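/- Let $(M,g)$ be a smooth (Hausdorff, second countable) $(n+1)$-dimensional Lorentzian manifold with $s\ge 1$ linearly independent, pairwise commuting Killing vector fields $K_0,\dots,K_{s-1}$. Write $K_\mu$ also for the one-form $g(K_\mu,\cdot)$, and set $$\mathcal Z=\{K_0\wedge\dots\wedge K_{s-1}=0\},\qquad W=-\det\big(g(K_\mu,K_\nu)\big)_{\mu,\nu=0,\dots,s-1},\qquad h_{ij}=g(K_i,K_j),\quad i,j=1,\dots,s-1 .$$ Assume: 1. (orthogonal integrability) $dK_\mu\wedge K_0\wedge\dots\wedge K_{s-1}=0$ for all $\mu=0,\dots,s-1$; 2. (stratification) the intersection of $\mathcal Z$ with any embedded null hypersurface $N$ is a stratified submanifold of $N$ (a closed subset of $N$ which is the disjoint union of a locally finite family of embedded submanifolds, the strata) all of whose strata have codimension at least two in $N$; 3. each $K_i$, $i=1,\dots,s-1$, is spacelike wherever it does not vanish. Let $p\in\{W=0\}\setminus\mathcal Z$ be such that the matrix $h(p)$ is invertible (this is automatic if $s=1$, or if $K_1(p),\dots,K_{s-1}(p)$ span a spacelike subspace), let $h^{ij}$ be the inverse matrix, and let $l_p$ be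 the Killing vector field $$l_p=K_0-\sum_{i,j=1}^{s-1}\big(h^{ij}g(K_0,K_i)\big)\big|_p\,K_j ,$$ with constant coefficients evaluated at $p$. Put $$E_p=\overline{\{q\in M\setminus\mathcal Z:\ g(l_p,l_p)|_q=0,\ W(q)=0\}}\ \setminus\ \{q\in M:\ l_p(q)=0\}.$$ Then $p\in E_p$, so $E_p$ is non-empty, and the distribution $l_p^\perp\subset TM$ of vectors orthogonal to $l_p$ is integrable over $E_p$: through each point of $E_p$ there passes a connected injectively immersed hypersurface contained in $E_p$ with tangent spaces $l_p^\perp$. Moreover, through each $q\in E_p$ (in particular through $p$) there passes a maximal leaf over $\{W=0\}$: a connected integral manifold $\hat S\subset\{W=0\}$ of $l_p^\perp$ containing every connected integral manifold of $l_p^\perp$ in $\{W=0\}$ that meets it. Every such maximal leaf $\hat S$ meeting $E_p$ is contained in $E_p$ and is a Killing prehorizon of $l_p$, that is, a connected, not necessarily embedded, null hypersurface contained in $\{g(l_p,l_p)=0,\ l_p\ne0\}$ to which $l_p$ is tangent; and $\hat S$ is totally geodesic in $M\setminus\{l_p=0\}$: every geodesic of $M\setminus\{l_p=0\}$, defined on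 an open interval, which is tangent to $\hat S$ at one of its points stays in $\hat S$. -/

import Mathlib

open scoped Manifold ContDiff

attribute [-instance] TopCat.of.chartedSpace

noncomputable section

namespace LorentzGeom

universe u

/-- The model space of an `m`-dimensional manifold. -/
abbrev Model (m : ℕ) : Type := EuclideanSpace ℝ (Fin m)

section Submanifolds

/-- An injectively immersed smooth `k`-dimensional submanifold, without boundary and not
necessarily embedded, of the smooth `m`-dimensional manifold `M`: a smooth `k`-manifold together
with an injective smooth immersion into `M`.  The Hausdorff property of the submanifold is
inherited from `M`, and so is second countability when the submanifold is connected. -/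
structure ImmersedSubmanifold (k m : ℕ) (M : Type u) [TopologicalSpace M]
    [ChartedSpace (Model m) M] where
  carrier : Type u
  [topologicalSpace : TopologicalSpace carrier]
  [chartedSpace : ChartedSpace (Model k) carrier]
  [isManifold : IsManifold (𝓡 k) ∞ carrier]
  incl : carrier → M
  injective : Function.Injective incl
  isImmersion : Manifold.IsImmersion (𝓡 k) (𝓡 m) ∞ incl

attribute [instance] ImmersedSubmanifold.topologicalSpace ImmersedSubmanifold.chartedSpace
  ImmersedSubmanifold.isManifold

variable {k m : ℕ} {M : Type u} [TopologicalSpace M] [ChartedSpace (Model m) M]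

/-- The underlying subset of `M`. -/
def ImmersedSubmanifold.support (S : ImmersedSubmanifold k m M) : Set M := Set.range S.incl

/-- The submanifold is embedded: its own topology is the one induced from `M`. -/
def ImmersedSubmanifold.IsEmbedded (S : ImmersedSubmanifold k m M) : Prop :=
  Topology.IsEmbedding S.incl

/-- The tangent space of a submanifold at one of its points, as a subspace of the tangent space
of `M`. -/
def ImmersedSubmanifold.tangent (S : ImmersedSubmanifold k m M) (x : S.carrier) :
    Submodule ℝ (TangentSpace (𝓡 m) (S.incl x)) :=
  LinearMap.range (mfderiv (𝓡 k) (𝓡 m) S.incl x).toLinearMap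

/-- `A` is a stratified submanifold of the `m`-manifold `M`, all of whose strata have codimension
at least `c`: `A` is closed and is the disjoint union of a locally finite family of embedded
submanifolds of codimension at least `c`.  (No frontier or Whitney condition is imposed.) -/
def IsStratifiedOfCodimGE (m : ℕ) {M : Type u} [TopologicalSpace M] [ChartedSpace (Model m) M]
    (A : Set M) (c : ℕ) : Prop :=
  IsClosed A ∧ ∃ (ι : Type u) (dim : ι → ℕ) (S : ∀ i, ImmersedSubmanifold (dim i) m M),
    (∀ i, (S i).IsEmbedded ∧ dim i + c ≤ m) ∧
    Pairwise (fun i j => Disjoint (S i).support (S j).support) ∧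
    LocallyFinite (fun i => (S i).support) ∧
    A = ⋃ i, (S i).support

end Submanifolds

section VectorFields

variable {m : ℕ} {M : Type u} [TopologicalSpace M] [ChartedSpace (Model m) M]

/-- Smooth vector fields on `M`. -/
def IsSmoothField [IsManifold (𝓡 m) ∞ M] (X : ∀ x : M, TangentSpace (𝓡 m) x) : Prop :=
  ContMDiff (𝓡 m) ((𝓡 m).prod 𝓘(ℝ, Model m)) ∞
    (fun x => (Bundle.TotalSpace.mk x (X x) : TangentBundle (𝓡 m) M))

/-- The derivative `X f` of the function `f` along the vector field `X`. -/
def dirDeriv (X : ∀ x : M, TangentSpace (𝓡 m) x) (f : M → ℝ) (x : M) : ℝ :=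
  mfderiv (𝓡 m) 𝓘(ℝ, ℝ) f x (X x)

/-- The exterior derivative of a one-form, evaluated on two vector fields:
`dα(X, Y) = X(α(Y)) - Y(α(X)) - α([X, Y])`. -/
def extDerivOneForm (α : ∀ x : M, TangentSpace (𝓡 m) x → ℝ)
    (X Y : ∀ x : M, TangentSpace (𝓡 m) x) (x : M) : ℝ :=
  dirDeriv X (fun y => α y (Y y)) x - dirDeriv Y (fun y => α y (X y)) x
    - α x (VectorField.mlieBracket (𝓡 m) X Y x)

end VectorFields

/-- A smooth Lorentzian metric, of signature `(-, +, …, +)`, on an `(n+1)`-dimensional manifold. -/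
structure LorentzianMetric (n : ℕ) (M : Type u) [TopologicalSpace M]
    [ChartedSpace (Model (n + 1)) M] [IsManifold (𝓡 (n + 1)) ∞ M] where
  val : ∀ x : M, TangentSpace (𝓡 (n + 1)) x →L[ℝ] TangentSpace (𝓡 (n + 1)) x →L[ℝ] ℝ
  symm : ∀ (x : M) (v w : TangentSpace (𝓡 (n + 1)) x), val x v w = val x w v
  signature : ∀ x : M, ∃ b : Module.Basis (Fin (n + 1)) ℝ (TangentSpace (𝓡 (n + 1)) x),
    ∀ i j, val x (b i) (b j) = if i = j then (if i = 0 then -1 else 1) else 0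
  smooth : ContMDiff (𝓡 (n + 1))
    ((𝓡 (n + 1)).prod 𝓘(ℝ, Model (n + 1) →L[ℝ] Model (n + 1) →L[ℝ] ℝ)) ∞
    (fun x => Bundle.TotalSpace.mk' (Model (n + 1) →L[ℝ] Model (n + 1) →L[ℝ] ℝ) x (val x))

namespace LorentzianMetric

variable {n : ℕ} {M : Type u} [TopologicalSpace M] [ChartedSpace (Model (n + 1)) M]
  [IsManifold (𝓡 (n + 1)) ∞ M] (g : LorentzianMetric n M)

/-- The function `g(X, Y)`. -/
def pair (X Y : ∀ x : M, TangentSpace (𝓡 (n + 1)) x) (x : M) : ℝ := g.val x (X x) (Y x)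

/-- Killing vector fields: smooth fields `K` with `ℒ_K g = 0`, that is,
`K(g(X, Y)) = g([K, X], Y) + g(X, [K, Y])` for all smooth vector fields `X`, `Y`. -/
def IsKilling (K : ∀ x : M, TangentSpace (𝓡 (n + 1)) x) : Prop :=
  IsSmoothField K ∧ ∀ X Y : ∀ x : M, TangentSpace (𝓡 (n + 1)) x,
    IsSmoothField X → IsSmoothField Y → ∀ x : M,
      dirDeriv K (g.pair X Y) x =
        g.pair (VectorField.mlieBracket (𝓡 (n + 1)) K X) Y x +
        g.pair X (VectorField.mlieBracket (𝓡 (n + 1)) K Y) x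

/-- A hypersurface is null if the metric induced on each of its tangent spaces is degenerate. -/
def IsNullHypersurface (N : ImmersedSubmanifold n (n + 1) M) : Prop :=
  ∀ x : N.carrier, ∃ v ∈ N.tangent x, v ≠ 0 ∧ ∀ w ∈ N.tangent x, g.val (N.incl x) v w = 0

/-- A Killing prehorizon of the Killing vector field `K`: a connected, not necessarily embedded,
null hypersurface contained in `{g(K, K) = 0, K ≠ 0}`, to which `K` is tangent. -/
def IsKillingPrehorizon (K : ∀ x : M, TangentSpace (𝓡 (n + 1)) x)
    (N : ImmersedSubmanifold n (n + 1) M) : Prop :=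
  g.IsKilling K ∧ ConnectedSpace N.carrier ∧ g.IsNullHypersurface N ∧
    N.support ⊆ {x | g.pair K K x = 0 ∧ K x ≠ 0} ∧
    ∀ x : N.carrier, K (N.incl x) ∈ N.tangent x

/-- The coordinate expression of the metric in the chart of `M` at `x₀`. -/
def inChart (x₀ : M) (y u v : Model (n + 1)) : ℝ :=
  g.val ((extChartAt (𝓡 (n + 1)) x₀).symm y)
    (mfderiv 𝓘(ℝ, Model (n + 1)) (𝓡 (n + 1)) (extChartAt (𝓡 (n + 1)) x₀).symm y u)
    (mfderiv 𝓘(ℝ, Model (n + 1)) (𝓡 (n + 1)) (extChartAt (𝓡 (n + 1)) x₀).symm y v)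

/-- Christoffel symbols of the first kind of the Levi-Civita connection in the chart at `x₀`:
`Γ(u, v; w) = (∂_u g(v, w) + ∂_v g(u, w) - ∂_w g(u, v)) / 2`. -/
def christoffel (x₀ : M) (y u v w : Model (n + 1)) : ℝ :=
  (fderiv ℝ (fun z => g.inChart x₀ z v w) y u + fderiv ℝ (fun z => g.inChart x₀ z u w) y v
    - fderiv ℝ (fun z => g.inChart x₀ z u v) y w) / 2

/-- Affinely parametrized geodesics on the open set `J` of parameters: twice continuously
differentiable curves whose coordinate expression `c` in the chart at `γ t` satisfies, at the
parameter `t`, the geodesic equation `g(c'', w) + Γ(c', c'; w) = 0` for all `w`. -/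
def IsGeodesicOn (γ : ℝ → M) (J : Set ℝ) : Prop :=
  ContMDiffOn 𝓘(ℝ, ℝ) (𝓡 (n + 1)) 2 γ J ∧ ∀ t ∈ J, ∀ w : Model (n + 1),
    let c : ℝ → Model (n + 1) := fun τ => extChartAt (𝓡 (n + 1)) (γ t) (γ τ)
    g.inChart (γ t) (c t) (deriv (deriv c) t) w
      + g.christoffel (γ t) (c t) (deriv c t) (deriv c t) w = 0

/-- `N` is totally geodesic in the open set `O`: every geodesic of `O`, defined on an open
interval, which at one parameter passes through a point of `N` in a direction tangent to `N`,
stays in `N`. -/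
def IsTotallyGeodesicIn {k : ℕ} (N : ImmersedSubmanifold k (n + 1) M) (O : Set M) : Prop :=
  ∀ (γ : ℝ → M) (J : Set ℝ) (t₀ : ℝ), IsOpen J → J.OrdConnected → t₀ ∈ J →
    g.IsGeodesicOn γ J → Set.MapsTo γ J O →
    tangentMap 𝓘(ℝ, ℝ) (𝓡 (n + 1)) γ (Bundle.TotalSpace.mk t₀ (1 : ℝ)) ∈
      Set.range (tangentMap (𝓡 k) (𝓡 (n + 1)) N.incl) →
    Set.MapsTo γ J N.support

/-- `N` is a connected integral manifold, contained in `F`, of the distribution `l^⊥` of vectors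
orthogonal to the vector field `l`.  Zeros of `l` never lie on `N`, for dimensional reasons. -/
def IsIntegralManifold (l : ∀ x : M, TangentSpace (𝓡 (n + 1)) x) (F : Set M)
    (N : ImmersedSubmanifold n (n + 1) M) : Prop :=
  ConnectedSpace N.carrier ∧ N.support ⊆ F ∧
    ∀ (x : N.carrier) (v : TangentSpace (𝓡 (n + 1)) (N.incl x)),
      v ∈ N.tangent x ↔ g.val (N.incl x) (l (N.incl x)) v = 0

/-- The distribution `l^⊥` is integrable over `F`: there is an integral manifold of it, contained
in `F`, through each point of `F`. -/
def IsIntegrableOver (l : ∀ x : M, TangentSpace (𝓡 (n + 1)) x) (F : Set M) : Prop :=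
  ∀ q ∈ F, ∃ N : ImmersedSubmanifold n (n + 1) M, g.IsIntegralManifold l F N ∧ q ∈ N.support

/-- `N` is a maximal leaf of `l^⊥` over `F`: a connected integral manifold contained in `F` which
contains every connected integral manifold contained in `F` that meets it. -/
def IsMaximalLeaf (l : ∀ x : M, TangentSpace (𝓡 (n + 1)) x) (F : Set M)
    (N : ImmersedSubmanifold n (n + 1) M) : Prop :=
  g.IsIntegralManifold l F N ∧ ∀ N' : ImmersedSubmanifold n (n + 1) M,
    g.IsIntegralManifold l F N' → (N'.support ∩ N.support).Nonempty → N'.support ⊆ N.support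

section KillingFamily

/- A family of `s = r + 1` fields `K₀, K₁, …, K_{s-1}`; the fields `K_i` with `1 ≤ i ≤ s - 1`
are `K i.succ` for `i : Fin r`. -/
variable {r : ℕ} (K : Fin (r + 1) → ∀ x : M, TangentSpace (𝓡 (n + 1)) x)

/-- The orthogonal integrability condition `dK_μ ∧ K₀ ∧ ⋯ ∧ K_{s-1} = 0` for all `μ`, where the
vector fields are identified with one-forms by means of `g`.  Up to a positive normalization
factor the wedge product is evaluated on vector fields by antisymmetrization. -/
def OrthogonallyIntegrable : Prop :=
  ∀ (μ : Fin (r + 1)) (X : Fin (r + 1 + 2) → ∀ x : M, TangentSpace (𝓡 (n + 1)) x),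
    (∀ a, IsSmoothField (X a)) → ∀ x : M,
      ∑ σ : Equiv.Perm (Fin (r + 1 + 2)), ((Equiv.Perm.sign σ : ℤ) : ℝ) *
        (extDerivOneForm (fun y v => g.val y (K μ y) v) (X (σ 0)) (X (σ 1)) x *
          ∏ ν : Fin (r + 1), g.pair (K ν) (X (σ ν.succ.succ)) x) = 0

/-- The degeneracy set `{K₀ ∧ ⋯ ∧ K_{s-1} = 0}`. -/
def degeneracySet : Set M :=
  {x | ExteriorAlgebra.ιMulti ℝ (r + 1) (fun μ => K μ x) = 0}

/-- The intersection of the degeneracy set with any (embedded) null hypersurface `N` is a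
stratified submanifold of `N`, with `N`-codimension at least two. -/
def DegeneracyStratified : Prop :=
  ∀ N : ImmersedSubmanifold n (n + 1) M, N.IsEmbedded → g.IsNullHypersurface N →
    IsStratifiedOfCodimGE n (N.incl ⁻¹' degeneracySet K) 2

/-- The area function `W = - det (g(K_μ, K_ν))`. -/
def areaFunction (x : M) : ℝ :=
  - (Matrix.of fun μ ν : Fin (r + 1) => g.pair (K μ) (K ν) x).det

/-- The matrix `h_{ij} = g(K_i, K_j)`, `i, j = 1, …, s - 1`. -/
def gram (x : M) : Matrix (Fin r) (Fin r) ℝ :=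
  Matrix.of fun i j => g.pair (K i.succ) (K j.succ) x

/-- The field `l_p = K₀ - (h^{ij} g(K₀, K_i))|_p K_j`, with coefficients frozen at `p`. -/
def generator (p x : M) : TangentSpace (𝓡 (n + 1)) x :=
  K 0 x - ∑ i : Fin r, ∑ j : Fin r,
    ((g.gram K p)⁻¹ i j * g.pair (K 0) (K i.succ) p) • K j.succ x

/-- The closure of `{g(l_p, l_p) = 0 = W}` off the degeneracy set, with the zeros of `l_p`
removed. -/
def horizonSet (p : M) : Set M :=
  closure {q | q ∉ degeneracySet K ∧ g.pair (g.generator K p) (g.generator K p) q = 0 ∧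
      g.areaFunction K q = 0} \
    {q | g.generator K p q = 0}

end KillingFamily

end LorentzianMetric

end LorentzGeom

end

/-!
Write `l = ∑ c μ • K μ` for the generator, with its constant coefficients `c`, and call a point
regular if the fields `K μ` are linearly independent there and all orthogonal to `l`.  In Lorentzian
signature a vector which is null and orthogonal to the null vector `l` is a multiple of `l`, so off
the degeneracy set the equations `g(l, l) = 0` and `W = 0` together say exactly that the point is
regular (`regularPoints_eq`).  Thus `E_p` is the closure of the set of regular points with the
zeros of `l` removed (`horizonSet_eq`), and `p` itself is regular (`mem_regularPoints`).

*Involutivity.*  At a regular point, orthogonal integrability and the commutation relations give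
`dθ = 0` on `ker θ`, where `θ = g(l, ·)` (`IsKillingSystem.extDeriv_eq_zero_of_mem_regularSet`), and
this passes to the closure.  Since it is known on a closed set only, the theorem of Frobenius does
not apply; integral manifolds are swept out by geodesics instead.

*Geodesics.*  A geodesic `γ` which is orthogonal to `l` at one parameter is so throughout, because
`g(l, γ')` is conserved.  If it starts at a regular point, it stays in the closure of the set of
regular points (`IsKillingSystem.geodesic_mem_closure`).  Indeed, along `γ` the functions
`g(K μ, l)` satisfy a linear system of differential inequalities as long as the fields stay
independent.  At a parameter where `γ` meets the degeneracy set, the fields vanishing there have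
derivatives along `γ` which are independent modulo the span of all the fields: otherwise such a
field would solve the Jacobi equation with the same data as a multiple of `l`, hence would be
proportional to `l` at the regular starting point (`IsKillingSystem.eq_zero_of_fderiv_mem_range`).
Dividing these fields by the parameter therefore gives a frame which remains independent, the
geodesic leaves the degeneracy set at once, and the differential inequality acquires a simple pole
only (`IsKillingSystem.extDeriv_le_near`).  The functions `g(K μ, l)` are smooth and vanish before
the pole, so they vanish to infinite order at it, and a Gronwall argument on dyadic intervals shows
that they vanish after it (`IsKillingSystem.eventually_mem_regularSet`).  By continuous dependence
on initial data, geodesics orthogonal to `l` which issue from a limit of regular points consist of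
such limits (`IsKillingSystem.flow_mem_closure`).

*Integral manifolds.*  Let `q` be a limit of regular points with `l ≠ 0`.  For two geodesics issuing
from `q` orthogonally to `l`, the value of `θ` on the chord joining them satisfies, by involutivity
along the first of them, a Gronwall inequality with a quadratic error
(`IsKillingSystem.abs_deriv_inclination_le`).  Hence the chords of the set swept out by these
geodesics are tangent to `ker θ` to second order, and the set is the graph of a smooth function
which is an integral manifold (`exists_integral_graph`, `IsKillingSystem.exists_leaf`).  By
uniqueness for ordinary differential equations a curve tangent to `ker θ` cannot leave such a graph
sideways (`curve_mem_graph`).  Flattening the graphs gives charts of `M` adapted to the distribution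
(`exists_isAdaptedChart`).

*Leaves.*  The points joined to `q` by chains of slices of adapted charts form a leaf, with the
slices as charts of its own topology (`leaf`, `IsLeafSet.core`, `IsLeafSet.submanifold`).  A map
from a connected domain with derivative orthogonal to `l` cannot leave a leaf as long as it avoids
the zeros of `l`, since adapted charts exist also at the limit points of the leaf
(`IsLeafSet.mapsTo`).  Applied to the inclusions of integral manifolds, on which `l` has no zeros for
dimensional reasons, this gives maximality over `{W = 0}`; applied to geodesics, it gives that the
leaves are totally geodesic in `{l ≠ 0}`.
-/

namespace KillingGeometry

open Set Filter Topology
set_option synthInstance.maxHeartbeats 400000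
set_option maxSynthPendingDepth 4

/-! ### Killing systems in a normed space -/

section

variable {E V : Type*} [NormedAddCommGroup E] [NormedSpace ℝ E] [NormedAddCommGroup V]
  [NormedSpace ℝ V]

/-- The exterior derivative at `z` of the one-form `g (k b)`, where `k · b` is the vector field
with coefficients `b`. -/
noncomputable def extDeriv (g : E → E →L[ℝ] E →L[ℝ] ℝ) (k : E → V →L[ℝ] E) (z : E) (b : V)
    (u v : E) : ℝ :=
  fderiv ℝ g z u (k z b) v + g z (fderiv ℝ k z u b) v - fderiv ℝ g z v (k z b) u
    - g z (fderiv ℝ k z v b) u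

/-- The coordinate form of the geometric data: a smooth metric `g` on the open set `Ω`, and a
linear family `k · b`, `b ∈ V`, of commuting Killing fields satisfying the orthogonal
integrability condition wherever the family is linearly independent.  Of the Lorentzian signature
only non-degeneracy and the definiteness of `g` modulo `l` on the orthogonal complement of a null
vector `l` are recorded. -/
structure IsKillingSystem (Ω : Set E) (g : E → E →L[ℝ] E →L[ℝ] ℝ) (k : E → V →L[ℝ] E) :
    Prop where
  isOpen : IsOpen Ω
  smooth_metric : ContDiffOn ℝ ∞ g Ω
  smooth_field : ContDiffOn ℝ ∞ k Ω
  symm : ∀ z ∈ Ω, ∀ u v, g z u v = g z v u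
  nondeg : ∀ z ∈ Ω, ∀ u, (∀ v, g z u v = 0) → u = 0
  null : ∀ z ∈ Ω, ∀ l v, l ≠ 0 → g z l l = 0 → g z l v = 0 → g z v v = 0 → ∃ a : ℝ, v = a • l
  killing : ∀ z ∈ Ω, ∀ b u v, fderiv ℝ g z (k z b) u v + g z (fderiv ℝ k z u b) v
    + g z u (fderiv ℝ k z v b) = 0
  comm : ∀ z ∈ Ω, ∀ b b', fderiv ℝ k z (k z b) b' = fderiv ℝ k z (k z b') b
  orth : ∀ z ∈ Ω, Function.Injective (k z) → ∀ b u v, (∀ b', g z (k z b') u = 0) →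
    (∀ b', g z (k z b') v = 0) → extDeriv g k z b u v = 0

/-- The points at which the family is linearly independent and the field with coefficients `c` is
orthogonal to all its members (hence null). -/
def regularSet (Ω : Set E) (g : E → E →L[ℝ] E →L[ℝ] ℝ) (k : E → V →L[ℝ] E) (c : V) : Set E :=
  {z ∈ Ω | Function.Injective (k z) ∧ ∀ b, g z (k z b) (k z c) = 0}

/-- For a linear map `L` whose value `L c` is orthogonal to its range, the bilinear form
`g (L b) (L b') + ξ b * ξ b'` on the source of `L`: the Gram form, made non-degenerate. -/
noncomputable def borderedGram (G : E →L[ℝ] E →L[ℝ] ℝ) (L : V →L[ℝ] E) (ξ : V →L[ℝ] ℝ) :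
    V →L[ℝ] V →L[ℝ] ℝ :=
  ((G.comp L).flip.comp L).flip + ξ.smulRight ξ

lemma borderedGram_apply (G : E →L[ℝ] E →L[ℝ] ℝ) (L : V →L[ℝ] E) (ξ : V →L[ℝ] ℝ) (b b' : V) :
    borderedGram G L ξ b b' = G (L b) (L b') + ξ b * ξ b' := by
  simp [borderedGram]

namespace IsKillingSystem

variable {Ω : Set E} {g : E → E →L[ℝ] E →L[ℝ] ℝ} {k : E → V →L[ℝ] E} {z : E}

lemma hasFDerivAt_metric (S : IsKillingSystem Ω g k) (hz : z ∈ Ω) :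
    HasFDerivAt g (fderiv ℝ g z) z :=
  ((S.smooth_metric.contDiffAt (S.isOpen.mem_nhds hz)).differentiableAt (by simp)).hasFDerivAt

lemma hasFDerivAt_field (S : IsKillingSystem Ω g k) (hz : z ∈ Ω) :
    HasFDerivAt k (fderiv ℝ k z) z :=
  ((S.smooth_field.contDiffAt (S.isOpen.mem_nhds hz)).differentiableAt (by simp)).hasFDerivAt

lemma hasFDerivAt_metric_apply (S : IsKillingSystem Ω g k) (hz : z ∈ Ω) (v w : E) :
    HasFDerivAt (fun y => g y v w) (((fderiv ℝ g z).flip v).flip w) z := by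
  have h := ((S.hasFDerivAt_metric hz).clm_apply (hasFDerivAt_const v z)).clm_apply
    (hasFDerivAt_const w z)
  refine h.congr_fderiv ?_
  ext u; simp

lemma fderiv_metric_symm (S : IsKillingSystem Ω g k) (hz : z ∈ Ω) (u v w : E) :
    fderiv ℝ g z u v w = fderiv ℝ g z u w v := by
  have h1 := S.hasFDerivAt_metric_apply hz v w
  have h2 := S.hasFDerivAt_metric_apply hz w v
  have : (fun y => g y v w) =ᶠ[𝓝 z] fun y => g y w v := by
    filter_upwards [S.isOpen.mem_nhds hz] with y hy using S.symm y hy v w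
  have := (h2.congr_of_eventuallyEq this).unique h1
  simpa using (congrArg (fun f => f u) this).symm

lemma extDeriv_swap (z : E) (b : V) (u v : E) :
    extDeriv g k z b u v = - extDeriv g k z b v u := by
  simp only [extDeriv]; ring

/-- Cartan's formula for a commuting Killing family: the contraction of `d(g (k b))` with `k b'`
is `-d(g (k b) (k b'))`. -/
lemma extDeriv_field (S : IsKillingSystem Ω g k) (hz : z ∈ Ω) (b b' : V) (v : E) :
    extDeriv g k z b (k z b') v =
      -(fderiv ℝ g z v (k z b) (k z b') + g z (fderiv ℝ k z v b) (k z b')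
        + g z (k z b) (fderiv ℝ k z v b')) := by
  have h1 := S.killing z hz b' (k z b) v
  have h2 := S.comm z hz b b'
  rw [h2] at h1
  simp only [extDeriv]
  linarith

lemma extDeriv_field_comm (S : IsKillingSystem Ω g k) (hz : z ∈ Ω) (b b' : V) (v : E) :
    extDeriv g k z b (k z b') v = extDeriv g k z b' (k z b) v := by
  rw [S.extDeriv_field hz, S.extDeriv_field hz, S.fderiv_metric_symm hz v (k z b),
    S.symm z hz (fderiv ℝ k z v b), S.symm z hz (k z b)]
  ring

lemma extDeriv_field_field (S : IsKillingSystem Ω g k) (hz : z ∈ Ω) (b b₁ b₂ : V) :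
    extDeriv g k z b (k z b₁) (k z b₂) = 0 := by
  -- symmetric in the first two arguments, antisymmetric in the last two
  have h1 := S.extDeriv_field_comm hz b b₁ (k z b₂)
  have h2 := S.extDeriv_field_comm hz b b₂ (k z b₁)
  have h3 := S.extDeriv_field_comm hz b₁ b₂ (k z b)
  have a1 := extDeriv_swap (g := g) (k := k) z b (k z b₁) (k z b₂)
  have a2 := extDeriv_swap (g := g) (k := k) z b₁ (k z b) (k z b₂)
  have a3 := extDeriv_swap (g := g) (k := k) z b₂ (k z b) (k z b₁)
  linarith

lemma extDeriv_smul_right (b : V) (a : ℝ) (u v : E) :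
    extDeriv g k z b u (a • v) = a * extDeriv g k z b u v := by
  simp only [extDeriv, map_smul, smul_apply, smul_eq_mul]; ring

lemma extDeriv_sub_right (b : V) (u v w : E) :
    extDeriv g k z b u (v - w) = extDeriv g k z b u v - extDeriv g k z b u w := by
  simp only [extDeriv, map_sub, sub_apply]; ring

lemma extDeriv_sub_left (b : V) (u v w : E) :
    extDeriv g k z b (v - w) u = extDeriv g k z b v u - extDeriv g k z b w u := by
  simp only [extDeriv, map_sub, sub_apply]; ring

/-- The bordered Gram form is non-degenerate: a null vector of the Gram form is a multiple of `c`,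
because `g` is definite modulo `L c` on the orthogonal complement of `L c`. -/
lemma borderedGram_injective (S : IsKillingSystem Ω g k) (hz : z ∈ Ω) {L : V →L[ℝ] E}
    (hL : Function.Injective L) {c : V} (hc : L c ≠ 0) (horth : ∀ b, g z (L b) (L c) = 0)
    {ξ : V →L[ℝ] ℝ} (hξ : ξ c = 1) : Function.Injective (borderedGram (g z) L ξ) := by
  rw [injective_iff_map_eq_zero]
  intro b hb
  have hb' : ∀ b', g z (L b) (L b') + ξ b * ξ b' = 0 := fun b' => by
    rw [← borderedGram_apply, hb]; rfl
  have h0 : ξ b = 0 := by simpa [horth, hξ] using hb' c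
  obtain ⟨a, ha⟩ := S.null z hz (L c) (L b) hc (horth c)
    (by rw [S.symm z hz]; exact horth b) (by simpa [h0] using hb' b)
  have : b = a • c := hL (by simpa using ha)
  rw [this] at h0 ⊢
  simp only [map_smul, hξ, smul_eq_mul, mul_one] at h0
  simp [h0]

/-- In finite dimension, injectivity gives that every functional on the coefficients is in the
image of the bordered Gram form. -/
lemma borderedGram_bijective [FiniteDimensional ℝ V] (S : IsKillingSystem Ω g k) (hz : z ∈ Ω)
    {L : V →L[ℝ] E}
    (hL : Function.Injective L) {c : V} (hc : L c ≠ 0) (horth : ∀ b, g z (L b) (L c) = 0)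
    {ξ : V →L[ℝ] ℝ} (hξ : ξ c = 1) : Function.Bijective (borderedGram (g z) L ξ) := by
  have hi := S.borderedGram_injective hz hL hc horth hξ
  refine ⟨hi, ?_⟩
  have hfin : Module.finrank ℝ V = Module.finrank ℝ (V →L[ℝ] ℝ) := by
    rw [← LinearMap.toContinuousLinearMap.finrank_eq (R := ℝ) (M := V →ₗ[ℝ] ℝ)]
    exact (Subspace.dual_finrank_eq (K := ℝ) (V := V)).symm
  exact (LinearMap.injective_iff_surjective_of_finrank_eq_finrank (f :=
    (borderedGram (g z) L ξ).toLinearMap) hfin).1 hi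

/-- At a regular point, every vector orthogonal to `k c` becomes orthogonal to the whole family
after subtraction of a member of the family: the bordered Gram form is surjective. -/
lemma exists_orthogonal_correction [FiniteDimensional ℝ V] (S : IsKillingSystem Ω g k)
    {c : V} (hz : z ∈ regularSet Ω g k c) (hc : k z c ≠ 0) {v : E} (hv : g z (k z c) v = 0) :
    ∃ b, ∀ b', g z (k z b') (v - k z b) = 0 := by
  obtain ⟨hzΩ, hinj, horth⟩ := hz
  have hc0 : c ≠ 0 := fun h => hc (by simp [h])
  obtain ⟨ξ, hξ⟩ := SeparatingDual.exists_eq_one (R := ℝ) hc0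
  obtain ⟨b, hb⟩ := (S.borderedGram_bijective hzΩ hinj hc horth hξ).2
    (((g z).flip v).comp (k z))
  have hb' : ∀ b', g z (k z b) (k z b') + ξ b * ξ b' = g z (k z b') v := fun b' => by
    rw [← borderedGram_apply, hb]; simp
  have h0 : ξ b = 0 := by simpa [horth, hξ, hv] using hb' c
  refine ⟨b, fun b' => ?_⟩
  have := hb' b'
  rw [h0, S.symm z hzΩ (k z b)] at this
  rw [map_sub]; linarith

/-- At a regular point, the contractions of `d(g (k b))` with the null field `k c` vanish on the
orthogonal complement of the latter. -/
lemma extDeriv_null_eq_zero [FiniteDimensional ℝ V] (S : IsKillingSystem Ω g k)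
    {c : V} (hz : z ∈ regularSet Ω g k c) (hc : k z c ≠ 0) (b : V) {v : E}
    (hv : g z (k z c) v = 0) : extDeriv g k z b (k z c) v = 0 := by
  obtain ⟨b', hb'⟩ := S.exists_orthogonal_correction hz hc hv
  have h1 := S.extDeriv_field_field hz.1 b c b'
  have h2 := S.orth z hz.1 hz.2.1 b (k z c) (v - k z b') hz.2.2 hb'
  rw [extDeriv_sub_right] at h2
  linarith

/-- The distribution orthogonal to `k · c` is involutive at the regular points. -/
lemma extDeriv_eq_zero_of_mem_regularSet [FiniteDimensional ℝ V] (S : IsKillingSystem Ω g k)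
    {c : V} (hz : z ∈ regularSet Ω g k c) (hc : k z c ≠ 0) {u v : E} (hu : g z (k z c) u = 0)
    (hv : g z (k z c) v = 0) : extDeriv g k z c u v = 0 := by
  obtain ⟨hzΩ, hinj, horth⟩ := id hz
  have hsym := S.symm z hzΩ
  have key : ∀ b v, g z (k z c) v = 0 → extDeriv g k z c (k z b) v = 0 := fun b v hv => by
    rw [S.extDeriv_field_comm hzΩ]
    exact S.extDeriv_null_eq_zero hz hc b hv
  obtain ⟨b, hb⟩ := S.exists_orthogonal_correction hz hc hu
  obtain ⟨b', hb'⟩ := S.exists_orthogonal_correction hz hc hv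
  have h := S.orth z hzΩ hinj c (u - k z b) (v - k z b') hb hb'
  rw [extDeriv_sub_left, key b _ (by rw [hsym]; simpa [hsym] using hb' c), extDeriv_sub_right,
    extDeriv_swap z c u (k z b'), key b' u hu] at h
  linarith

end IsKillingSystem

end

/-! ### Geodesics and the Jacobi equation of Killing fields -/

section

variable {E V : Type*} [NormedAddCommGroup E] [NormedSpace ℝ E] [NormedAddCommGroup V]
  [NormedSpace ℝ V]

/-- The geodesic equation for the velocity `X` and the acceleration `a` at the point `z`. -/
def GeodesicEq (g : E → E →L[ℝ] E →L[ℝ] ℝ) (z X a : E) : Prop :=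
  ∀ w, g z a w + fderiv ℝ g z X X w - fderiv ℝ g z w X X / 2 = 0

/-- The one-form `w ↦ g(Y'', w)` for a Jacobi field with value `Y` and coordinate derivative `Y₁`
along a geodesic with velocity `X` and acceleration `a`: minus the linearization of the geodesic
equation, the term with the second derivative being left out. -/
noncomputable def jacobiForm (g : E → E →L[ℝ] E →L[ℝ] ℝ) (z X a Y Y₁ w : E) : ℝ :=
  -(fderiv ℝ g z Y a w + fderiv ℝ (fderiv ℝ g) z Y X X w
    - fderiv ℝ (fderiv ℝ g) z Y w X X / 2
    + (fderiv ℝ g z Y₁ X w + fderiv ℝ g z X Y₁ w - fderiv ℝ g z w Y₁ X))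

namespace IsKillingSystem

variable {Ω : Set E} {g : E → E →L[ℝ] E →L[ℝ] ℝ} {k : E → V →L[ℝ] E} {z : E}

lemma contDiffOn_fderiv_metric (S : IsKillingSystem Ω g k) : ContDiffOn ℝ ∞ (fderiv ℝ g) Ω :=
  S.smooth_metric.fderiv_of_isOpen S.isOpen (by simp)

lemma contDiffOn_fderiv_field (S : IsKillingSystem Ω g k) : ContDiffOn ℝ ∞ (fderiv ℝ k) Ω :=
  S.smooth_field.fderiv_of_isOpen S.isOpen (by simp)

lemma hasFDerivAt_fderiv_metric (S : IsKillingSystem Ω g k) (hz : z ∈ Ω) :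
    HasFDerivAt (fderiv ℝ g) (fderiv ℝ (fderiv ℝ g) z) z :=
  ((S.contDiffOn_fderiv_metric.contDiffAt (S.isOpen.mem_nhds hz)).differentiableAt
    (by simp)).hasFDerivAt

lemma hasFDerivAt_fderiv_field (S : IsKillingSystem Ω g k) (hz : z ∈ Ω) :
    HasFDerivAt (fderiv ℝ k) (fderiv ℝ (fderiv ℝ k) z) z :=
  ((S.contDiffOn_fderiv_field.contDiffAt (S.isOpen.mem_nhds hz)).differentiableAt
    (by simp)).hasFDerivAt

lemma fderiv_fderiv_field_comm (S : IsKillingSystem Ω g k) (hz : z ∈ Ω) (u v : E) :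
    fderiv ℝ (fderiv ℝ k) z u v = fderiv ℝ (fderiv ℝ k) z v u :=
  ((S.smooth_field.contDiffAt (S.isOpen.mem_nhds hz)).isSymmSndFDerivAt (by simp; exact WithTop.coe_le_coe.2 le_top)).eq u v

lemma fderiv_fderiv_metric_comm (S : IsKillingSystem Ω g k) (hz : z ∈ Ω) (u v : E) :
    fderiv ℝ (fderiv ℝ g) z u v = fderiv ℝ (fderiv ℝ g) z v u :=
  ((S.smooth_metric.contDiffAt (S.isOpen.mem_nhds hz)).isSymmSndFDerivAt (by simp; exact WithTop.coe_le_coe.2 le_top)).eq u v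

/-- `g(K, γ')` has vanishing derivative along a geodesic `γ`, for each Killing field `K`. -/
lemma geodesic_conservation (S : IsKillingSystem Ω g k) (hz : z ∈ Ω) {X a : E}
    (h : GeodesicEq g z X a) (b : V) :
    fderiv ℝ g z X (k z b) X + g z (fderiv ℝ k z X b) X + g z (k z b) a = 0 := by
  have h1 := h (k z b)
  have h2 := S.killing z hz b X X
  rw [S.symm z hz a, S.fderiv_metric_symm hz X X] at h1
  rw [S.symm z hz X] at h2
  linarith

/-- The derivative of the Killing equation. -/
lemma fderiv_killing (S : IsKillingSystem Ω g k) (hz : z ∈ Ω) (b : V) (u v w : E) :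
    fderiv ℝ (fderiv ℝ g) z u (k z b) v w + fderiv ℝ g z (fderiv ℝ k z u b) v w
      + fderiv ℝ g z u (fderiv ℝ k z v b) w + g z (fderiv ℝ (fderiv ℝ k) z u v b) w
      + fderiv ℝ g z u v (fderiv ℝ k z w b) + g z v (fderiv ℝ (fderiv ℝ k) z u w b) = 0 := by
  have hg := S.hasFDerivAt_metric hz
  have hk := S.hasFDerivAt_field hz
  have hg2 := S.hasFDerivAt_fderiv_metric hz
  have hk2 := S.hasFDerivAt_fderiv_field hz
  have c (x : E) := hasFDerivAt_const (𝕜 := ℝ) x z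
  have cb := hasFDerivAt_const (𝕜 := ℝ) b z
  have h1 := ((hg2.clm_apply (hk.clm_apply cb)).clm_apply (c v)).clm_apply (c w)
  have h2 := (hg.clm_apply ((hk2.clm_apply (c v)).clm_apply cb)).clm_apply (c w)
  have h3 := (hg.clm_apply (c v)).clm_apply ((hk2.clm_apply (c w)).clm_apply cb)
  have h := (h1.add h2).add h3
  have h0 : HasFDerivAt (fun _ : E => (0 : ℝ)) (0 : E →L[ℝ] ℝ) z := hasFDerivAt_const _ _
  have he : (fun _ : E => (0 : ℝ)) =ᶠ[𝓝 z] fun y => fderiv ℝ g y (k y b) v w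
      + g y (fderiv ℝ k y v b) w + g y v (fderiv ℝ k y w b) := by
    filter_upwards [S.isOpen.mem_nhds hz] with y hy
    exact (S.killing y hy b v w).symm
  have := congrArg (fun f => f u) ((h0.congr_of_eventuallyEq he.symm).unique h)
  simp at this
  linarith

/-- Killing fields satisfy the Jacobi equation along geodesics. -/
lemma jacobi (S : IsKillingSystem Ω g k) (hz : z ∈ Ω) {X a : E}
    (h : GeodesicEq g z X a) (b : V) (w : E) :
    g z (fderiv ℝ (fderiv ℝ k) z X X b + fderiv ℝ k z a b) w =
      jacobiForm g z X a (k z b) (fderiv ℝ k z X b) w := by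
  have h1 := S.fderiv_killing hz b X X w
  have h2 := S.fderiv_killing hz b w X X
  have h3 := S.killing z hz b a w
  have h4 := h (fderiv ℝ k z w b)
  have e1 := S.fderiv_metric_symm hz w X (fderiv ℝ k z X b)
  have e2 := S.symm z hz X (fderiv ℝ (fderiv ℝ k) z w X b)
  rw [S.fderiv_fderiv_field_comm hz w X] at h2 e2
  rw [S.fderiv_fderiv_metric_comm hz X] at h1
  rw [S.fderiv_fderiv_metric_comm hz w] at h2
  simp only [jacobiForm, map_add, add_apply]
  linarith

/-- For a Killing field `K = k b`, the contraction of `d(g K)` with `X` is twice the covariant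
derivative of `K` along `X`.  The left side is the term multiplying `f'` when the Jacobi operator is
applied to the product of a function `f` with `K`. -/
lemma extDeriv_eq_jacobi (S : IsKillingSystem Ω g k) (hz : z ∈ Ω) (b : V) (X w : E) :
    2 * g z (fderiv ℝ k z X b) w + (fderiv ℝ g z (k z b) X w + fderiv ℝ g z X (k z b) w
      - fderiv ℝ g z w (k z b) X) = extDeriv g k z b X w := by
  have h1 := S.killing z hz b X w
  simp only [extDeriv]
  rw [S.symm z hz X] at h1
  linarith

end IsKillingSystem

/-- Uniqueness for linear differential inequalities, in both directions of time. -/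
lemma eq_zero_of_norm_deriv_le {F : Type*} [NormedAddCommGroup F] [NormedSpace ℝ F] {f f' : ℝ → F}
    {C a b t₀ : ℝ} (hf : ∀ t ∈ Icc a b, HasDerivAt f (f' t) t)
    (hC : ∀ t ∈ Icc a b, ‖f' t‖ ≤ C * ‖f t‖) (ht₀ : t₀ ∈ Icc a b) (h0 : f t₀ = 0) :
    ∀ t ∈ Icc a b, f t = 0 := by
  intro t ht
  rcases le_total t₀ t with h | h
  · refine eq_zero_of_abs_deriv_le_mul_abs_self_of_eq_zero_right (f' := f') (K := C) (a := t₀)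
      (b := b) ?_ ?_ h0 ?_ t ⟨h, ht.2⟩
    · exact fun s hs => (hf s ⟨ht₀.1.trans hs.1, hs.2⟩).continuousAt.continuousWithinAt
    · exact fun s hs => (hf s ⟨ht₀.1.trans hs.1, hs.2.le⟩).hasDerivWithinAt
    · exact fun s hs => hC s ⟨ht₀.1.trans hs.1, hs.2.le⟩
  · have hd : ∀ s ∈ Icc (-t₀) (-a), HasDerivAt (fun s => f (-s)) (-f' (-s)) s := by
      intro s hs
      have h1 := hf (-s) ⟨by linarith [hs.2], by linarith [hs.1, ht₀.2]⟩
      have := h1.scomp s (hasDerivAt_neg s)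
      simpa [Function.comp_def] using this
    have := eq_zero_of_abs_deriv_le_mul_abs_self_of_eq_zero_right (f := fun s => f (-s))
      (f' := fun s => -f' (-s)) (K := C) (a := -t₀) (b := -a)
      (fun s hs => (hd s hs).continuousAt.continuousWithinAt)
      (fun s hs => (hd s ⟨hs.1, hs.2.le⟩).hasDerivWithinAt) (by simpa using h0)
      (fun s hs => by
        simpa using hC (-s) ⟨by linarith [hs.2], by linarith [hs.1, ht₀.2]⟩) (-t)
      ⟨by linarith, by linarith [ht.1]⟩
    simpa using this

end

section

variable {E V : Type*} [NormedAddCommGroup E] [NormedSpace ℝ E] [NormedAddCommGroup V]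
  [NormedSpace ℝ V]

/-- A geodesic on the parameter set `J`, contained in `Ω`, together with its velocity. -/
structure IsGeodesic (Ω : Set E) (g : E → E →L[ℝ] E →L[ℝ] ℝ) (J : Set ℝ) (γ γ' γ'' : ℝ → E) :
    Prop where
  mem : ∀ t ∈ J, γ t ∈ Ω
  deriv : ∀ t ∈ J, HasDerivAt γ (γ' t) t
  deriv₂ : ∀ t ∈ J, HasDerivAt γ' (γ'' t) t
  eq : ∀ t ∈ J, GeodesicEq g (γ t) (γ' t) (γ'' t)
  cont : ContinuousOn γ'' J

lemma IsGeodesic.mono {Ω : Set E} {g : E → E →L[ℝ] E →L[ℝ] ℝ} {J J' : Set ℝ} {γ γ' γ'' : ℝ → E}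
    (h : IsGeodesic Ω g J γ γ' γ'') (hJ : J' ⊆ J) : IsGeodesic Ω g J' γ γ' γ'' :=
  ⟨fun t ht => h.mem t (hJ ht), fun t ht => h.deriv t (hJ ht), fun t ht => h.deriv₂ t (hJ ht),
    fun t ht => h.eq t (hJ ht), h.cont.mono hJ⟩

namespace IsKillingSystem

variable {Ω : Set E} {g : E → E →L[ℝ] E →L[ℝ] ℝ} {k : E → V →L[ℝ] E} {z : E}

lemma continuousOn_extDeriv (S : IsKillingSystem Ω g k) (b : V) {T : Type*} [TopologicalSpace T]
    {s : Set T} {ζ u v : T → E} (hζ : ContinuousOn ζ s) (hs : MapsTo ζ s Ω)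
    (hu : ContinuousOn u s) (hv : ContinuousOn v s) :
    ContinuousOn (fun t => extDeriv g k (ζ t) b (u t) (v t)) s := by
  have h1 := S.smooth_metric.continuousOn.comp hζ hs
  have h2 := S.smooth_field.continuousOn.comp hζ hs
  have h3 := S.contDiffOn_fderiv_metric.continuousOn.comp hζ hs
  have h4 := S.contDiffOn_fderiv_field.continuousOn.comp hζ hs
  have c : ContinuousOn (fun _ : T => b) s := continuousOn_const
  exact (((((h3.clm_apply hu).clm_apply (h2.clm_apply c)).clm_apply hv).add
    ((h1.clm_apply ((h4.clm_apply hu).clm_apply c)).clm_apply hv)).sub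
    (((h3.clm_apply hv).clm_apply (h2.clm_apply c)).clm_apply hu)).sub
    ((h1.clm_apply ((h4.clm_apply hv).clm_apply c)).clm_apply hu)

/-- The orthogonality relations hold on the closure of the set of regular points; the fields need
not be independent there. -/
lemma orthogonal_of_mem_closure (S : IsKillingSystem Ω g k) {c : V}
    (hz : z ∈ Ω) (hzc : z ∈ closure (regularSet Ω g k c)) (b : V) :
    g z (k z b) (k z c) = 0 := by
  have h1 := S.smooth_metric.continuousOn
  have h2 := S.smooth_field.continuousOn
  have hc : ContinuousOn (fun z => g z (k z b) (k z c)) Ω :=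
    (h1.clm_apply (h2.clm_apply continuousOn_const)).clm_apply (h2.clm_apply continuousOn_const)
  have : (fun z => g z (k z b) (k z c)) z ∈ closure ({0} : Set ℝ) :=
    (hc.continuousAt (S.isOpen.mem_nhds hz)).continuousWithinAt.mem_closure hzc
      fun y hy => hy.2.2 b
  simpa using this

/-- Involutivity of the distribution orthogonal to `k · c` on the closure of the set of regular
points; `e` is a fixed direction transversal to it. -/
lemma extDeriv_eq_zero_of_mem_closure [FiniteDimensional ℝ V] (S : IsKillingSystem Ω g k)
    {c : V} {e : E} (he : ∀ z ∈ Ω, g z (k z c) e ≠ 0) (hz : z ∈ Ω)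
    (hzc : z ∈ closure (regularSet Ω g k c)) {u v : E} (hu : g z (k z c) u = 0)
    (hv : g z (k z c) v = 0) : extDeriv g k z c u v = 0 := by
  have h1 := S.smooth_metric.continuousOn
  have h2 := S.smooth_field.continuousOn
  let p : E → E → E := fun u z => u - (g z (k z c) u / g z (k z c) e) • e
  have hp : ∀ u, ContinuousOn (p u) Ω := fun u => by
    have hl := h1.clm_apply (h2.clm_apply (continuousOn_const (c := c)))
    exact continuousOn_const.sub (((hl.clm_apply continuousOn_const).div
      (hl.clm_apply continuousOn_const) he).smul continuousOn_const)
  have hp0 : ∀ u, ∀ z ∈ Ω, g z (k z c) (p u z) = 0 := fun u z hz => by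
    simp only [p, map_sub, map_smul, smul_eq_mul]
    rw [div_mul_cancel₀ _ (he z hz), sub_self]
  have hpu : ∀ u, g z (k z c) u = 0 → p u z = u := fun u hu => by simp [p, hu]
  have hne : ∀ z ∈ Ω, k z c ≠ 0 := fun z hz h => he z hz (by simp [h])
  have hc := S.continuousOn_extDeriv c continuousOn_id (mapsTo_id Ω) (hp u) (hp v)
  have : (fun z => extDeriv g k (id z) c (p u z) (p v z)) z ∈ closure ({0} : Set ℝ) :=
    (hc.continuousAt (S.isOpen.mem_nhds hz)).continuousWithinAt.mem_closure hzc
      fun y hy => S.extDeriv_eq_zero_of_mem_regularSet hy (hne y hy.1) (hp0 u y hy.1)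
        (hp0 v y hy.1)
  simpa [hpu u hu, hpu v hv] using this

/-! #### The metric as an isomorphism onto the dual space -/

lemma exists_metric_equiv [FiniteDimensional ℝ E] (S : IsKillingSystem Ω g k) (hz : z ∈ Ω) :
    ∃ e : E ≃L[ℝ] (E →L[ℝ] ℝ), (e : E →L[ℝ] E →L[ℝ] ℝ) = g z := by
  have hi : Function.Injective (g z) := by
    rw [injective_iff_map_eq_zero]
    exact fun u hu => S.nondeg z hz u fun v => by rw [hu]; rfl
  have hfin : Module.finrank ℝ E = Module.finrank ℝ (E →L[ℝ] ℝ) := by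
    rw [← LinearMap.toContinuousLinearMap.finrank_eq (R := ℝ) (M := E →ₗ[ℝ] ℝ)]
    exact (Subspace.dual_finrank_eq (K := ℝ) (V := E)).symm
  refine ⟨(LinearEquiv.ofBijective (g z).toLinearMap ⟨hi,
    (LinearMap.injective_iff_surjective_of_finrank_eq_finrank (f := (g z).toLinearMap) hfin).1
      hi⟩).toContinuousLinearEquiv, ?_⟩
  ext u v; rfl

lemma metric_inverse_apply [FiniteDimensional ℝ E] (S : IsKillingSystem Ω g k) (hz : z ∈ Ω)
    (φ : E →L[ℝ] ℝ) : g z ((g z).inverse φ) = φ := by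
  obtain ⟨e, he⟩ := S.exists_metric_equiv hz
  rw [← he]; simp

lemma inverse_metric_apply [FiniteDimensional ℝ E] (S : IsKillingSystem Ω g k) (hz : z ∈ Ω)
    (v : E) : (g z).inverse (g z v) = v := by
  obtain ⟨e, he⟩ := S.exists_metric_equiv hz
  rw [← he]; simp

lemma contDiffOn_inverse [FiniteDimensional ℝ E] (S : IsKillingSystem Ω g k) :
    ContDiffOn ℝ ∞ (fun z => (g z).inverse) Ω := by
  intro z hz
  obtain ⟨e, he⟩ := S.exists_metric_equiv hz
  have h := contDiffAt_map_inverse (𝕜 := ℝ) (n := ∞) e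
  rw [he] at h
  exact h.comp_contDiffWithinAt z (S.smooth_metric z hz)

/-! #### Killing fields along geodesics -/

variable {J : Set ℝ} {γ γ' γ'' : ℝ → E}

lemma hasDerivAt_field_along (S : IsKillingSystem Ω g k) (hγ : IsGeodesic Ω g J γ γ' γ'') {t : ℝ}
    (ht : t ∈ J) (b : V) :
    HasDerivAt (fun s => k (γ s) b) (fderiv ℝ k (γ t) (γ' t) b) t := by
  have h := (S.hasFDerivAt_field (hγ.mem t ht)).comp_hasDerivAt t (hγ.deriv t ht)
  simpa using h.clm_apply (hasDerivAt_const t b)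

lemma hasDerivAt_fderiv_field_along (S : IsKillingSystem Ω g k) (hγ : IsGeodesic Ω g J γ γ' γ'')
    {t : ℝ} (ht : t ∈ J) (b : V) :
    HasDerivAt (fun s => fderiv ℝ k (γ s) (γ' s) b)
      (fderiv ℝ (fderiv ℝ k) (γ t) (γ' t) (γ' t) b + fderiv ℝ k (γ t) (γ'' t) b) t := by
  have h := (S.hasFDerivAt_fderiv_field (hγ.mem t ht)).comp_hasDerivAt t (hγ.deriv t ht)
  simpa using (h.clm_apply (hγ.deriv₂ t ht)).clm_apply (hasDerivAt_const t b)

/-- The conserved quantity of a Killing field along a geodesic. -/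
lemma hasDerivAt_momentum (S : IsKillingSystem Ω g k) (hγ : IsGeodesic Ω g J γ γ' γ'') {t : ℝ}
    (ht : t ∈ J) (b : V) : HasDerivAt (fun s => g (γ s) (k (γ s) b) (γ' s)) 0 t := by
  have h1 := (S.hasFDerivAt_metric (hγ.mem t ht)).comp_hasDerivAt t (hγ.deriv t ht)
  have h := (h1.clm_apply (S.hasDerivAt_field_along hγ ht b)).clm_apply (hγ.deriv₂ t ht)
  refine h.congr_deriv ?_
  have := S.geodesic_conservation (hγ.mem t ht) (hγ.eq t ht) b
  simpa using this

/-- The derivative of `g(K, k c)` along a geodesic. -/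
lemma hasDerivAt_inner_along (S : IsKillingSystem Ω g k) (hγ : IsGeodesic Ω g J γ γ' γ'') {t : ℝ}
    (ht : t ∈ J) (b c : V) :
    HasDerivAt (fun s => g (γ s) (k (γ s) b) (k (γ s) c))
      (- extDeriv g k (γ t) b (k (γ t) c) (γ' t)) t := by
  have h1 := (S.hasFDerivAt_metric (hγ.mem t ht)).comp_hasDerivAt t (hγ.deriv t ht)
  have h := (h1.clm_apply (S.hasDerivAt_field_along hγ ht b)).clm_apply
    (S.hasDerivAt_field_along hγ ht c)
  refine h.congr_deriv ?_
  rw [S.extDeriv_field (hγ.mem t ht)]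
  simp

end IsKillingSystem

lemma IsGeodesic.continuousOn_vel {Ω : Set E} {g : E → E →L[ℝ] E →L[ℝ] ℝ} {J : Set ℝ}
    {γ γ' γ'' : ℝ → E} (h : IsGeodesic Ω g J γ γ' γ'') : ContinuousOn γ' J :=
  fun t ht => (h.deriv₂ t ht).continuousAt.continuousWithinAt

lemma IsGeodesic.continuousOn {Ω : Set E} {g : E → E →L[ℝ] E →L[ℝ] ℝ} {J : Set ℝ}
    {γ γ' γ'' : ℝ → E} (h : IsGeodesic Ω g J γ γ' γ'') : ContinuousOn γ J :=
  fun t ht => (h.deriv t ht).continuousAt.continuousWithinAt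

/-- A crude bound for the Jacobi operator. -/
lemma abs_jacobiForm_le (g : E → E →L[ℝ] E →L[ℝ] ℝ) (z X a Y Y₁ w : E) :
    |jacobiForm g z X a Y Y₁ w| ≤ (‖fderiv ℝ g z‖ * ‖a‖ + 2 * ‖fderiv ℝ (fderiv ℝ g) z‖ * ‖X‖ * ‖X‖
      + 3 * ‖fderiv ℝ g z‖ * ‖X‖) * ‖(Y, Y₁)‖ * ‖w‖ := by
  have b3 : ∀ u v w, |fderiv ℝ g z u v w| ≤ ‖fderiv ℝ g z‖ * ‖u‖ * ‖v‖ * ‖w‖ := fun u v w => by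
    rw [← Real.norm_eq_abs]
    refine ((fderiv ℝ g z u v).le_opNorm w).trans ?_
    gcongr
    exact (fderiv ℝ g z).le_opNorm₂ u v
  have b4 : ∀ u v w x, |fderiv ℝ (fderiv ℝ g) z u v w x| ≤
      ‖fderiv ℝ (fderiv ℝ g) z‖ * ‖u‖ * ‖v‖ * ‖w‖ * ‖x‖ := fun u v w x => by
    rw [← Real.norm_eq_abs]
    refine ((fderiv ℝ (fderiv ℝ g) z u v w).le_opNorm x).trans ?_
    gcongr
    refine ((fderiv ℝ (fderiv ℝ g) z u v).le_opNorm w).trans ?_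
    gcongr
    exact (fderiv ℝ (fderiv ℝ g) z).le_opNorm₂ u v
  have hY : ‖Y‖ ≤ ‖(Y, Y₁)‖ := norm_fst_le (Y, Y₁)
  have hY₁ : ‖Y₁‖ ≤ ‖(Y, Y₁)‖ := norm_snd_le (Y, Y₁)
  set N := ‖(Y, Y₁)‖
  set D := ‖fderiv ℝ g z‖
  set D2 := ‖fderiv ℝ (fderiv ℝ g) z‖
  have e1 : |fderiv ℝ g z Y a w| ≤ D * N * ‖a‖ * ‖w‖ := (b3 _ _ _).trans (by gcongr)
  have e2 : |fderiv ℝ (fderiv ℝ g) z Y X X w| ≤ D2 * N * ‖X‖ * ‖X‖ * ‖w‖ :=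
    (b4 _ _ _ _).trans (by gcongr)
  have e3 : |fderiv ℝ (fderiv ℝ g) z Y w X X| ≤ D2 * N * ‖w‖ * ‖X‖ * ‖X‖ :=
    (b4 _ _ _ _).trans (by gcongr)
  have e4 : |fderiv ℝ g z Y₁ X w| ≤ D * N * ‖X‖ * ‖w‖ := (b3 _ _ _).trans (by gcongr)
  have e5 : |fderiv ℝ g z X Y₁ w| ≤ D * ‖X‖ * N * ‖w‖ := (b3 _ _ _).trans (by gcongr)
  have e6 : |fderiv ℝ g z w Y₁ X| ≤ D * ‖w‖ * N * ‖X‖ := (b3 _ _ _).trans (by gcongr)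
  have p3 : 0 ≤ D2 * N * ‖w‖ * ‖X‖ * ‖X‖ := by positivity
  rw [abs_le] at *
  unfold jacobiForm
  constructor <;> linarith [e1.1, e1.2, e2.1, e2.2, e3.1, e3.2, e4.1, e4.2, e5.1, e5.2, e6.1, e6.2]

end

/-! ### Uniqueness for the Jacobi equation -/

section

variable {E V : Type*} [NormedAddCommGroup E] [NormedSpace ℝ E] [NormedAddCommGroup V]
  [NormedSpace ℝ V]

namespace IsKillingSystem

variable {Ω : Set E} {g : E → E →L[ℝ] E →L[ℝ] ℝ} {k : E → V →L[ℝ] E} {z : E}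
  {J : Set ℝ} {γ γ' γ'' : ℝ → E}

/-- If `v` solves the linear second order equation `g(v'', ·) = jacobiForm v v'` along a geodesic
and has vanishing initial data, it vanishes. -/
lemma jacobi_unique [FiniteDimensional ℝ E] (S : IsKillingSystem Ω g k)
    {t₀ t₁ : ℝ} (h01 : t₀ ≤ t₁) (hγ : IsGeodesic Ω g (Icc t₀ t₁) γ γ' γ'') {v v' v'' : ℝ → E}
    (hv : ∀ t ∈ Icc t₀ t₁, HasDerivAt v (v' t) t)
    (hv' : ∀ t ∈ Icc t₀ t₁, HasDerivAt v' (v'' t) t)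
    (hJ : ∀ t ∈ Icc t₀ t₁, ∀ w,
      g (γ t) (v'' t) w = jacobiForm g (γ t) (γ' t) (γ'' t) (v t) (v' t) w)
    (h0 : v t₁ = 0) (h0' : v' t₁ = 0) : v t₀ = 0 := by
  set M : ℝ → ℝ := fun t => ‖(g (γ t)).inverse‖ * (‖fderiv ℝ g (γ t)‖ * ‖γ'' t‖
    + 2 * ‖fderiv ℝ (fderiv ℝ g) (γ t)‖ * ‖γ' t‖ * ‖γ' t‖
    + 3 * ‖fderiv ℝ g (γ t)‖ * ‖γ' t‖) with hM
  have hmap : MapsTo γ (Icc t₀ t₁) Ω := hγ.mem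
  have c1 := (S.contDiffOn_inverse.continuousOn.comp hγ.continuousOn hmap).norm
  have c2 := (S.contDiffOn_fderiv_metric.continuousOn.comp hγ.continuousOn hmap).norm
  have c3 := ((S.contDiffOn_fderiv_metric.fderiv_of_isOpen (m := 0) S.isOpen
    (by simp)).continuousOn.comp hγ.continuousOn hmap).norm
  have c4 := hγ.continuousOn_vel.norm
  have c5 := hγ.cont.norm
  have hMc : ContinuousOn M (Icc t₀ t₁) :=
    c1.mul (((c2.mul c5).add (((continuousOn_const.mul c3).mul c4).mul c4)).add
      ((continuousOn_const.mul c2).mul c4))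
  obtain ⟨C, hC⟩ := isCompact_Icc.exists_bound_of_continuousOn hMc
  have hfin := eq_zero_of_norm_deriv_le (f := fun t => (v t, v' t)) (f' := fun t => (v' t, v'' t))
    (C := 1 + C) (a := t₀) (b := t₁) (t₀ := t₁) (fun t ht => (hv t ht).prodMk (hv' t ht)) ?_
    (right_mem_Icc.2 h01) (by simp [h0, h0'])
  · exact congrArg Prod.fst (hfin t₀ (left_mem_Icc.2 h01))
  intro t ht
  have hCt : M t ≤ C := (le_abs_self _).trans (hC t ht)
  have hC0 : 0 ≤ C := (norm_nonneg _).trans (hC t ht)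
  have hN : 0 ≤ ‖(v t, v' t)‖ := norm_nonneg _
  refine max_le ?_ ?_
  · have := norm_snd_le (v t, v' t)
    nlinarith
  · show ‖v'' t‖ ≤ _
    have h1 : ‖g (γ t) (v'' t)‖ ≤ (‖fderiv ℝ g (γ t)‖ * ‖γ'' t‖
        + 2 * ‖fderiv ℝ (fderiv ℝ g) (γ t)‖ * ‖γ' t‖ * ‖γ' t‖
        + 3 * ‖fderiv ℝ g (γ t)‖ * ‖γ' t‖) * ‖(v t, v' t)‖ := by
      refine ContinuousLinearMap.opNorm_le_bound _ (by positivity) fun w => ?_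
      rw [hJ t ht, Real.norm_eq_abs]
      exact abs_jacobiForm_le g _ _ _ _ _ _
    have h2 : ‖v'' t‖ ≤ M t * ‖(v t, v' t)‖ := by
      conv_lhs => rw [← S.inverse_metric_apply (hγ.mem t ht) (v'' t)]
      refine ((g (γ t)).inverse.le_opNorm _).trans ?_
      rw [hM, mul_assoc]
      gcongr
    nlinarith

/-- A Killing field `Y = k b` of the family which vanishes at the end point of a geodesic `γ`
tangent to the null distribution, with derivative `Y' = a l` along `γ`, is a multiple of the null
field `l = k c` at the initial point of `γ`: indeed `∇_{γ'} l = κ l`, so that `Y - β l` is a Jacobi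
field with vanishing data at the end point when `β'' = -2 κ β'`. -/
lemma exists_eq_smul_of_tangent [FiniteDimensional ℝ E] [FiniteDimensional ℝ V]
    (S : IsKillingSystem Ω g k) {c : V} {e : E} (he : ∀ z ∈ Ω, g z (k z c) e ≠ 0)
    {t₀ t₁ : ℝ} (h01 : t₀ ≤ t₁) (hγ : IsGeodesic Ω g (Icc t₀ t₁) γ γ' γ'')
    (hcl : ∀ t ∈ Icc t₀ t₁, γ t ∈ closure (regularSet Ω g k c))
    (htan : ∀ t ∈ Icc t₀ t₁, g (γ t) (k (γ t) c) (γ' t) = 0) {b : V} (hb : k (γ t₁) b = 0)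
    {a : ℝ} (ha : fderiv ℝ k (γ t₁) (γ' t₁) b = a • k (γ t₁) c) :
    ∃ β : ℝ, k (γ t₀) b = β • k (γ t₀) c := by
  have hmap : MapsTo γ (Icc t₀ t₁) Ω := hγ.mem
  -- `κ` is twice the factor in `∇_{γ'} l = κ l`
  set κ : ℝ → ℝ := fun t => extDeriv g k (γ t) c (γ' t) e / g (γ t) (k (γ t) c) e with hκ
  have hκc : ContinuousOn κ (Icc t₀ t₁) := by
    refine (S.continuousOn_extDeriv c hγ.continuousOn hmap hγ.continuousOn_vel
      continuousOn_const).div ?_ fun t ht => he _ (hmap ht)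
    exact ((S.smooth_metric.continuousOn.comp hγ.continuousOn hmap).clm_apply
      ((S.smooth_field.continuousOn.comp hγ.continuousOn hmap).clm_apply
        continuousOn_const)).clm_apply continuousOn_const
  set κ' : ℝ → ℝ := Set.IccExtend h01 ((Icc t₀ t₁).domRestrict κ) with hκ'
  have hκ'c : Continuous κ' := (continuousOn_iff_continuous_domRestrict.1 hκc).Icc_extend'
  have hκe : ∀ t ∈ Icc t₀ t₁, κ' t = κ t := fun t ht => by
    rw [hκ', Set.IccExtend_of_mem h01 _ ht]; rfl
  set β₁ : ℝ → ℝ := fun t => a * Real.exp (-∫ s in t₁..t, κ' s) with hβ₁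
  have hβ₁d : ∀ t, HasDerivAt β₁ (-(κ' t) * β₁ t) t := fun t => by
    have h := ((hκ'c.integral_hasStrictDerivAt t₁ t).hasDerivAt.neg.exp).const_mul a
    refine h.congr_deriv ?_
    simp only [hβ₁, Pi.neg_apply]; ring
  have hβ₁c : Continuous β₁ := continuous_iff_continuousAt.2 fun t => (hβ₁d t).continuousAt
  set β : ℝ → ℝ := fun t => ∫ s in t₁..t, β₁ s with hβ
  have hβd : ∀ t, HasDerivAt β (β₁ t) t := fun t => (hβ₁c.integral_hasStrictDerivAt t₁ t).hasDerivAt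
  have hβ0 : β t₁ = 0 := by simp [hβ]
  have hβ₁0 : β₁ t₁ = a := by simp [hβ₁]
  refine ⟨β t₀, ?_⟩
  rw [← sub_eq_zero]
  have dY := fun t (ht : t ∈ Icc t₀ t₁) (b : V) => S.hasDerivAt_field_along hγ ht b
  have dY' := fun t (ht : t ∈ Icc t₀ t₁) (b : V) => S.hasDerivAt_fderiv_field_along hγ ht b
  refine S.jacobi_unique h01 hγ (v := fun t => k (γ t) b - β t • k (γ t) c)
    (v' := fun t => fderiv ℝ k (γ t) (γ' t) b
      - (β t • fderiv ℝ k (γ t) (γ' t) c + β₁ t • k (γ t) c))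
    (fun t ht => (dY t ht b).sub ((hβd t).smul (dY t ht c)))
    (fun t ht => (dY' t ht b).sub (((hβd t).smul (dY' t ht c)).add ((hβ₁d t).smul (dY t ht c))))
    ?_ (by simp [hb, hβ0]) (by simp [ha, hβ0, hβ₁0])
  intro t ht w
  have hz := hmap ht
  have j1 := S.jacobi hz (hγ.eq t ht) b w
  have j2 := S.jacobi hz (hγ.eq t ht) c w
  have j3 := S.extDeriv_eq_jacobi hz c (γ' t) w
  have j4 : extDeriv g k (γ t) c (γ' t) w = κ' t * g (γ t) (k (γ t) c) w := by
    have h := S.extDeriv_eq_zero_of_mem_closure he hz (hcl t ht) (htan t ht)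
      (v := w - (g (γ t) (k (γ t) c) w / g (γ t) (k (γ t) c) e) • e) (by
        simp only [map_sub, map_smul, smul_eq_mul]
        rw [div_mul_cancel₀ _ (he _ hz), sub_self])
    rw [extDeriv_sub_right, extDeriv_smul_right] at h
    rw [hκe t ht, hκ]
    have := he _ hz
    field_simp at h ⊢
    linarith
  rw [j4] at j3
  simp only [map_sub, map_add, map_smul, sub_apply, add_apply, smul_apply, smul_eq_mul] at j1 j2 ⊢
  simp only [jacobiForm, map_sub, map_add, map_smul, sub_apply, add_apply, smul_apply,
    smul_eq_mul] at j1 j2 ⊢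
  linear_combination j1 - β t * j2 - β₁ t * j3

end IsKillingSystem

end

/-! ### Flat functions and differential inequalities with a simple pole -/

/-- A smooth function vanishing on the left of a point is flat at this point. -/
lemma norm_le_pow_of_eq_zero_left {F : Type*} [NormedAddCommGroup F] [NormedSpace ℝ F] {t₁ : ℝ}
    (N : ℕ) {f : ℝ → F} (hf : ContDiffAt ℝ ∞ f t₁) (h0 : ∀ᶠ t in 𝓝[<] t₁, f t = 0) :
    ∃ C, 0 ≤ C ∧ ∀ᶠ t in 𝓝[≥] t₁, ‖f t‖ ≤ C * (t - t₁) ^ N := by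
  induction N generalizing f with
  | zero =>
    refine ⟨‖f t₁‖ + 1, by positivity, ?_⟩
    have := (hf.continuousAt.norm).eventually_lt_const (lt_add_one ‖f t₁‖)
    filter_upwards [nhdsWithin_le_nhds this] with t ht
    simpa using ht.le
  | succ N ih =>
    have hd : ContDiffAt ℝ ∞ (deriv f) t₁ := by
      have : ContDiffAt ℝ ∞ (fderiv ℝ f) t₁ := hf.fderiv_right (by simp)
      exact this.clm_apply contDiffAt_const
    have hd0 : ∀ᶠ t in 𝓝[<] t₁, deriv f t = 0 := by
      have := eventually_eventually_nhdsWithin.2 h0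
      filter_upwards [this, self_mem_nhdsWithin] with t ht htm
      have h : f =ᶠ[𝓝 t] fun _ => 0 := by
        rwa [IsOpen.nhdsWithin_eq isOpen_Iio htm] at ht
      rw [h.deriv_eq]; simp
    obtain ⟨C, hC0, hC⟩ := ih hd hd0
    refine ⟨C, hC0, ?_⟩
    have hf0 : f t₁ = 0 := by
      have h1 : Tendsto f (𝓝[<] t₁) (𝓝 (f t₁)) := hf.continuousAt.tendsto.mono_left inf_le_left
      have h2 : Tendsto f (𝓝[<] t₁) (𝓝 0) :=
        tendsto_const_nhds.congr' (by filter_upwards [h0] with t ht using ht.symm)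
      exact tendsto_nhds_unique h1 h2
    have hdiff : ∀ᶠ t in 𝓝 t₁, DifferentiableAt ℝ f t := by
      have : ContDiffAt ℝ 1 f t₁ := hf.of_le (by simp)
      filter_upwards [this.eventually (by simp)] with t ht using ht.differentiableAt (by simp)
    have hboth := hC.and (nhdsWithin_le_nhds hdiff : ∀ᶠ t in 𝓝[≥] t₁, DifferentiableAt ℝ f t)
    obtain ⟨u, hu, hsub⟩ := (mem_nhdsGE_iff_exists_Ico_subset).1 hboth
    filter_upwards [Ico_mem_nhdsGE hu] with t ht
    have key := (convex_Icc t₁ t).norm_image_sub_le_of_norm_deriv_le (f := f)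
      (C := C * (t - t₁) ^ N) (fun s hs => (hsub ⟨hs.1, hs.2.trans_lt ht.2⟩).2) (fun s hs => by
        refine (hsub ⟨hs.1, hs.2.trans_lt ht.2⟩).1.trans ?_
        have h1 : 0 ≤ s - t₁ := sub_nonneg.2 hs.1
        have h2 : s - t₁ ≤ t - t₁ := by linarith [hs.2]
        gcongr) (left_mem_Icc.2 ht.1) (right_mem_Icc.2 ht.1)
    rw [hf0, sub_zero, Real.norm_of_nonneg (sub_nonneg.2 ht.1)] at key
    rwa [pow_succ, ← mul_assoc]

/-- A flat function satisfying `‖f'‖ ≤ C (t - t₁)⁻¹ ‖f‖` vanishes: on each dyadic interval its norm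
grows at most by a fixed factor. -/
lemma eq_zero_of_norm_deriv_le_inv_mul {F : Type*} [NormedAddCommGroup F] [NormedSpace ℝ F]
    {f f' : ℝ → F} {t₁ C δ : ℝ} (hf : ∀ t ∈ Ioo t₁ (t₁ + δ), HasDerivAt f (f' t) t)
    (hC : ∀ t ∈ Ioo t₁ (t₁ + δ), ‖f' t‖ ≤ C * (t - t₁)⁻¹ * ‖f t‖)
    (hflat : ∀ N : ℕ, ∃ D, ∀ᶠ t in 𝓝[>] t₁, ‖f t‖ ≤ D * (t - t₁) ^ N) :
    ∀ t ∈ Ioo t₁ (t₁ + δ), f t = 0 := by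
  set C' := max C 0
  have hC' : 0 ≤ C' := le_max_right _ _
  -- one halving of the distance to `t₁`
  have half : ∀ τ ∈ Ioo 0 δ, ‖f (t₁ + τ)‖ ≤ Real.exp C' * ‖f (t₁ + τ / 2)‖ := by
    intro τ hτ
    have h2 : 0 < τ / 2 := by linarith [hτ.1]
    have mem : ∀ s ∈ Icc (t₁ + τ / 2) (t₁ + τ), s ∈ Ioo t₁ (t₁ + δ) := fun s hs =>
      ⟨by linarith [hs.1], by linarith [hs.2, hτ.2]⟩
    have := norm_le_gronwallBound_of_norm_deriv_right_le (f := f) (f' := f')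
      (δ := ‖f (t₁ + τ / 2)‖) (K := C' * (τ / 2)⁻¹) (ε := 0) (a := t₁ + τ / 2) (b := t₁ + τ)
      (fun s hs => (hf s (mem s hs)).continuousAt.continuousWithinAt)
      (fun s hs => (hf s (mem s ⟨hs.1, hs.2.le⟩)).hasDerivWithinAt) le_rfl
      (fun s hs => by
        refine (hC s (mem s ⟨hs.1, hs.2.le⟩)).trans ?_
        have h1 : τ / 2 ≤ s - t₁ := by linarith [hs.1]
        have h3 : (s - t₁)⁻¹ ≤ (τ / 2)⁻¹ := inv_anti₀ h2 h1
        have h4 : 0 ≤ (s - t₁)⁻¹ := inv_nonneg.2 (h2.le.trans h1)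
        rw [add_zero]
        gcongr
        exact le_max_left _ _) (t₁ + τ) ⟨by linarith, le_rfl⟩
    rw [gronwallBound_ε0] at this
    rw [mul_comm]
    have hne := hτ.1.ne'
    convert this using 3
    field_simp
    ring
  have iter : ∀ n : ℕ, ∀ τ ∈ Ioo 0 δ, ‖f (t₁ + τ)‖ ≤ Real.exp C' ^ n * ‖f (t₁ + τ / 2 ^ n)‖ := by
    intro n
    induction n with
    | zero => intro τ _; simp
    | succ n ih =>
      intro τ hτ
      have hm : τ / 2 ^ n ∈ Ioo 0 δ :=
        ⟨by have := hτ.1; positivity,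
          (div_le_self hτ.1.le (one_le_pow₀ (by norm_num))).trans_lt hτ.2⟩
      refine (ih τ hτ).trans ?_
      rw [pow_succ, mul_assoc, pow_succ, ← div_div]
      gcongr
      exact half _ hm
  obtain ⟨N, hN⟩ := pow_unbounded_of_one_lt (Real.exp C') (show (1 : ℝ) < 2 by norm_num)
  obtain ⟨D, hD⟩ := hflat N
  intro t ht
  set τ := t - t₁ with hτd
  have hτ : τ ∈ Ioo 0 δ := ⟨by linarith [ht.1], by linarith [ht.2]⟩
  have htt : t = t₁ + τ := by ring
  have lim : Tendsto (fun n : ℕ => t₁ + τ / 2 ^ n) atTop (𝓝[>] t₁) := by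
    refine tendsto_nhdsWithin_iff.2 ⟨?_, Eventually.of_forall fun n => ?_⟩
    · have h := tendsto_pow_atTop_nhds_zero_of_lt_one (r := (1 / 2 : ℝ)) (by norm_num)
        (by norm_num)
      have := (h.const_mul τ).const_add t₁
      simpa [div_eq_mul_inv] using this
    · have : 0 < τ / 2 ^ n := by have := hτ.1; positivity
      simpa using this
  have hq : Tendsto (fun n : ℕ => (Real.exp C' / 2 ^ N) ^ n * (D * τ ^ N)) atTop (𝓝 0) := by
    have : Tendsto (fun n : ℕ => (Real.exp C' / 2 ^ N) ^ n) atTop (𝓝 0) :=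
      tendsto_pow_atTop_nhds_zero_of_lt_one (by positivity) ((div_lt_one (by positivity)).2 hN)
    simpa using this.mul_const (D * τ ^ N)
  have hle : ‖f t‖ ≤ 0 := by
    refine ge_of_tendsto hq ?_
    filter_upwards [lim.eventually hD] with n hn
    rw [htt]
    refine (iter n τ hτ).trans ?_
    rw [add_sub_cancel_left] at hn
    calc Real.exp C' ^ n * ‖f (t₁ + τ / 2 ^ n)‖
        ≤ Real.exp C' ^ n * (D * (τ / 2 ^ n) ^ N) := by gcongr
      _ = _ := by rw [div_pow, div_pow, ← pow_mul, ← pow_mul, mul_comm n N]; ring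
  simpa using hle

/-! ### Geodesics crossing the degeneracy set -/

/-- Solvability, with bounds, of a linear equation is stable under small perturbations. -/
lemma exists_bounded_solution {X Y T : Type*} [NormedAddCommGroup X] [NormedSpace ℝ X]
    [NormedAddCommGroup Y] [NormedSpace ℝ Y] [FiniteDimensional ℝ X] [FiniteDimensional ℝ Y]
    [TopologicalSpace T] {A : T → X →L[ℝ] Y} {t₁ : T} (hA : ContinuousAt A t₁)
    (hs : Function.Surjective (A t₁)) :
    ∃ C, 0 ≤ C ∧ ∀ᶠ t in 𝓝 t₁, ∀ y, ∃ x, A t x = y ∧ ‖x‖ ≤ C * ‖y‖ := by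
  obtain ⟨R, hR⟩ := (A t₁).toLinearMap.exists_rightInverse_of_surjective
    (LinearMap.range_eq_top.2 hs)
  set R' : Y →L[ℝ] X := R.toContinuousLinearMap
  have hN : ContinuousAt (fun t => (A t).comp R') t₁ := hA.clm_comp continuousAt_const
  have hN1 : (A t₁).comp R' = (ContinuousLinearEquiv.refl ℝ Y : Y →L[ℝ] Y) := by
    ext y; exact congrArg (fun f => f y) hR
  have hinv : ContinuousAt (fun t => ((A t).comp R').inverse) t₁ := by
    have h := (contDiffAt_map_inverse (𝕜 := ℝ) (n := 0) (ContinuousLinearEquiv.refl ℝ Y))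
    rw [← hN1] at h
    exact h.continuousAt.comp (f := fun t => (A t).comp R') hN
  have hequiv : ∀ᶠ t in 𝓝 t₁, (A t).comp R' ∈ range ((↑) : (Y ≃L[ℝ] Y) → Y →L[ℝ] Y) := by
    refine hN.eventually ?_
    change _ ∈ 𝓝 ((A t₁).comp R')
    rw [hN1]
    exact ContinuousLinearEquiv.nhds (ContinuousLinearEquiv.refl ℝ Y)
  set B := ‖((A t₁).comp R').inverse‖ + 1
  have hb : ∀ᶠ t in 𝓝 t₁, ‖((A t).comp R').inverse‖ < B :=
    hinv.norm.eventually_lt_const (lt_add_one _)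
  refine ⟨‖R'‖ * B, by positivity, ?_⟩
  filter_upwards [hequiv, hb] with t ⟨e, he⟩ ht y
  refine ⟨R' (((A t).comp R').inverse y), ?_, ?_⟩
  · have : ((A t).comp R') (((A t).comp R').inverse y) = y := by rw [← he]; simp
    exact this
  · refine (R'.le_opNorm _).trans ?_
    rw [mul_assoc]
    gcongr
    refine (ContinuousLinearMap.le_opNorm _ _).trans ?_
    gcongr

section

variable {E V : Type*} [NormedAddCommGroup E] [NormedSpace ℝ E] [NormedAddCommGroup V]
  [NormedSpace ℝ V]

lemma continuousAt_clm_flip {T X Y : Type*} [TopologicalSpace T] [NormedAddCommGroup X]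
    [NormedSpace ℝ X] [NormedAddCommGroup Y] [NormedSpace ℝ Y] {A : T → X →L[ℝ] Y →L[ℝ] ℝ} {t : T}
    (h : ContinuousAt A t) : ContinuousAt (fun s => (A s).flip) t :=
  (ContinuousLinearMap.flipₗᵢ ℝ X Y ℝ).continuous.continuousAt.comp (f := A) h

lemma _root_.ContinuousAt.exists_eventually_norm_le {T Y : Type*} [TopologicalSpace T]
    [NormedAddCommGroup Y] {h : T → Y} {t₁ : T} (hc : ContinuousAt h t₁) :
    ∃ M, 0 ≤ M ∧ ∀ᶠ t in 𝓝 t₁, ‖h t‖ ≤ M := by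
  refine ⟨‖h t₁‖ + 1, by positivity, ?_⟩
  filter_upwards [hc.norm.eventually_lt_const (lt_add_one _)] with t ht using ht.le

lemma abs_extDeriv_le (g : E → E →L[ℝ] E →L[ℝ] ℝ) (k : E → V →L[ℝ] E) (z : E) (b : V) (u v : E) :
    |extDeriv g k z b u v| ≤
      (2 * ‖fderiv ℝ g z‖ * ‖k z‖ + 2 * ‖g z‖ * ‖fderiv ℝ k z‖) * ‖b‖ * ‖u‖ * ‖v‖ := by
  have h1 : ∀ u v, |fderiv ℝ g z u (k z b) v| ≤ ‖fderiv ℝ g z‖ * ‖u‖ * (‖k z‖ * ‖b‖) * ‖v‖ :=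
    fun u v => by
    rw [← Real.norm_eq_abs]
    refine ((fderiv ℝ g z u (k z b)).le_opNorm v).trans ?_
    gcongr
    refine ((fderiv ℝ g z).le_opNorm₂ u _).trans ?_
    gcongr
    exact (k z).le_opNorm b
  have h2 : ∀ u v, |g z (fderiv ℝ k z u b) v| ≤ ‖g z‖ * (‖fderiv ℝ k z‖ * ‖u‖ * ‖b‖) * ‖v‖ :=
    fun u v => by
    rw [← Real.norm_eq_abs]
    refine ((g z).le_opNorm₂ _ v).trans ?_
    gcongr
    exact (fderiv ℝ k z).le_opNorm₂ u b
  have a1 := h1 u v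
  have a2 := h1 v u
  have a3 := h2 u v
  have a4 := h2 v u
  rw [abs_le] at *
  unfold extDeriv
  constructor <;> linarith [a1.1, a1.2, a2.1, a2.2, a3.1, a3.2, a4.1, a4.2]

namespace IsKillingSystem

variable {Ω : Set E} {g : E → E →L[ℝ] E →L[ℝ] ℝ} {k : E → V →L[ℝ] E} {z : E}
  {J : Set ℝ} {γ γ' γ'' : ℝ → E}

/-- The derivative of a field of the family vanishing at `z` is orthogonal to all of them. -/
lemma fderiv_orthogonal_of_eq_zero (S : IsKillingSystem Ω g k) (hz : z ∈ Ω) {b : V}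
    (hb : k z b = 0) (X : E) (b' : V) : g z (fderiv ℝ k z X b) (k z b') = 0 := by
  have h1 := S.killing z hz b X (k z b')
  have h2 := S.comm z hz b' b
  rw [h2, hb] at h1
  simpa using h1

/-- The derivative of a field vanishing at `z` is orthogonal to the whole family.  If it lies in the
span of the family it is therefore null and orthogonal to `k c`, hence a multiple of `k c`. -/
lemma exists_fderiv_eq_smul (S : IsKillingSystem Ω g k) (hz : z ∈ Ω) {c : V} (hc : k z c ≠ 0)
    (horth : ∀ b, g z (k z b) (k z c) = 0) {b b' : V} (hb : k z b = 0) {X : E}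
    (hX : fderiv ℝ k z X b = k z b') : ∃ a : ℝ, fderiv ℝ k z X b = a • k z c := by
  have h := S.fderiv_orthogonal_of_eq_zero hz hb X
  exact S.null z hz _ _ hc (horth c) (by rw [S.symm z hz]; exact h c) (by rw [hX] at h ⊢; exact h b')

/-- At the end point of a geodesic tangent to the null distribution which starts at a regular
point, no derivative along the geodesic of a field vanishing there lies in the span of the
family. -/
lemma eq_zero_of_fderiv_mem_range [FiniteDimensional ℝ E] [FiniteDimensional ℝ V]
    (S : IsKillingSystem Ω g k) {c : V} {e : E} (he : ∀ z ∈ Ω, g z (k z c) e ≠ 0)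
    {t₀ t₁ : ℝ} (h01 : t₀ ≤ t₁) (hγ : IsGeodesic Ω g (Icc t₀ t₁) γ γ' γ'')
    (h0 : γ t₀ ∈ regularSet Ω g k c)
    (hcl : ∀ t ∈ Icc t₀ t₁, γ t ∈ closure (regularSet Ω g k c))
    (htan : ∀ t ∈ Icc t₀ t₁, g (γ t) (k (γ t) c) (γ' t) = 0) {b b' : V} (hb : k (γ t₁) b = 0)
    (hb' : fderiv ℝ k (γ t₁) (γ' t₁) b = k (γ t₁) b') : b = 0 := by
  have hr := right_mem_Icc.2 h01
  have hz := hγ.mem t₁ hr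
  have hc : k (γ t₁) c ≠ 0 := fun h => he _ hz (by simp [h])
  obtain ⟨a, ha⟩ := S.exists_fderiv_eq_smul hz hc
    (S.orthogonal_of_mem_closure hz (hcl t₁ hr)) hb hb'
  obtain ⟨β, hβ⟩ := S.exists_eq_smul_of_tangent he h01 hγ hcl htan hb ha
  have h1 : b = β • c := h0.2.1 (by simpa using hβ)
  rw [h1, map_smul] at hb
  rcases smul_eq_zero.1 hb with h | h
  · simp [h1, h]
  · exact absurd h hc

/-- The derivative of `g(k b, l)`, `l = k c`, in a direction `X` orthogonal to `l`, expressed by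
means of the linear map `b ↦ g(L b, l)`, where `L` is a reparametrization of the family. -/
lemma extDeriv_eq_of_frame (S : IsKillingSystem Ω g k) (hz : z ∈ Ω)
    (hinj : Function.Injective (k z)) {L : V →L[ℝ] E} {σ : V → V} (hσ : ∀ b, L b = k z (σ b))
    (hσs : Function.Surjective σ) {c : V} (hLc : L c = k z c) {X : E} (hX : g z (k z c) X = 0)
    {ξ : V →L[ℝ] ℝ} (hξ : ξ c = 1) {β : V}
    (hβ : ∀ b', g z (L β) (L b') + ξ β * ξ b' = g z (L b') X) {Z₁ Z₂ : E}
    (h1 : ∀ b, g z (L b) Z₁ = g z (L b) (k z c)) (h2 : ∀ b, g z (L b) Z₂ = ξ b) (b : V) :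
    ξ β = - g z (L β) (k z c) ∧
    extDeriv g k z b (k z c) X =
      extDeriv g k z b Z₁ (X - L β) + ξ β * extDeriv g k z b (k z c - Z₁) Z₂ := by
  have hξβ : ξ β = - g z (L β) (k z c) := by
    have := hβ c
    rw [hξ, hLc, hX] at this
    linarith
  refine ⟨hξβ, ?_⟩
  have o1 : ∀ b', g z (k z b') (k z c - Z₁) = 0 := fun b' => by
    obtain ⟨b'', rfl⟩ := hσs b'
    rw [← hσ, map_sub, h1, sub_self]
  have o2 : ∀ b', g z (k z b') (X - L β - ξ β • Z₂) = 0 := fun b' => by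
    obtain ⟨b'', rfl⟩ := hσs b'
    rw [← hσ]
    simp only [map_sub, map_smul, smul_eq_mul]
    rw [h2, S.symm z hz (L b'') (L β), ← hβ b'']
    ring
  have h3 := S.orth z hz hinj b _ _ o1 o2
  have h4 := S.extDeriv_field_field hz b c (σ β)
  rw [← hσ] at h4
  rw [extDeriv_sub_right, extDeriv_smul_right] at h3
  have h5 : extDeriv g k z b (k z c) (X - L β) = extDeriv g k z b (k z c) X := by
    rw [extDeriv_sub_right, h4, sub_zero]
  have h6 := extDeriv_sub_left (g := g) (k := k) (z := z) b (X - L β) (k z c) Z₁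
  linarith

/-- The quantitative form of `extDeriv_eq_of_frame`: the derivatives of the functions `g(k b, l)` are
bounded by these functions themselves, collected in the functional `F`. -/
lemma abs_extDeriv_le_of_frame (S : IsKillingSystem Ω g k) (hz : z ∈ Ω)
    (hinj : Function.Injective (k z)) {L : V →L[ℝ] E} {σ : V → V} (hσ : ∀ b, L b = k z (σ b))
    (hσs : Function.Surjective σ) {c : V} (hLc : L c = k z c) {X : E} (hX : g z (k z c) X = 0)
    {ξ : V →L[ℝ] ℝ} (hξ : ξ c = 1) {β : V}
    (hβ : ∀ b', g z (L β) (L b') + ξ β * ξ b' = g z (L b') X) {Z₁ Z₂ : E}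
    (h1 : ∀ b, g z (L b) Z₁ = g z (L b) (k z c)) (h2 : ∀ b, g z (L b) Z₂ = ξ b) (b : V)
    {F : V →L[ℝ] ℝ} (hF : ∀ b, F b = g z (L b) (k z c)) {N Mβ MX Ml M₂ C : ℝ}
    (hN : 2 * ‖fderiv ℝ g z‖ * ‖k z‖ + 2 * ‖g z‖ * ‖fderiv ℝ k z‖ ≤ N) (nβ : ‖β‖ ≤ Mβ)
    (nX : ‖X - L β‖ ≤ MX) (n₁ : ‖Z₁‖ ≤ C * ‖F‖) (nl : ‖k z c - Z₁‖ ≤ Ml) (n₂ : ‖Z₂‖ ≤ M₂) :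
    |extDeriv g k z b (k z c) X| ≤ (N * C * MX + Mβ * N * Ml * M₂) * ‖F‖ * ‖b‖ := by
  obtain ⟨e1, e2⟩ := S.extDeriv_eq_of_frame hz hinj hσ hσs hLc hX hξ hβ h1 h2 b
  have hN0 : 0 ≤ N := le_trans (by positivity) hN
  have hM0 : 0 ≤ Mβ := (norm_nonneg _).trans nβ
  have hl0 : 0 ≤ Ml := (norm_nonneg _).trans nl
  have nξβ : |g z (L β) (k z c)| ≤ ‖F‖ * Mβ := by
    rw [← hF, ← Real.norm_eq_abs]
    exact (F.le_opNorm β).trans (by gcongr)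
  have i1 : |extDeriv g k z b Z₁ (X - L β)| ≤ N * ‖b‖ * (C * ‖F‖) * MX :=
    (abs_extDeriv_le g k _ _ _ _).trans (by
      have : 0 ≤ C * ‖F‖ := (norm_nonneg _).trans n₁
      gcongr)
  have i2 : |extDeriv g k z b (k z c - Z₁) Z₂| ≤ N * ‖b‖ * Ml * M₂ :=
    (abs_extDeriv_le g k _ _ _ _).trans (by gcongr)
  rw [e2, e1]
  refine (abs_add_le _ _).trans ?_
  rw [abs_mul, abs_neg]
  calc _ ≤ N * ‖b‖ * (C * ‖F‖) * MX + ‖F‖ * Mβ * (N * ‖b‖ * Ml * M₂) := by gcongr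
    _ = _ := by ring

set_option maxHeartbeats 400000 in
/-- Near a parameter `t₁` at which the fields vanishing at `γ t₁` have derivatives independent
modulo the span of the family, a geodesic tangent to the null distribution leaves the degeneracy
set, and the functions `g(k b, l)` satisfy a differential inequality with a simple pole at `t₁`
(and no pole if `γ t₁` is not degenerate).  The key point is that dividing the fields which vanish
at `γ t₁` by `t - t₁` gives a frame which stays independent at `t₁`. -/
lemma extDeriv_le_near [FiniteDimensional ℝ E] [FiniteDimensional ℝ V]
    (S : IsKillingSystem Ω g k) {c : V} {t₁ : ℝ} (hJ : J ∈ 𝓝 t₁)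
    (hγ : IsGeodesic Ω g J γ γ' γ'') (hc : k (γ t₁) c ≠ 0)
    (hf : ∀ b, g (γ t₁) (k (γ t₁) b) (k (γ t₁) c) = 0)
    (htan : ∀ t ∈ J, g (γ t) (k (γ t) c) (γ' t) = 0)
    (hind : ∀ b b', k (γ t₁) b = 0 → fderiv ℝ k (γ t₁) (γ' t₁) b = k (γ t₁) b' → b = 0) :
    ∃ C D : ℝ, 0 ≤ C ∧ 0 ≤ D ∧ (Function.Injective (k (γ t₁)) → D = 0) ∧
      ∀ᶠ t in 𝓝[≠] t₁, Function.Injective (k (γ t)) ∧ ∀ b,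
        |extDeriv g k (γ t) b (k (γ t) c) (γ' t)| ≤ (C + D * |t - t₁|⁻¹) *
          ‖((g (γ t)).comp (k (γ t))).flip (k (γ t) c)‖ * ‖b‖ := by
  have hJ₁ := mem_of_mem_nhds hJ
  set x := γ t₁ with hx
  have hxΩ : x ∈ Ω := hγ.mem t₁ hJ₁
  -- a functional `ξ` vanishing on `ker (k x)` with `ξ c = 1`
  obtain ⟨ξ₀, hξ₀⟩ := SeparatingDual.exists_eq_one (R := ℝ) hc
  set ξ : V →L[ℝ] ℝ := ξ₀.comp (k x) with hξd
  have hξ : ξ c = 1 := hξ₀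
  have hξk : ∀ b, k x b = 0 → ξ b = 0 := fun b hb => by simp [hξd, hb]
  -- a projection `P` onto `ker (k x)` with `P c = 0`
  obtain ⟨p, hp⟩ := (LinearMap.ker (k x).toLinearMap).subtype.exists_leftInverse_of_injective
    (Submodule.ker_subtype _)
  set P₀ : V →L[ℝ] V := ((LinearMap.ker (k x).toLinearMap).subtype ∘ₗ p).toContinuousLinearMap
  set P : V →L[ℝ] V := P₀.comp (ContinuousLinearMap.id ℝ V - ξ.smulRight c) with hPd
  have hP₀ : ∀ b, k x b = 0 → P₀ b = b := fun b hb =>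
    congrArg Subtype.val (LinearMap.congr_fun hp ⟨b, hb⟩)
  have hPk : ∀ b, k x (P b) = 0 := fun b => (p ((ContinuousLinearMap.id ℝ V - ξ.smulRight c) b)).2
  have hP : ∀ b, k x b = 0 → P b = b := fun b hb => by simp [hPd, hξk b hb, hP₀ b hb]
  have hPc : P c = 0 := by simp [hPd, hξ]
  have hPP : ∀ b, P (P b) = P b := fun b => hP _ (hPk b)
  -- the rescaled frame
  set G : ℝ → V →L[ℝ] E := fun t => (k (γ t)).comp P with hG
  have dk : HasDerivAt (fun t => k (γ t)) (fderiv ℝ k x (γ' t₁)) t₁ :=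
    (S.hasFDerivAt_field hxΩ).comp_hasDerivAt t₁ (hγ.deriv t₁ hJ₁)
  have dG : HasDerivAt G ((fderiv ℝ k x (γ' t₁)).comp P) t₁ := by
    have := dk.clm_comp (hasDerivAt_const t₁ P)
    simpa using this
  have hG0 : G t₁ = 0 := by ext b; exact hPk b
  -- `L t` agrees with `k (γ t)` on the kernel of `P`, and with `(t - t₁)⁻¹ • k (γ t)` on its range
  set L : ℝ → V →L[ℝ] E := fun t =>
    (k (γ t)).comp (ContinuousLinearMap.id ℝ V - P) + dslope G t₁ t with hLd
  have kc : ContinuousAt (fun t => k (γ t)) t₁ := dk.continuousAt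
  have hLc : ContinuousAt L t₁ :=
    (kc.clm_comp continuousAt_const).add (continuousAt_dslope_same.2 dG.differentiableAt)
  have hL₁ : ∀ b, L t₁ b = k x (b - P b) + fderiv ℝ k x (γ' t₁) (P b) := fun b => by
    simp [hLd, dslope_same, dG.deriv, ← hx]
  have hL : ∀ t, t ≠ t₁ → ∀ b, L t b = k (γ t) ((b - P b) + (t - t₁)⁻¹ • P b) := fun t ht b => by
    simp [hLd, dslope_of_ne _ ht, slope, hG, ← hx, hPk]
  have hLcc : ∀ t, t ≠ t₁ → L t c = k (γ t) c := fun t ht => by rw [hL t ht, hPc]; simp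
  -- the frame at `t₁`
  have hL₁i : Function.Injective (L t₁) := by
    rw [injective_iff_map_eq_zero]
    intro b hb
    rw [hL₁] at hb
    have h0 : P b = 0 := hind (P b) (-(b - P b)) (hPk b) (by
      rw [map_neg]; exact eq_neg_of_add_eq_zero_right hb)
    rw [h0] at hb
    simp only [sub_zero, map_zero, add_zero] at hb
    rw [← hP b hb, h0]
  have hL₁c : L t₁ c = k x c := by rw [hL₁, hPc]; simp
  have hL₁o : ∀ b, g x (L t₁ b) (L t₁ c) = 0 := fun b => by
    rw [hL₁c, hL₁, map_add, add_apply, hf, zero_add]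
    exact S.fderiv_orthogonal_of_eq_zero hxΩ (hPk b) _ _
  have gc : ContinuousAt (fun t => g (γ t)) t₁ :=
    ((S.hasFDerivAt_metric hxΩ).continuousAt).comp (f := γ) (hγ.deriv t₁ hJ₁).continuousAt
  -- solvability of the two linear systems of `extDeriv_eq_of_frame`
  have hQc : ContinuousAt (fun t => ((g (γ t)).comp (L t)).flip) t₁ :=
    continuousAt_clm_flip (gc.clm_comp hLc)
  have hBc : ContinuousAt (fun t => borderedGram (g (γ t)) (L t) ξ) t₁ :=
    (continuousAt_clm_flip (hQc.clm_comp hLc)).add continuousAt_const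
  obtain ⟨C₁, hC₁0, hC₁⟩ := exists_bounded_solution hBc
    (S.borderedGram_bijective hxΩ hL₁i (by rwa [hL₁c]) hL₁o hξ).2
  have hQs : Function.Surjective ((g (γ t₁)).comp (L t₁)).flip := by
    -- a functional `φ` on `V` is extended to `E` by a left inverse of `L t₁`, and the extension is
    -- represented by a vector
    intro φ
    obtain ⟨R, hR⟩ := (L t₁).toLinearMap.exists_leftInverse_of_injective
      (LinearMap.ker_eq_bot.2 hL₁i)
    refine ⟨(g x).inverse (φ.comp R.toContinuousLinearMap), ?_⟩
    ext b
    have h1 : g x (L t₁ b) ((g x).inverse (φ.comp R.toContinuousLinearMap)) = φ b := by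
      rw [S.symm x hxΩ, S.metric_inverse_apply hxΩ]
      exact congrArg φ (LinearMap.congr_fun hR b)
    simpa using h1
  obtain ⟨C₂, hC₂0, hC₂⟩ := exists_bounded_solution hQc hQs
  -- local bounds
  have γc : ContinuousAt γ t₁ := (hγ.deriv t₁ hJ₁).continuousAt
  have Xc : ContinuousAt γ' t₁ := (hγ.deriv₂ t₁ hJ₁).continuousAt
  have dgc : ContinuousAt (fun t => fderiv ℝ g (γ t)) t₁ :=
    (S.hasFDerivAt_fderiv_metric hxΩ).continuousAt.comp (f := γ) γc
  have dkc : ContinuousAt (fun t => fderiv ℝ k (γ t)) t₁ :=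
    (S.hasFDerivAt_fderiv_field hxΩ).continuousAt.comp (f := γ) γc
  obtain ⟨MX, hMX, bX⟩ := Xc.exists_eventually_norm_le
  obtain ⟨Mg, hMg, bg⟩ := gc.exists_eventually_norm_le
  obtain ⟨ML, hML, bL⟩ := hLc.exists_eventually_norm_le
  obtain ⟨Mk, hMk, bk⟩ := kc.exists_eventually_norm_le
  obtain ⟨Mdg, hMdg, bdg⟩ := dgc.exists_eventually_norm_le
  obtain ⟨Mdk, hMdk, bdk⟩ := dkc.exists_eventually_norm_le
  set Mβ := C₁ * (Mg * ML * MX)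
  set N := 2 * Mdg * Mk + 2 * Mg * Mdk
  set Ml := Mk * ‖c‖
  set C := N * C₂ * (MX + ML * Mβ) + Mβ * N * (Ml + C₂ * (Mg * ML * Ml)) * (C₂ * ‖ξ‖)
  have hC0 : 0 ≤ C := by positivity
  refine ⟨C * (1 + ‖P‖), C * ‖P‖, by positivity, by positivity, fun hi => ?_, ?_⟩
  · have : P = 0 := by
      ext b
      exact hi (by rw [hPk]; simp)
    simp [this]
  filter_upwards [nhdsWithin_le_nhds hJ, nhdsWithin_le_nhds hC₁, nhdsWithin_le_nhds hC₂,
    nhdsWithin_le_nhds bX, nhdsWithin_le_nhds bg, nhdsWithin_le_nhds bL,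
    nhdsWithin_le_nhds bk, nhdsWithin_le_nhds bdg, nhdsWithin_le_nhds bdk,
    self_mem_nhdsWithin] with t htJ h1 h2 bX bg bL bk bdg bdk htne
  replace htne : t ≠ t₁ := htne
  have hz := hγ.mem t htJ
  have hτ : t - t₁ ≠ 0 := sub_ne_zero.2 htne
  -- the rescaling is invertible
  have hσs : Function.Surjective fun b : V => (b - P b) + (t - t₁)⁻¹ • P b := fun b => by
    refine ⟨(b - P b) + (t - t₁) • P b, ?_⟩
    simp only [map_add, map_sub, map_smul, hPP, smul_smul, inv_mul_cancel₀ hτ, sub_self, zero_add,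
      one_smul]
    abel
  have hLi : Function.Injective (L t) := by
    rw [injective_iff_map_eq_zero]
    intro b hb
    by_contra hne
    obtain ⟨φ, hφ⟩ := SeparatingDual.exists_eq_one (R := ℝ) hne
    obtain ⟨Z, hZ, -⟩ := h2 φ
    rw [← hZ] at hφ
    simp [hb] at hφ
  have hinj : Function.Injective (k (γ t)) := by
    rw [injective_iff_map_eq_zero]
    intro b hb
    have h3 : L t ((b - P b) + (t - t₁) • P b) = 0 := by
      rw [hL t htne, ← hb]
      congr 1
      simp only [map_add, map_sub, map_smul, hPP, smul_smul, inv_mul_cancel₀ hτ, sub_self, zero_add,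
        one_smul]
      abel
    have h4 : (b - P b) + (t - t₁) • P b = 0 := hLi (by rw [h3, map_zero])
    have h5 := congrArg P h4
    simp only [map_add, map_sub, map_smul, hPP, sub_self, zero_add, map_zero, smul_eq_zero, hτ,
      false_or] at h5
    simpa [h5] using h4
  refine ⟨hinj, fun b => ?_⟩
  set l := k (γ t) c with hl
  set F := ((g (γ t)).comp (k (γ t))).flip l with hF
  set F' : V →L[ℝ] ℝ := ((g (γ t)).comp (L t)).flip l with hF'
  obtain ⟨β, hβ, hβn⟩ := h1 (((g (γ t)).comp (L t)).flip (γ' t))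
  obtain ⟨Z₁, hZ₁, hZ₁n⟩ := h2 F'
  obtain ⟨Z₂, hZ₂, hZ₂n⟩ := h2 ξ
  have opn : ∀ Y : E, ‖((g (γ t)).comp (L t)).flip Y‖ ≤ Mg * ML * ‖Y‖ := fun Y => by
    refine ((((g (γ t)).comp (L t)).flip).le_opNorm Y).trans ?_
    rw [ContinuousLinearMap.opNorm_flip]
    gcongr
    exact ((g (γ t)).opNorm_comp_le (L t)).trans (by gcongr)
  have nβ : ‖β‖ ≤ Mβ := hβn.trans (by
    refine mul_le_mul_of_nonneg_left ((opn _).trans ?_) hC₁0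
    gcongr)
  have nl : ‖l‖ ≤ Ml := ((k (γ t)).le_opNorm c).trans (mul_le_mul_of_nonneg_right bk (norm_nonneg _))
  have nF' : ‖F'‖ ≤ Mg * ML * Ml := (opn l).trans (by gcongr)
  have nX : ‖γ' t - L t β‖ ≤ MX + ML * Mβ :=
    (norm_sub_le _ _).trans (add_le_add bX (((L t).le_opNorm β).trans (by gcongr)))
  have nlZ : ‖l - Z₁‖ ≤ Ml + C₂ * (Mg * ML * Ml) :=
    (norm_sub_le _ _).trans (add_le_add nl (hZ₁n.trans (by gcongr)))
  have nN : 2 * ‖fderiv ℝ g (γ t)‖ * ‖k (γ t)‖ + 2 * ‖g (γ t)‖ * ‖fderiv ℝ k (γ t)‖ ≤ N := by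
    simp only [N]; gcongr
  have i3 : |extDeriv g k (γ t) b l (γ' t)| ≤ C * ‖F'‖ * ‖b‖ :=
    S.abs_extDeriv_le_of_frame hz hinj (hL t htne) hσs (hLcc t htne) (htan t htJ) hξ
      (fun b' => by rw [← borderedGram_apply, hβ]; simp)
      (fun b => congrArg (fun f => f b) hZ₁)
      (fun b => congrArg (fun f => f b) hZ₂) b (fun b => rfl)
      nN nβ nX hZ₁n nlZ hZ₂n
  -- the passage from the rescaled frame back to the family produces the pole
  have i4 : ‖F'‖ ≤ (1 + ‖P‖ + ‖P‖ * |t - t₁|⁻¹) * ‖F‖ := by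
    refine ContinuousLinearMap.opNorm_le_bound _ (by positivity) fun b => ?_
    have h3 : F' b = F ((b - P b) + (t - t₁)⁻¹ • P b) := by
      simp only [hF', hF, ContinuousLinearMap.flip_apply, ContinuousLinearMap.comp_apply]
      rw [hL t htne]
    have h4 : ‖(b - P b) + (t - t₁)⁻¹ • P b‖ ≤ (1 + ‖P‖ + ‖P‖ * |t - t₁|⁻¹) * ‖b‖ := by
      have h5 := P.le_opNorm b
      refine (norm_add_le _ _).trans ?_
      refine (add_le_add (norm_sub_le _ _) le_rfl).trans ?_
      rw [norm_smul, norm_inv, Real.norm_eq_abs]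
      calc _ ≤ ‖b‖ + ‖P‖ * ‖b‖ + |t - t₁|⁻¹ * (‖P‖ * ‖b‖) := by gcongr
        _ = _ := by ring
    rw [h3]
    refine (F.le_opNorm _).trans ?_
    calc _ ≤ ‖F‖ * ((1 + ‖P‖ + ‖P‖ * |t - t₁|⁻¹) * ‖b‖) := by gcongr
      _ = _ := by ring
  exact i3.trans (le_of_le_of_eq (mul_le_mul_of_nonneg_right (mul_le_mul_of_nonneg_left i4 hC0)
    (norm_nonneg b)) (by ring))

end IsKillingSystem

end

section

variable {E V : Type*} [NormedAddCommGroup E] [NormedSpace ℝ E] [NormedAddCommGroup V]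
  [NormedSpace ℝ V]

namespace IsKillingSystem

variable {Ω : Set E} {g : E → E →L[ℝ] E →L[ℝ] ℝ} {k : E → V →L[ℝ] E} {z : E}
  {J : Set ℝ} {γ γ' γ'' : ℝ → E}

/-- A geodesic tangent to the null distribution, which starts at a regular point and has stayed in
the closure of the set of regular points up to the parameter `t₁`, consists of regular points
right after `t₁`.  If `γ t₁` is degenerate, the functions `g(k b, l)` vanish to infinite order at
`t₁`, since they vanish before `t₁`, and this makes up for the pole of the differential inequality
they satisfy. -/
lemma eventually_mem_regularSet [FiniteDimensional ℝ E] [FiniteDimensional ℝ V]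
    (S : IsKillingSystem Ω g k) {c : V} {e : E} (he : ∀ z ∈ Ω, g z (k z c) e ≠ 0)
    {t₀ t₁ : ℝ} (h01 : t₀ ≤ t₁) (hJ : IsOpen J) (hsub : Icc t₀ t₁ ⊆ J)
    (hγ : IsGeodesic Ω g J γ γ' γ'') (hsm : ContDiffAt ℝ ∞ γ t₁)
    (h0 : γ t₀ ∈ regularSet Ω g k c)
    (hcl : ∀ t ∈ Icc t₀ t₁, γ t ∈ closure (regularSet Ω g k c))
    (htan : ∀ t ∈ J, g (γ t) (k (γ t) c) (γ' t) = 0) :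
    ∀ᶠ t in 𝓝[>] t₁, γ t ∈ regularSet Ω g k c := by
  have hr := right_mem_Icc.2 h01
  have hJ₁ : J ∈ 𝓝 t₁ := hJ.mem_nhds (hsub hr)
  have hx := hγ.mem t₁ (hsub hr)
  have hc : ∀ z ∈ Ω, k z c ≠ 0 := fun z hz h => he _ hz (by simp [h])
  obtain ⟨C, D, hC, hD, hD0, hev⟩ := S.extDeriv_le_near hJ₁ hγ (hc _ hx)
    (S.orthogonal_of_mem_closure hx (hcl t₁ hr)) htan fun b b' hb hb' =>
      S.eq_zero_of_fderiv_mem_range he h01 (hγ.mono hsub) h0 hcl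
        (fun t ht => htan t (hsub ht)) hb hb'
  set F : ℝ → V →L[ℝ] ℝ := fun t => ((g (γ t)).comp (k (γ t))).flip (k (γ t) c) with hF
  have hFb : ∀ t b, F t b = g (γ t) (k (γ t) b) (k (γ t) c) := fun t b => rfl
  have fl := (ContinuousLinearMap.flipₗᵢ ℝ V E ℝ).contDiff (n := ∞)
  have hFs : ∀ (n : ℕ∞) t, t ∈ J → ContDiffAt ℝ n γ t → ContDiffAt ℝ n F t := fun n t ht h => by
    have hz := S.isOpen.mem_nhds (hγ.mem t ht)
    have h1 := ((S.smooth_metric.contDiffAt hz).of_le (mod_cast le_top : (n : WithTop ℕ∞) ≤ ∞)).comp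
      t h
    have h2 := ((S.smooth_field.contDiffAt hz).of_le (mod_cast le_top : (n : WithTop ℕ∞) ≤ ∞)).comp
      t h
    exact ((fl.of_le (mod_cast le_top)).contDiffAt.comp t (h1.clm_comp h2)).clm_apply
      (h2.clm_apply contDiffAt_const)
  have hFd : ∀ t ∈ J, HasDerivAt F (deriv F t) t := fun t ht => by
    have hz := hγ.mem t ht
    have h1 := ((S.hasFDerivAt_metric hz).comp_hasDerivAt t (hγ.deriv t ht))
    have h2 := ((S.hasFDerivAt_field hz).comp_hasDerivAt t (hγ.deriv t ht))
    have h3 := ((fl.differentiable (by simp)).differentiableAt.comp t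
      (h1.clm_comp h2).differentiableAt)
    exact (h3.clm_apply (h2.differentiableAt.clm_apply (differentiableAt_const c))).hasDerivAt
  have hFe : ∀ t ∈ J, ∀ b, deriv F t b = - extDeriv g k (γ t) b (k (γ t) c) (γ' t) :=
    fun t ht b => by
    have h1 := (hFd t ht).clm_apply (hasDerivAt_const t b)
    simpa using h1.unique (S.hasDerivAt_inner_along hγ ht b c)
  have hF0 : ∀ t ∈ Icc t₀ t₁, F t = 0 := fun t ht => by
    ext b
    exact S.orthogonal_of_mem_closure (hγ.mem t (hsub ht)) (hcl t ht) b
  have hbound : ∀ᶠ t in 𝓝[>] t₁, t ∈ J ∧ Function.Injective (k (γ t)) ∧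
      ‖deriv F t‖ ≤ (C + D * |t - t₁|⁻¹) * ‖F t‖ := by
    filter_upwards [nhdsGT_le_nhdsNE t₁ hev, nhdsWithin_le_nhds hJ₁] with t ht htJ
    refine ⟨htJ, ht.1, ContinuousLinearMap.opNorm_le_bound _ (by positivity) fun b => ?_⟩
    rw [hFe t htJ, norm_neg]
    exact ht.2 b
  obtain ⟨u, hu, husub⟩ := (mem_nhdsGT_iff_exists_Ioo_subset).1 hbound
  set δ := min (u - t₁) 1 with hδ
  have hδ0 : 0 < δ := lt_min (sub_pos.2 hu) one_pos
  have hmem : ∀ t ∈ Ioo t₁ (t₁ + δ), t ∈ Ioo t₁ u := fun t ht =>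
    ⟨ht.1, by have := min_le_left (u - t₁) 1; linarith [ht.2]⟩
  have hzero : ∀ t ∈ Ioo t₁ (t₁ + δ), F t = 0 := by
    rcases h01.eq_or_lt with rfl | hlt
    · -- at the regular initial point there is no pole
      intro t ht
      rw [hD0 h0.2.1] at husub
      have htu := hmem t ht
      have hmem' : ∀ s ∈ Icc t₀ t, s = t₀ ∨ s ∈ Ioo t₀ u := fun s hs =>
        hs.1.eq_or_lt.imp Eq.symm fun h => ⟨h, hs.2.trans_lt htu.2⟩
      refine eq_zero_of_norm_deriv_le (f := F) (f' := deriv F) (C := C) (a := t₀) (b := t)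
        (fun s hs => hFd s ?_) (fun s hs => ?_) (left_mem_Icc.2 ht.1.le) (hF0 _ hr) t
        (right_mem_Icc.2 ht.1.le)
      · rcases hmem' s hs with rfl | h
        · exact hsub hr
        · exact (husub h).1
      · rcases hmem' s hs with rfl | h
        · have : deriv F s = 0 := by
            ext b
            rw [hFe s (hsub hr), S.extDeriv_null_eq_zero h0 (hc _ hx) b (htan s (hsub hr))]
            simp
          rw [this, norm_zero]; positivity
        · simpa using (husub h).2.2
    · -- `F` vanishes on the left of `t₁`, hence is flat at `t₁`
      refine eq_zero_of_norm_deriv_le_inv_mul (f' := deriv F) (C := C + D)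
        (fun t ht => hFd t (husub (hmem t ht)).1) (fun t ht => ?_) fun N => ?_
      · refine (husub (hmem t ht)).2.2.trans ?_
        have h1 : 0 < t - t₁ := sub_pos.2 ht.1
        have h2 : t - t₁ ≤ 1 := by have := min_le_right (u - t₁) 1; linarith [ht.2]
        have h3 : 1 ≤ (t - t₁)⁻¹ := (one_le_inv₀ h1).2 h2
        rw [abs_of_pos h1]
        refine mul_le_mul_of_nonneg_right ?_ (norm_nonneg _)
        rw [add_mul]
        exact add_le_add (le_mul_of_one_le_right hC h3) le_rfl
      · obtain ⟨B, -, hB⟩ := norm_le_pow_of_eq_zero_left N (hFs ⊤ t₁ (hsub hr) hsm) (by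
          filter_upwards [Ioo_mem_nhdsLT hlt] with t ht using hF0 t ⟨ht.1.le, ht.2.le⟩)
        exact ⟨B, nhdsWithin_mono _ Ioi_subset_Ici_self hB⟩
  filter_upwards [Ioo_mem_nhdsGT (show t₁ < t₁ + δ by linarith)] with t ht
  have h1 := husub (hmem t ht)
  refine ⟨hγ.mem t h1.1, h1.2.1, fun b => ?_⟩
  rw [← hFb, hzero t ht]; rfl

/-- A geodesic tangent to the null distribution at one parameter is tangent to it throughout, by
conservation of the momentum of `k c`. -/
lemma tangent_of_tangent (S : IsKillingSystem Ω g k) {c : V} {a b t₀ : ℝ}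
    (hγ : IsGeodesic Ω g (Ioo a b) γ γ' γ'') (ht₀ : t₀ ∈ Ioo a b)
    (htan : g (γ t₀) (k (γ t₀) c) (γ' t₀) = 0) :
    ∀ t ∈ Ioo a b, g (γ t) (k (γ t) c) (γ' t) = 0 := by
  intro t ht
  have hs : Icc (min t₀ t) (max t₀ t) ⊆ Ioo a b := fun s hs =>
    ⟨(lt_min ht₀.1 ht.1).trans_le hs.1, hs.2.trans_lt (max_lt ht₀.2 ht.2)⟩
  exact eq_zero_of_norm_deriv_le (C := 0) (fun s h => S.hasDerivAt_momentum hγ (hs h) c)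
    (fun s _ => by simp) ⟨min_le_left _ _, le_max_left _ _⟩ htan t
    ⟨min_le_right _ _, le_max_right _ _⟩

/-- A geodesic tangent to the null distribution which starts at a regular point stays in the
closure of the set of regular points. -/
lemma geodesic_mem_closure [FiniteDimensional ℝ E] [FiniteDimensional ℝ V]
    (S : IsKillingSystem Ω g k) {c : V} {e : E} (he : ∀ z ∈ Ω, g z (k z c) e ≠ 0)
    {a b t₀ : ℝ} (hγ : IsGeodesic Ω g (Ioo a b) γ γ' γ'') (hsm : ∀ t ∈ Ioo a b, ContDiffAt ℝ ∞ γ t)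
    (ht₀ : t₀ ∈ Ioo a b) (h0 : γ t₀ ∈ regularSet Ω g k c)
    (htan : g (γ t₀) (k (γ t₀) c) (γ' t₀) = 0) {T : ℝ} (hT : T ∈ Ioo a b) (h0T : t₀ ≤ T) :
    γ T ∈ closure (regularSet Ω g k c) := by
  have htan' := S.tangent_of_tangent hγ ht₀ htan
  have hsub : Icc t₀ T ⊆ Ioo a b := fun s hs => ⟨ht₀.1.trans_le hs.1, hs.2.trans_lt hT.2⟩
  set s : Set ℝ := {t | ∀ r ∈ Icc t₀ t, γ r ∈ closure (regularSet Ω g k c)}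
  have hclosed : IsClosed (s ∩ Icc t₀ T) := by
    refine isClosed_of_closure_subset fun t ht => ?_
    have htI : t ∈ Icc t₀ T := by
      have := closure_mono inter_subset_right ht
      rwa [isClosed_Icc.closure_eq] at this
    have hlt : ∀ r ∈ Ico t₀ t, γ r ∈ closure (regularSet Ω g k c) := fun r hr => by
      obtain ⟨y, hy1, hy2⟩ := mem_closure_iff.1 ht (Ioi r) isOpen_Ioi hr.2
      exact hy2.1 r ⟨hr.1, le_of_lt hy1⟩
    refine ⟨fun r hr => ?_, htI⟩
    rcases hr.2.eq_or_lt with rfl | h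
    · rcases hr.1.eq_or_lt with rfl | h
      · exact subset_closure h0
      · have hcont : ContinuousAt γ r := (hγ.deriv r (hsub ⟨hr.1, htI.2⟩)).continuousAt
        have hm : r ∈ closure (Ico t₀ r) := by
          rw [closure_Ico h.ne]; exact right_mem_Icc.2 h.le
        have := hcont.continuousWithinAt.mem_closure hm (t := closure (regularSet Ω g k c)) hlt
        rwa [closure_closure] at this
    · exact hlt r ⟨hr.1, h⟩
  have key := hclosed.Icc_subset_of_forall_exists_gt (fun r hr => by
    have : r = t₀ := le_antisymm hr.2 hr.1
    rw [this]; exact subset_closure h0) (fun t ht y hy => by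
    have htI : Icc t₀ t ⊆ Ioo a b := fun r hr => hsub ⟨hr.1, hr.2.trans ht.2.2.le⟩
    have hev := S.eventually_mem_regularSet he ht.2.1 isOpen_Ioo htI hγ
      (hsm t (hsub ⟨ht.2.1, ht.2.2.le⟩)) h0 ht.1 htan'
    obtain ⟨u, hu, husub⟩ := (mem_nhdsGT_iff_exists_Ioc_subset).1 hev
    refine ⟨min u y, fun r hr => ?_, lt_min hu hy, min_le_right _ _⟩
    rcases le_or_gt r t with h | h
    · exact ht.1 r ⟨hr.1, h⟩
    · exact subset_closure (husub ⟨h, hr.2.trans (min_le_left _ _)⟩))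
  exact key (right_mem_Icc.2 h0T) T (right_mem_Icc.2 h0T)

end IsKillingSystem

end

/-! ### The geodesic flow near a limit of regular points -/

section

variable {E V : Type*} [NormedAddCommGroup E] [NormedSpace ℝ E] [NormedAddCommGroup V]
  [NormedSpace ℝ V]

/-- The acceleration of the geodesic with velocity `v` at `z`. -/
noncomputable def accel (g : E → E →L[ℝ] E →L[ℝ] ℝ) (z v : E) : E :=
  -(g z).inverse (fderiv ℝ g z v v - (1 / 2 : ℝ) • ((fderiv ℝ g z).flip v).flip v)

/-- The geodesic spray: the geodesic equation as a first order system. -/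
noncomputable def spray (g : E → E →L[ℝ] E →L[ℝ] ℝ) (p : E × E) : E × E := (p.2, accel g p.1 p.2)

namespace IsKillingSystem

variable {Ω : Set E} {g : E → E →L[ℝ] E →L[ℝ] ℝ} {k : E → V →L[ℝ] E} {z : E}

lemma geodesicEq_accel [FiniteDimensional ℝ E] (S : IsKillingSystem Ω g k) (hz : z ∈ Ω) (v : E) :
    GeodesicEq g z v (accel g z v) := by
  intro w
  rw [accel, map_neg, S.metric_inverse_apply hz]
  simp
  ring

lemma spray_zero (q : E) : spray g (q, 0) = 0 := by simp [spray, accel]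

lemma contDiffOn_spray [FiniteDimensional ℝ E] (S : IsKillingSystem Ω g k) :
    ContDiffOn ℝ ∞ (spray g) (Ω ×ˢ univ) := by
  have hm : MapsTo (Prod.fst : E × E → E) (Ω ×ˢ univ) Ω := fun p hp => hp.1
  have f1 : ContDiffOn ℝ ∞ (Prod.fst : E × E → E) (Ω ×ˢ univ) := contDiffOn_fst
  have f2 : ContDiffOn ℝ ∞ (Prod.snd : E × E → E) (Ω ×ˢ univ) := contDiffOn_snd
  have h1 := S.contDiffOn_fderiv_metric.comp f1 hm
  have h2 := S.contDiffOn_inverse.comp f1 hm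
  have fl := (ContinuousLinearMap.flipₗᵢ ℝ E E (E →L[ℝ] ℝ)).contDiff (n := ∞)
  have fl' := (ContinuousLinearMap.flipₗᵢ ℝ E E ℝ).contDiff (n := ∞)
  have h3 := (fl'.comp_contDiffOn ((fl.comp_contDiffOn h1).clm_apply f2)).clm_apply f2
  exact f2.prodMk (h2.clm_apply (((h1.clm_apply f2).clm_apply f2).sub
    (h3.const_smul (1 / 2 : ℝ)))).neg

/-- The local geodesic flow near the zero velocity at `q`, with values in a given neighbourhood. -/
lemma exists_flow [FiniteDimensional ℝ E] (S : IsKillingSystem Ω g k) {q : E} (hq : q ∈ Ω)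
    {U : Set (E × E)} (hU : U ∈ 𝓝 (q, (0 : E))) :
    ∃ α : E × E → ℝ → E × E, ∃ ε > 0, ∃ r > 0, ∃ K : NNReal,
      (∀ x ∈ Metric.closedBall (q, (0 : E)) r, α x 0 = x ∧
        ∀ t ∈ Ioo (-ε) ε, α x t ∈ U ∧ HasDerivAt (α x) (spray g (α x t)) t) ∧
      ∀ t ∈ Ioo (-ε) ε, LipschitzOnWith K (α · t) (Metric.closedBall (q, (0 : E)) r) := by
  have hs : ContDiffAt ℝ 1 (spray g) (q, (0 : E)) :=
    (S.contDiffOn_spray.contDiffAt ((S.isOpen.prod isOpen_univ).mem_nhds ⟨hq, mem_univ _⟩)).of_le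
      (by simp)
  obtain ⟨ε, hε, a, r, L, K, hr, hpl⟩ := IsPicardLindelof.of_contDiffAt_one hs
  obtain ⟨α, hα, K', hK⟩ :=
    (hpl 0).exists_forall_mem_closedBall_eq_hasDerivWithinAt_lipschitzOnWith
  simp only [zero_sub, zero_add] at hα hK
  have hx₀ : (q, (0 : E)) ∈ Metric.closedBall (q, (0 : E)) (r : ℝ) :=
    Metric.mem_closedBall_self r.2
  -- the solutions with nearby initial values stay near `(q, 0)` for a short time
  obtain ⟨η, hη, hηU⟩ := Metric.mem_nhds_iff.1 hU
  have hd := ((hα _ hx₀).2 0 ⟨by linarith, hε.le⟩).hasDerivAt (Icc_mem_nhds (by linarith) hε)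
  have hc := hd.continuousAt
  rw [ContinuousAt, (hα _ hx₀).1] at hc
  obtain ⟨ε₁, hε₁, hball⟩ := Metric.mem_nhds_iff.1 (hc (Metric.ball_mem_nhds _ (half_pos hη)))
  set r' := min (r : ℝ) (η / 2 / (K' + 1))
  have hr' : 0 < r' := lt_min hr (by positivity)
  have hsub : Metric.closedBall (q, (0 : E)) r' ⊆ Metric.closedBall (q, (0 : E)) (r : ℝ) :=
    Metric.closedBall_subset_closedBall (min_le_left _ _)
  have hI : ∀ t ∈ Ioo (-min ε ε₁) (min ε ε₁), t ∈ Ioo (-ε) ε ∧ t ∈ Ioo (-ε₁) ε₁ := fun t ht => by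
    have h1 := min_le_left ε ε₁
    have h2 := min_le_right ε ε₁
    exact ⟨⟨by linarith [ht.1], by linarith [ht.2]⟩, ⟨by linarith [ht.1], by linarith [ht.2]⟩⟩
  refine ⟨α, min ε ε₁, lt_min hε hε₁, r', hr', K', fun x hx => ⟨(hα x (hsub hx)).1,
    fun t ht => ⟨hηU ?_, ?_⟩⟩, fun t ht => (hK t (Ioo_subset_Icc_self (hI t ht).1)).mono hsub⟩
  · have h1 : dist (α (q, 0) t) (q, 0) < η / 2 := hball (by
      rw [Metric.mem_ball, Real.dist_eq, sub_zero, abs_lt]; exact (hI t ht).2)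
    have h2 := (hK t (Ioo_subset_Icc_self (hI t ht).1)).dist_le_mul x (hsub hx) _ hx₀
    have h3 : dist x (q, 0) ≤ η / 2 / (K' + 1) := (Metric.mem_closedBall.1 hx).trans
      (min_le_right _ _)
    have h4 : (K' : ℝ) * dist x (q, 0) ≤ η / 2 := by
      calc (K' : ℝ) * dist x (q, 0) ≤ (K' + 1) * (η / 2 / (K' + 1)) := by
            gcongr; linarith
        _ = η / 2 := by field_simp
    rw [Metric.mem_ball]
    linarith [dist_triangle (α x t) (α (q, 0) t) (q, 0)]
  · exact ((hα x (hsub hx)).2 t (Ioo_subset_Icc_self (hI t ht).1)).hasDerivAt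
      (Icc_mem_nhds (hI t ht).1.1 (hI t ht).1.2)

lemma isGeodesic_of_spray [FiniteDimensional ℝ E] (S : IsKillingSystem Ω g k) {J : Set ℝ}
    {p : ℝ → E × E} (hm : ∀ t ∈ J, (p t).1 ∈ Ω) (hp : ∀ t ∈ J, HasDerivAt p (spray g (p t)) t) :
    IsGeodesic Ω g J (fun t => (p t).1) (fun t => (p t).2) (fun t => accel g (p t).1 (p t).2) where
  mem := hm
  deriv t ht := (hp t ht).fst
  deriv₂ t ht := (hp t ht).snd
  eq t ht := S.geodesicEq_accel (hm t ht) _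
  cont := (continuousOn_snd.comp (t := univ) S.contDiffOn_spray.continuousOn
      (fun _ _ => mem_univ _) |>.comp (f := p)
      (fun t ht => (hp t ht).continuousAt.continuousWithinAt) fun t ht => ⟨hm t ht, mem_univ _⟩)

lemma contDiffAt_of_spray [FiniteDimensional ℝ E] (S : IsKillingSystem Ω g k) {a b : ℝ}
    {p : ℝ → E × E} (hm : ∀ t ∈ Ioo a b, (p t).1 ∈ Ω)
    (hp : ∀ t ∈ Ioo a b, HasDerivAt p (spray g (p t)) t) {t : ℝ} (ht : t ∈ Ioo a b) :
    ContDiffAt ℝ ∞ (fun t => (p t).1) t := by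
  obtain ⟨a', ha'⟩ := exists_between ht.1
  obtain ⟨b', hb'⟩ := exists_between ht.2
  have hsub : Icc a' b' ⊆ Ioo a b := fun s hs => ⟨ha'.1.trans_le hs.1, hs.2.trans_lt hb'.2⟩
  have h := ODE.contDiffOn_enat_Icc_of_hasDerivWithinAt (n := ⊤) (f := fun _ => spray g)
    (u := Ω ×ˢ univ) (α := p) (tmin := a') (tmax := b')
    (S.contDiffOn_spray.comp contDiffOn_snd fun x hx => hx.2)
    (fun s hs => (hp s (hsub hs)).hasDerivWithinAt) (fun s hs => ⟨hm s (hsub hs), mem_univ _⟩)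
  exact (h.contDiffAt (Icc_mem_nhds ha'.2 hb'.1)).fst

/-- Geodesics tangent to the null distribution which start at a limit of regular points consist of
limits of regular points. -/
lemma flow_mem_closure [FiniteDimensional ℝ E] [FiniteDimensional ℝ V]
    (S : IsKillingSystem Ω g k) {c : V} {e : E} (he : ∀ z ∈ Ω, g z (k z c) e ≠ 0) {q : E}
    (hq : q ∈ Ω) (hqc : q ∈ closure (regularSet Ω g k c)) {α : E × E → ℝ → E × E} {ε r : ℝ}
    {K : NNReal}
    (hα : ∀ x ∈ Metric.closedBall (q, (0 : E)) r, α x 0 = x ∧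
        ∀ t ∈ Ioo (-ε) ε, (α x t).1 ∈ Ω ∧ HasDerivAt (α x) (spray g (α x t)) t)
    (hK : ∀ t ∈ Ioo (-ε) ε, LipschitzOnWith K (α · t) (Metric.closedBall (q, (0 : E)) r))
    {v : E} (hv : ‖v‖ < r) (hvt : g q (k q c) v = 0) {t : ℝ} (ht : t ∈ Ico 0 ε) :
    (α (q, v) t).1 ∈ closure (regularSet Ω g k c) := by
  have hε : 0 < ε := ht.1.trans_lt ht.2
  have htI : t ∈ Ioo (-ε) ε := ⟨by linarith [ht.1], ht.2⟩
  have : (𝓝[regularSet Ω g k c] q).NeBot := mem_closure_iff_nhdsWithin_neBot.1 hqc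
  -- the initial velocity `v` is projected to the distribution at the nearby regular points
  let w : E → E := fun z => v - (g z (k z c) v / g z (k z c) e) • e
  have hw : ContinuousAt w q := by
    have hl := (S.smooth_metric.continuousOn.clm_apply (S.smooth_field.continuousOn.clm_apply
      (continuousOn_const (c := c)))).continuousAt (S.isOpen.mem_nhds hq)
    exact continuousAt_const.sub (((hl.clm_apply continuousAt_const).div
      (hl.clm_apply continuousAt_const) (he q hq)).smul continuousAt_const)
  have hwq : w q = v := by simp [w, hvt]
  have hlim : Tendsto (fun z => (z, w z)) (𝓝[regularSet Ω g k c] q) (𝓝 (q, v)) := by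
    refine Tendsto.mono_left ?_ nhdsWithin_le_nhds
    exact hwq ▸ (continuousAt_id.prodMk hw).tendsto
  have hball : Metric.closedBall (q, (0 : E)) r ∈ 𝓝 (q, v) := by
    refine mem_of_superset (Metric.isOpen_ball.mem_nhds ?_) Metric.ball_subset_closedBall
    rw [Metric.mem_ball, Prod.dist_eq]
    simpa using hv
  have hcont : ContinuousAt (fun x => (α x t).1) (q, v) :=
    ((hK t htI).continuousOn.continuousAt hball).fst
  refine isClosed_closure.mem_of_tendsto (hcont.tendsto.comp hlim) ?_
  filter_upwards [hlim.eventually hball, self_mem_nhdsWithin] with z hz hzr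
  obtain ⟨h0, h1⟩ := hα _ hz
  have hg := S.isGeodesic_of_spray (fun t ht => (h1 t ht).1) (fun t ht => (h1 t ht).2)
  refine S.geodesic_mem_closure he hg
    (fun s hs => S.contDiffAt_of_spray (fun t ht => (h1 t ht).1) (fun t ht => (h1 t ht).2) hs)
    (t₀ := 0) ⟨by linarith, hε⟩ (by rw [h0]; exact hzr) ?_ htI ht.1
  rw [h0]
  simp only [w, map_sub, map_smul, smul_eq_mul]
  rw [div_mul_cancel₀ _ (he z hzr.1), sub_self]

end IsKillingSystem

end

/-! ### Integral graphs of a hyperplane distribution -/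

section Graph

variable {E F : Type*} [NormedAddCommGroup E] [NormedSpace ℝ E] [NormedAddCommGroup F]
  [NormedSpace ℝ F] {Ω : Set E} {θ : E → E →L[ℝ] ℝ} {Ψ : (F × ℝ) ≃L[ℝ] E} {q : E}

/-- The slope at `z` of the hyperplane `ker (θ z)`, as a graph in the coordinates `Ψ`. -/
noncomputable def slope (θ : E → E →L[ℝ] ℝ) (Ψ : (F × ℝ) ≃L[ℝ] E) (z : E) : F →L[ℝ] ℝ :=
  -(θ z (Ψ (0, 1)))⁻¹ • ((θ z).comp (Ψ : (F × ℝ) →L[ℝ] E)).comp (ContinuousLinearMap.inl ℝ F ℝ)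

lemma coord_eq_add (Ψ : (F × ℝ) ≃L[ℝ] E) (h : F) (a : ℝ) :
    Ψ (h, a) = Ψ (h, 0) + a • Ψ (0, 1) := by
  rw [← map_smul, ← map_add]; simp

/-- In the coordinates `Ψ`, the form `θ` measures the deviation from the slope, up to the factor
`θ (Ψ (0, 1))`. -/
lemma apply_coord_eq (hz : θ q (Ψ (0, 1)) ≠ 0) (h : F) (a : ℝ) :
    θ q (Ψ (h, a)) = θ q (Ψ (0, 1)) * (a - slope θ Ψ q h) := by
  rw [coord_eq_add, map_add, map_smul]
  simp [slope]
  field_simp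
  ring

lemma contDiffOn_slope (hθ : ContDiffOn ℝ ∞ θ Ω) (he : ∀ z ∈ Ω, θ z (Ψ (0, 1)) ≠ 0) :
    ContDiffOn ℝ ∞ (slope θ Ψ) Ω := by
  unfold slope
  have h1 : ContDiffOn ℝ ∞ (fun z => θ z (Ψ (0, 1))) Ω := hθ.clm_apply contDiffOn_const
  exact (h1.inv he).neg.smul ((hθ.clm_comp contDiffOn_const).clm_comp contDiffOn_const)

/-- A function whose graph is an integral manifold of a smooth distribution is smooth. -/
lemma contDiffOn_of_slope (hθ : ContDiffOn ℝ ∞ θ Ω) (he : ∀ z ∈ Ω, θ z (Ψ (0, 1)) ≠ 0)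
    {s : Set F} (hs : IsOpen s) {u : F → ℝ} (hm : ∀ x ∈ s, q + Ψ (x, u x) ∈ Ω)
    (hu : ∀ x ∈ s, HasFDerivAt u (slope θ Ψ (q + Ψ (x, u x))) x) : ContDiffOn ℝ ∞ u s := by
  rw [contDiffOn_infty]
  intro n
  induction n with
  | zero =>
    exact contDiffOn_zero.2 fun x hx => (hu x hx).continuousAt.continuousWithinAt
  | succ n ih =>
    push_cast
    rw [contDiffOn_succ_iff_fderiv_of_isOpen hs]
    refine ⟨fun x hx => (hu x hx).differentiableAt.differentiableWithinAt, by simp, ?_⟩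
    have h1 : ContDiffOn ℝ n (fun x => q + Ψ (x, u x)) s :=
      contDiffOn_const.add (Ψ.contDiff.comp_contDiffOn (contDiffOn_id.prodMk ih))
    refine (((contDiffOn_slope hθ he).of_le (mod_cast le_top)).comp h1 hm).congr fun x hx => ?_
    exact (hu x hx).fderiv

/-- A parametrized set whose chords are tangent to the distribution up to a quadratic error is the
graph of a smooth function, and the graph is an integral manifold. -/
lemma exists_integral_graph [CompleteSpace F] (hθ : ContDiffOn ℝ ∞ θ Ω)
    (he : ∀ z ∈ Ω, θ z (Ψ (0, 1)) ≠ 0) {A : Set E} {m r τ C : ℝ} (hm : 0 < m) (hr : 0 < r)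
    (hτ : 0 < τ) {Φ : F → E} (h0 : Φ 0 = q)
    (hmem : ∀ v ∈ Metric.closedBall (0 : F) r, Φ v ∈ Ω ∩ A ∧ m ≤ |θ (Φ v) (Ψ (0, 1))|)
    (hquad : ∀ v ∈ Metric.closedBall (0 : F) r, ∀ v' ∈ Metric.closedBall (0 : F) r,
      |θ (Φ v) (Φ v' - Φ v)| ≤ C * ‖v' - v‖ ^ 2)
    (happ : ∀ v ∈ Metric.closedBall (0 : F) r, ∀ v' ∈ Metric.closedBall (0 : F) r,
      ‖(Ψ.symm (Φ v' - Φ v)).1 - τ • (v' - v)‖ ≤ τ / 2 * ‖v' - v‖) :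
    ∃ ρ > 0, ∃ u : F → ℝ, ContDiffOn ℝ ∞ u (Metric.ball 0 ρ) ∧ u 0 = 0 ∧
      ∀ x ∈ Metric.ball (0 : F) ρ, q + Ψ (x, u x) ∈ Ω ∩ A ∧
        ∀ h, θ (q + Ψ (x, u x)) (Ψ (h, fderiv ℝ u x h)) = 0 := by
  -- `f`, the rescaled base component of `Φ`, is a perturbation of the identity
  set f : F → F := fun v => τ⁻¹ • (Ψ.symm (Φ v - q)).1 with hf
  have hfv : ∀ v, (Ψ.symm (Φ v - q)).1 = τ • f v := fun v => by
    simp [hf, smul_smul, hτ.ne']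
  have hf0 : f 0 = 0 := by simp [hf, h0]
  have hdiff : ∀ v v', (Ψ.symm (Φ v' - Φ v)).1 = τ • (f v' - f v) := fun v v' => by
    rw [← sub_sub_sub_cancel_right (Φ v') (Φ v) q, map_sub, Prod.fst_sub, hfv, hfv, smul_sub]
  have hfa : ∀ v ∈ Metric.closedBall (0 : F) r, ∀ v' ∈ Metric.closedBall (0 : F) r,
      ‖f v' - f v - (v' - v)‖ ≤ 1 / 2 * ‖v' - v‖ := fun v hv v' hv' => by
    have h := happ v hv v' hv'
    rw [hdiff, ← smul_sub, norm_smul, Real.norm_of_nonneg hτ.le] at h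
    have h' : τ * ‖f v' - f v - (v' - v)‖ ≤ τ * (1 / 2 * ‖v' - v‖) := by linarith
    exact le_of_mul_le_mul_left h' hτ
  have happrox : ApproximatesLinearOn f (ContinuousLinearMap.id ℝ F)
      (Metric.closedBall (0 : F) r) (1 / 2 : NNReal) := by
    intro v hv v' hv'
    simpa using hfa v' hv' v hv
  have hsurj := happrox.surjOn_closedBall_of_nonlinearRightInverse
    ⟨id, 1, fun y => by simp, fun y => by simp⟩ hr.le Subset.rfl
  have hanti : ∀ v ∈ Metric.closedBall (0 : F) r, ∀ v' ∈ Metric.closedBall (0 : F) r,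
      ‖v' - v‖ ≤ 2 * ‖f v' - f v‖ := fun v hv v' hv' => by
    have h := hfa v hv v' hv'
    have h2 : ‖v' - v‖ ≤ ‖f v' - f v‖ + ‖f v' - f v - (v' - v)‖ := by
      calc ‖v' - v‖ = ‖(f v' - f v) - (f v' - f v - (v' - v))‖ := by congr 1; abel
        _ ≤ _ := norm_sub_le _ _
    linarith
  have hball : ∀ x ∈ Metric.ball (0 : F) (τ * (r / 2)), ∃ v ∈ Metric.closedBall (0 : F) r,
      τ • f v = x := fun x hx => by
    obtain ⟨v, hv, hvx⟩ := hsurj (show τ⁻¹ • x ∈ _ by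
      rw [mem_closedBall_iff_norm, hf0, sub_zero, norm_smul, norm_inv, Real.norm_of_nonneg hτ.le]
      rw [mem_ball_iff_norm, sub_zero] at hx
      rw [inv_mul_le_iff₀ hτ]
      refine hx.le.trans (le_of_eq ?_)
      simp; left; ring)
    exact ⟨v, hv, by rw [hvx, smul_smul, mul_inv_cancel₀ hτ.ne', one_smul]⟩
  choose! V hV hVx using hball
  set ρ := τ * (r / 2)
  have hρ : 0 < ρ := by positivity
  set u : F → ℝ := fun x => (Ψ.symm (Φ (V x) - q)).2 with hu
  have hz : ∀ x ∈ Metric.ball (0 : F) ρ, q + Ψ (x, u x) = Φ (V x) := fun x hx => by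
    have : (x, u x) = Ψ.symm (Φ (V x) - q) := Prod.ext (by rw [hfv, hVx x hx]) rfl
    rw [this]; simp
  have hV0 : V 0 = 0 := by
    have h0b : (0 : F) ∈ Metric.ball (0 : F) ρ := Metric.mem_ball_self hρ
    have hf0' : f (V 0) = 0 := by
      have := hVx 0 h0b
      exact (smul_eq_zero.1 this).resolve_left hτ.ne'
    have := hanti 0 (Metric.mem_closedBall_self hr.le) (V 0) (hV 0 h0b)
    rw [hf0', hf0] at this
    simpa using this
  -- the quadratic chord estimate says that the slope of the distribution is the derivative of `u`
  have hder : ∀ x ∈ Metric.ball (0 : F) ρ, HasFDerivAt u (slope θ Ψ (q + Ψ (x, u x))) x := by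
    intro x hx
    have hb := hmem _ (hV x hx)
    rw [hz x hx]
    rw [hasFDerivAt_iff_isLittleO]
    have hO : (fun y => u y - u x - slope θ Ψ (Φ (V x)) (y - x)) =O[𝓝 x]
        fun y => ‖y - x‖ ^ 2 := by
      refine Asymptotics.IsBigO.of_bound (m⁻¹ * (|C| * (2 * τ⁻¹) ^ 2)) ?_
      filter_upwards [Metric.isOpen_ball.mem_nhds hx] with y hy
      have h1 := hquad _ (hV x hx) _ (hV y hy)
      have h2 : Φ (V y) - Φ (V x) = Ψ (y - x, u y - u x) := by
        rw [← hz x hx, ← hz y hy, add_sub_add_left_eq_sub, ← map_sub]; rfl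
      rw [h2, apply_coord_eq (he _ hb.1.1), abs_mul] at h1
      have h3 : ‖V y - V x‖ ≤ 2 * τ⁻¹ * ‖y - x‖ := by
        have e1 : y - x = τ • (f (V y) - f (V x)) := by rw [smul_sub, hVx x hx, hVx y hy]
        refine (hanti _ (hV x hx) _ (hV y hy)).trans (le_of_eq ?_)
        rw [e1, norm_smul, Real.norm_of_nonneg hτ.le]
        field_simp
      rw [norm_pow, norm_norm, Real.norm_eq_abs, mul_assoc, ← div_eq_inv_mul, le_div_iff₀' hm]
      calc m * |u y - u x - slope θ Ψ (Φ (V x)) (y - x)|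
          ≤ |θ (Φ (V x)) (Ψ (0, 1))| * |u y - u x - slope θ Ψ (Φ (V x)) (y - x)| := by
            gcongr; exact hb.2
        _ ≤ |C| * ‖V y - V x‖ ^ 2 := h1.trans (by gcongr; exact le_abs_self C)
        _ ≤ |C| * (2 * τ⁻¹ * ‖y - x‖) ^ 2 := by gcongr
        _ = _ := by ring
    refine hO.trans_isLittleO ?_
    have : (fun y : F => ‖y - x‖ ^ 2) =o[𝓝 x] fun y => ‖y - x‖ ^ 1 :=
      (Asymptotics.isLittleO_pow_pow (𝕜 := ℝ) one_lt_two).comp_tendsto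
        (by simpa using (tendsto_norm_sub_self x))
    refine Asymptotics.IsLittleO.of_norm_right ?_
    simpa using this
  refine ⟨ρ, hρ, u, contDiffOn_of_slope hθ he Metric.isOpen_ball
    (fun x hx => hz x hx ▸ (hmem _ (hV x hx)).1.1) hder, by simp [hu, hV0, h0], fun x hx =>
    ⟨hz x hx ▸ (hmem _ (hV x hx)).1, fun h => ?_⟩⟩
  have hb := hmem _ (hV x hx)
  rw [(hder x hx).fderiv, apply_coord_eq (by rw [hz x hx]; exact he _ hb.1.1), sub_self, mul_zero]

/-- A curve tangent to the distribution which meets an integral graph stays in it, as long as it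
stays over the domain of the graph. -/
lemma curve_mem_graph (hΩ : IsOpen Ω) (hθ : ContDiffOn ℝ ∞ θ Ω)
    (he : ∀ z ∈ Ω, θ z (Ψ (0, 1)) ≠ 0) {s : Set F} (hs : IsOpen s) {u : F → ℝ}
    (hu : ContDiffOn ℝ ∞ u s) (hm : ∀ x ∈ s, q + Ψ (x, u x) ∈ Ω)
    (hu' : ∀ x ∈ s, ∀ h, θ (q + Ψ (x, u x)) (Ψ (h, fderiv ℝ u x h)) = 0)
    {J : Set ℝ} (hJ : IsOpen J) (hJ' : IsPreconnected J) {c c' : ℝ → E}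
    (hc : ∀ t ∈ J, HasDerivAt c (c' t) t) (hc' : ContinuousOn c' J) (hcΩ : MapsTo c J Ω)
    (hcs : ∀ t ∈ J, (Ψ.symm (c t - q)).1 ∈ s) (htan : ∀ t ∈ J, θ (c t) (c' t) = 0) {t₀ : ℝ}
    (ht₀ : t₀ ∈ J) (h0 : (Ψ.symm (c t₀ - q)).2 = u (Ψ.symm (c t₀ - q)).1) :
    ∀ t ∈ J, (Ψ.symm (c t - q)).2 = u (Ψ.symm (c t - q)).1 := by
  set x : ℝ → F := fun t => (Ψ.symm (c t - q)).1 with hx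
  set y : ℝ → ℝ := fun t => (Ψ.symm (c t - q)).2 with hy
  set x' : ℝ → F := fun t => (Ψ.symm (c' t)).1 with hx'
  have hP : ∀ t ∈ J, HasDerivAt (fun t => Ψ.symm (c t - q)) (Ψ.symm (c' t)) t := fun t ht =>
    (Ψ.symm : E →L[ℝ] F × ℝ).hasFDerivAt.comp_hasDerivAt t ((hc t ht).sub_const q)
  have hxd : ∀ t ∈ J, HasDerivAt x (x' t) t := fun t ht => (hP t ht).fst
  have hyd : ∀ t ∈ J, HasDerivAt y (slope θ Ψ (c t) (x' t)) t := fun t ht => by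
    have h1 : θ (c t) (Ψ (x' t, (Ψ.symm (c' t)).2)) = 0 := by
      rw [← htan t ht]; congr 1; exact Ψ.apply_symm_apply _
    rw [apply_coord_eq (he _ (hcΩ ht))] at h1
    rw [← sub_eq_zero.1 ((mul_eq_zero.1 h1).resolve_left (he _ (hcΩ ht)))]
    exact (hP t ht).snd
  have hcz : ∀ t, c t = q + Ψ (x t, y t) := fun t => by
    have : (x t, y t) = Ψ.symm (c t - q) := rfl
    rw [this]; simp
  have hslope : ∀ z ∈ s, fderiv ℝ u z = slope θ Ψ (q + Ψ (z, u z)) := fun z hz => by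
    ext h
    have h1 := hu' z hz h
    rw [apply_coord_eq (he _ (hm z hz))] at h1
    exact sub_eq_zero.1 ((mul_eq_zero.1 h1).resolve_left (he _ (hm z hz)))
  have hxc : ∀ t ∈ J, ContinuousAt x t := fun t ht => (hxd t ht).continuousAt
  have huc : ∀ t ∈ J, ContinuousAt (fun t => u (x t)) t := fun t ht =>
    ContinuousAt.comp (f := x) (hu.continuousOn.continuousAt (hs.mem_nhds (hcs t ht))) (hxc t ht)
  have hyc : ∀ t ∈ J, ContinuousAt y t := fun t ht => (hyd t ht).continuousAt
  -- the set of parameters on the graph is open: its defect `y - u x` satisfies a linear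
  -- differential inequality
  have hopen : ∀ t₁ ∈ J, y t₁ = u (x t₁) → ∀ᶠ t in 𝓝 t₁, y t = u (x t) := by
    intro t₁ ht₁ h1
    have hz₁ : c t₁ ∈ Ω := hcΩ ht₁
    obtain ⟨K, W, hW, hK⟩ := (((contDiffOn_slope hθ he).contDiffAt
      (hΩ.mem_nhds hz₁)).of_le (show (1 : WithTop ℕ∞) ≤ ∞ by simp)).exists_lipschitzOnWith
    have hg : ContinuousAt (fun t => q + Ψ (x t, u (x t))) t₁ :=
      continuousAt_const.add (Ψ.continuous.continuousAt.comp
        ((hxc t₁ ht₁).prodMk (huc t₁ ht₁)))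
    have hgW : ∀ᶠ t in 𝓝 t₁, q + Ψ (x t, u (x t)) ∈ W :=
      hg.eventually_mem (by rwa [← h1, ← hcz])
    have hcW : ∀ᶠ t in 𝓝 t₁, c t ∈ W := (hc t₁ ht₁).continuousAt.eventually_mem hW
    have hx'c : ContinuousAt (fun t => ‖x' t‖) t₁ := by
      have := (Ψ.symm : E →L[ℝ] F × ℝ).continuous.continuousAt.comp
        (hc'.continuousAt (hJ.mem_nhds ht₁))
      exact this.fst.norm
    have hb : ∀ᶠ t in 𝓝 t₁, ‖x' t‖ ≤ ‖x' t₁‖ + 1 := by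
      filter_upwards [hx'c.eventually_lt (continuousAt_const (y := ‖x' t₁‖ + 1)) (by simp)]
        with t ht using ht.le
    obtain ⟨δ, hδ, hδs⟩ := Metric.eventually_nhds_iff_ball.1
      (hgW.and (hcW.and (hb.and (hJ.eventually_mem ht₁))))
    have hsub : Icc (t₁ - δ / 2) (t₁ + δ / 2) ⊆ Metric.ball t₁ δ := by
      rw [← Real.closedBall_eq_Icc]
      exact Metric.closedBall_subset_ball (by linarith)
    have key := eq_zero_of_norm_deriv_le (f := fun t => y t - u (x t))
      (f' := fun t => slope θ Ψ (c t) (x' t) - fderiv ℝ u (x t) (x' t))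
      (C := K * ‖(Ψ : (F × ℝ) →L[ℝ] E)‖ * (‖x' t₁‖ + 1)) (a := t₁ - δ / 2) (b := t₁ + δ / 2)
      (t₀ := t₁) (fun t ht => ?_) (fun t ht => ?_)
      ⟨by linarith, by linarith⟩ (sub_eq_zero.2 h1)
    · filter_upwards [Icc_mem_nhds (by linarith : t₁ - δ / 2 < t₁)
        (by linarith : t₁ < t₁ + δ / 2)] with t ht using sub_eq_zero.1 (key t ht)
    · obtain ⟨-, -, -, htJ⟩ := hδs t (hsub ht)
      refine (hyd t htJ).sub ?_
      exact ((hu.differentiableOn (by simp)).differentiableAt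
        (hs.mem_nhds (hcs t htJ))).hasFDerivAt.comp_hasDerivAt t (hxd t htJ)
    · obtain ⟨h2, h3, h4, htJ⟩ := hδs t (hsub ht)
      rw [hslope _ (hcs t htJ), ← sub_apply]
      refine (ContinuousLinearMap.le_opNorm _ _).trans ?_
      have h5 := hK.dist_le_mul _ h3 _ h2
      rw [dist_eq_norm, dist_eq_norm] at h5
      have h6 : c t - (q + Ψ (x t, u (x t))) = Ψ (0, y t - u (x t)) := by
        rw [hcz t, add_sub_add_left_eq_sub, ← map_sub]; simp
      have h7 : ‖Ψ (0, y t - u (x t))‖ ≤ ‖(Ψ : (F × ℝ) →L[ℝ] E)‖ * ‖y t - u (x t)‖ := by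
        refine ((Ψ : (F × ℝ) →L[ℝ] E).le_opNorm _).trans (le_of_eq ?_)
        simp
      rw [h6] at h5
      calc _ ≤ (K * (‖(Ψ : (F × ℝ) →L[ℝ] E)‖ * ‖y t - u (x t)‖)) * (‖x' t₁‖ + 1) := by
            gcongr
            exact h5.trans (by gcongr)
        _ = _ := by ring
  have hcl : IsPreconnected J := hJ'
  have := hcl.subset_of_closure_inter_subset (u := {t | ∀ᶠ s in 𝓝 t, s ∈ J ∧ y s = u (x s)})
    isOpen_setOfPred_eventually_nhds
    ⟨t₀, ht₀, (hJ.eventually_mem ht₀).and (hopen t₀ ht₀ h0)⟩ (fun t ht => by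
      have hd : y t = u (x t) := by
        by_contra hne
        have := ((hyc t ht.2).sub (huc t ht.2)).eventually_ne (sub_ne_zero.2 hne)
        obtain ⟨s, hs1, hs2⟩ := ((mem_closure_iff_frequently.1 ht.1).and_eventually this).exists
        exact hs2 (sub_eq_zero.2 (Filter.Eventually.self_of_nhds hs1).2)
      exact (hJ.eventually_mem ht.2).and (hopen t ht.2 hd))
  exact fun t ht => (this ht).self_of_nhds.2

end Graph

/-! ### Integral graphs swept out by geodesics -/

section

variable {E V F : Type*} [NormedAddCommGroup E] [NormedSpace ℝ E] [NormedAddCommGroup V]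
  [NormedSpace ℝ V] [NormedAddCommGroup F] [NormedSpace ℝ F]

lemma norm_sub_sub_fderiv_le {G : Type*} [NormedAddCommGroup G] [NormedSpace ℝ G] {θ : E → G}
    {θ' : E → E →L[ℝ] G} {B : Set E} (hB : Convex ℝ B) (hθ : ∀ z ∈ B, HasFDerivAt θ (θ' z) z)
    {K : NNReal} (hK : LipschitzOnWith K θ' B) {z z' : E} (hz : z ∈ B) (hz' : z' ∈ B) :
    ‖θ z' - θ z - θ' z (z' - z)‖ ≤ K * ‖z' - z‖ ^ 2 := by
  have hs : segment ℝ z z' ⊆ B := hB.segment_subset hz hz'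
  have := (convex_segment z z').norm_image_sub_le_of_norm_hasFDerivWithin_le' (𝕜 := ℝ)
    (f := θ) (f' := θ') (φ := θ' z) (C := K * ‖z' - z‖) (fun x hx => (hθ x (hs hx)).hasFDerivWithinAt)
    (fun x hx => by
      have h1 := hK.dist_le_mul x (hs hx) z hz
      rw [dist_eq_norm, dist_eq_norm] at h1
      refine h1.trans ?_
      gcongr
      exact norm_sub_le_of_mem_segment hx) (left_mem_segment ℝ z z') (right_mem_segment ℝ z z')
  rw [sq, ← mul_assoc]
  exact this

lemma gronwallBound_zero_left (K ε x : ℝ) : gronwallBound 0 K ε x = ε * gronwallBound 0 K 1 x := by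
  unfold gronwallBound
  split_ifs <;> ring

namespace IsKillingSystem

variable {Ω : Set E} {g : E → E →L[ℝ] E →L[ℝ] ℝ} {k : E → V →L[ℝ] E} {z q : E} {c : V}

lemma contDiffOn_form (S : IsKillingSystem Ω g k) (c : V) :
    ContDiffOn ℝ ∞ (fun z => g z (k z c)) Ω :=
  S.smooth_metric.clm_apply (S.smooth_field.clm_apply contDiffOn_const)

lemma extDeriv_eq_fderiv_form (S : IsKillingSystem Ω g k) (hz : z ∈ Ω) (c : V) (u v : E) :
    extDeriv g k z c u v =
      fderiv ℝ (fun z => g z (k z c)) z u v - fderiv ℝ (fun z => g z (k z c)) z v u := by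
  have h1 : HasFDerivAt (fun z => g z (k z c)) _ z :=
    (S.hasFDerivAt_metric hz).clm_apply ((S.hasFDerivAt_field hz).clm_apply (hasFDerivAt_const c z))
  rw [h1.fderiv, extDeriv]
  simp
  ring

/-- The quadratic estimate behind the integrability of the distribution: for two neighbouring
tangent geodesics, the chord `J` changes its inclination `θ J` only to second order, up to a
multiple of the inclination itself.  It uses that `dθ` vanishes on the distribution. -/
lemma abs_deriv_inclination_le [FiniteDimensional ℝ V] (S : IsKillingSystem Ω g k) {e : E}
    (he : ∀ z ∈ Ω, g z (k z c) e ≠ 0) {B : Set E} (hB : Convex ℝ B) (hBΩ : B ⊆ Ω) {A₁ m δ : ℝ}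
    {A₂ : NNReal} (hA₁ : ∀ z ∈ B, ‖fderiv ℝ (fun z => g z (k z c)) z‖ ≤ A₁)
    (hA₂ : LipschitzOnWith A₂ (fderiv ℝ (fun z => g z (k z c))) B) (hm : 0 < m)
    (hme : ∀ z ∈ B, m ≤ |g z (k z c) e|) {z z' X Y : E} (hz : z ∈ B) (hz' : z' ∈ B)
    (hzc : z ∈ closure (regularSet Ω g k c)) (hX : g z (k z c) X = 0)
    (hY : g z' (k z' c) Y = 0) (hX1 : ‖X‖ ≤ 1) (hY1 : ‖Y‖ ≤ 1) (hJ : ‖z' - z‖ ≤ δ)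
    (hJ' : ‖Y - X‖ ≤ δ) :
    |fderiv ℝ (fun z => g z (k z c)) z X (z' - z) + g z (k z c) (Y - X)| ≤
      2 * A₁ * ‖e‖ * m⁻¹ * |g z (k z c) (z' - z)| + (A₁ + A₂) * δ ^ 2 := by
  set θ : E → E →L[ℝ] ℝ := fun z => g z (k z c) with hθ
  set D := fderiv ℝ θ
  have hδ : 0 ≤ δ := (norm_nonneg _).trans hJ
  have hA0 : 0 ≤ A₁ := (norm_nonneg _).trans (hA₁ z hz)
  have hz0 : θ z e ≠ 0 := he z (hBΩ hz)
  set a := θ z (z' - z) / θ z e with ha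
  have hθz : ∀ w, θ z w = g z (k z c) w := fun w => rfl
  have h1 : D z X (z' - z) - D z (z' - z) X = a * (D z X e - D z e X) := by
    have h := S.extDeriv_eq_zero_of_mem_closure he (hBΩ hz) hzc hX
      (v := (z' - z) - a • e) (by
        rw [map_sub, map_smul, ← hθz, ← hθz, smul_eq_mul, ha, div_mul_cancel₀ _ hz0, sub_self])
    rw [extDeriv_sub_right, extDeriv_smul_right, S.extDeriv_eq_fderiv_form (hBΩ hz),
      S.extDeriv_eq_fderiv_form (hBΩ hz)] at h
    exact sub_eq_zero.1 h
  have h2 := norm_sub_sub_fderiv_le hB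
    (fun w hw => ((S.contDiffOn_form c).differentiableOn (by simp)).differentiableAt
      (S.isOpen.mem_nhds (hBΩ hw)) |>.hasFDerivAt) hA₂ hz hz'
  have h3 : D z X (z' - z) + θ z (Y - X) = a * (D z X e - D z e X)
      - (θ z' - θ z - D z (z' - z)) Y - D z (z' - z) (Y - X) := by
    rw [← h1]
    have h4 : θ z X = 0 := hX
    have h5 : θ z' Y = 0 := hY
    simp only [sub_apply, map_sub, h4, h5]
    ring
  rw [h3]
  have b1 : |a * (D z X e - D z e X)| ≤ 2 * A₁ * ‖e‖ * m⁻¹ * |θ z (z' - z)| := by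
    rw [abs_mul, ha, abs_div]
    have c1 : |D z X e| ≤ A₁ * ‖e‖ := by
      refine ((D z).le_opNorm₂ X e).trans ?_
      have := hA₁ z hz
      calc ‖D z‖ * ‖X‖ * ‖e‖ ≤ A₁ * 1 * ‖e‖ := by gcongr
        _ = _ := by ring
    have c2 : |D z e X| ≤ A₁ * ‖e‖ := by
      refine ((D z).le_opNorm₂ e X).trans ?_
      have := hA₁ z hz
      calc ‖D z‖ * ‖e‖ * ‖X‖ ≤ A₁ * ‖e‖ * 1 := by gcongr
        _ = _ := by ring
    have c3 : |D z X e - D z e X| ≤ 2 * A₁ * ‖e‖ := (abs_sub _ _).trans (by linarith)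
    have c4 : |θ z (z' - z)| / |θ z e| ≤ |θ z (z' - z)| * m⁻¹ := by
      rw [div_eq_mul_inv]
      gcongr
      exact hme z hz
    calc _ ≤ (|θ z (z' - z)| * m⁻¹) * (2 * A₁ * ‖e‖) := by gcongr
      _ = _ := by ring
  have b2 : |(θ z' - θ z - D z (z' - z)) Y| ≤ A₂ * δ ^ 2 := by
    refine ((θ z' - θ z - D z (z' - z)).le_opNorm Y).trans ?_
    calc _ ≤ (A₂ * ‖z' - z‖ ^ 2) * 1 := by gcongr
      _ ≤ A₂ * δ ^ 2 := by rw [mul_one]; gcongr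
  have b3 : |D z (z' - z) (Y - X)| ≤ A₁ * δ ^ 2 := by
    refine ((D z).le_opNorm₂ _ _).trans ?_
    have := hA₁ z hz
    calc ‖D z‖ * ‖z' - z‖ * ‖Y - X‖ ≤ A₁ * δ * δ := by gcongr
      _ = _ := by ring
  calc _ ≤ |a * (D z X e - D z e X)| + |(θ z' - θ z - D z (z' - z)) Y|
        + |D z (z' - z) (Y - X)| :=
        (abs_sub _ _).trans (add_le_add_left (abs_sub _ _) _)
    _ ≤ _ := by
      show _ ≤ 2 * A₁ * ‖e‖ * m⁻¹ * |θ z (z' - z)| + (A₁ + A₂) * δ ^ 2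
      linarith

end IsKillingSystem

end

section

variable {E V F : Type*} [NormedAddCommGroup E] [NormedSpace ℝ E] [NormedAddCommGroup V]
  [NormedSpace ℝ V] [NormedAddCommGroup F] [NormedSpace ℝ F]

/-- A second order Taylor estimate, with a bound on the second derivative. -/
lemma norm_sub_smul_le_of_second_deriv {J J' J'' : ℝ → E} {τ A : ℝ} (hA : 0 ≤ A) (hτ : 0 ≤ τ)
    (hJ : ∀ t ∈ Icc 0 τ, HasDerivAt J (J' t) t) (hJ' : ∀ t ∈ Icc 0 τ, HasDerivAt J' (J'' t) t)
    (hJ'' : ∀ t ∈ Icc 0 τ, ‖J'' t‖ ≤ A) : ‖J τ - J 0 - τ • J' 0‖ ≤ A * τ * τ := by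
  have h1 : ∀ t ∈ Icc 0 τ, ‖J' t - J' 0‖ ≤ A * τ := fun t ht => by
    have := norm_image_sub_le_of_norm_deriv_le_segment' (f := J') (f' := J'') (C := A)
      (fun t ht => (hJ' t ht).hasDerivWithinAt) (fun t ht => hJ'' t (Ico_subset_Icc_self ht)) t ht
    rw [sub_zero] at this
    exact this.trans (by gcongr; exact ht.2)
  have := norm_image_sub_le_of_norm_deriv_le_segment' (f := fun t => J t - t • J' 0)
    (f' := fun t => J' t - J' 0) (C := A * τ)
    (fun t ht => by
      have h2 := (hJ t ht).sub ((hasDerivAt_id t).smul_const (J' 0))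
      rw [one_smul] at h2
      exact h2.hasDerivWithinAt) (fun t ht => h1 t (Ico_subset_Icc_self ht)) τ
    (right_mem_Icc.2 hτ)
  rw [sub_zero, zero_smul, sub_zero] at this
  rwa [sub_right_comm] at this

namespace IsKillingSystem

variable {Ω : Set E} {g : E → E →L[ℝ] E →L[ℝ] ℝ} {k : E → V →L[ℝ] E} {z q : E} {c : V}

set_option maxHeartbeats 1000000 in
/-- Through every limit of regular points there is an integral graph of the null distribution, and
it consists of limits of regular points.  The graph is swept out by the geodesics issuing from
the point tangentially to the distribution. -/
lemma exists_leaf [FiniteDimensional ℝ E] [FiniteDimensional ℝ V] [CompleteSpace F]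
    (S : IsKillingSystem Ω g k) (Ψ : (F × ℝ) ≃L[ℝ] E)
    (he : ∀ z ∈ Ω, g z (k z c) (Ψ (0, 1)) ≠ 0) (hq : q ∈ Ω)
    (hqc : q ∈ closure (regularSet Ω g k c)) (hΨ : ∀ x : F, g q (k q c) (Ψ (x, 0)) = 0) :
    ∃ ρ > 0, ∃ u : F → ℝ, ContDiffOn ℝ ∞ u (Metric.ball 0 ρ) ∧ u 0 = 0 ∧
      ∀ x ∈ Metric.ball (0 : F) ρ, q + Ψ (x, u x) ∈ Ω ∩ closure (regularSet Ω g k c) ∧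
        ∀ h, g (q + Ψ (x, u x)) (k (q + Ψ (x, u x)) c) (Ψ (h, fderiv ℝ u x h)) = 0 := by
  set e := Ψ (0, 1) with hedef
  set θ : E → E →L[ℝ] ℝ := fun z => g z (k z c) with hθ
  have hΩq := S.isOpen.mem_nhds hq
  have hθs : ContDiffOn ℝ ∞ θ Ω := S.contDiffOn_form c
  have hθd : ContDiffAt ℝ ∞ (fderiv ℝ θ) q :=
    (hθs.fderiv_of_isOpen S.isOpen (m := ∞) (by simp)).contDiffAt hΩq
  obtain ⟨A₂, W₂, hW₂, hA₂⟩ := (hθd.of_le (show (1 : WithTop ℕ∞) ≤ ∞ by simp)).exists_lipschitzOnWith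
  have hA₁ : ∀ᶠ z in 𝓝 q, ‖fderiv ℝ θ z‖ ≤ ‖fderiv ℝ θ q‖ + 1 := by
    filter_upwards [hθd.continuousAt.norm.eventually_lt
      (continuousAt_const (y := ‖fderiv ℝ θ q‖ + 1)) (by simp)] with t ht using ht.le
  have hme : ∀ᶠ z in 𝓝 q, |θ q e| / 2 ≤ |θ z e| := by
    have h1 : ContinuousAt (fun z => |θ z e|) q :=
      ((hθs.continuousOn.continuousAt hΩq).clm_apply continuousAt_const).abs
    filter_upwards [(continuousAt_const (y := |θ q e| / 2)).eventually_lt h1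
      (half_lt_self (abs_pos.2 (he q hq)))] with t ht using ht.le
  obtain ⟨R, hR, hB⟩ := Metric.eventually_nhds_iff_ball.1
    (hA₁.and (hme.and ((eventually_mem_set.2 hW₂).and (eventually_mem_set.2 hΩq))))
  obtain ⟨M, WS, hWS, hM⟩ := ((S.contDiffOn_spray.contDiffAt
    ((S.isOpen.prod isOpen_univ).mem_nhds (x := (q, (0 : E))) ⟨hq, mem_univ _⟩)).of_le
    (show (1 : WithTop ℕ∞) ≤ ∞ by simp)).exists_lipschitzOnWith
  set B := Metric.ball q R with hBdef
  have hBΩ : B ⊆ Ω := fun z hz => (hB z hz).2.2.2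
  have hU : (B ×ˢ Metric.ball (0 : E) 1) ∩ WS ∈ 𝓝 (q, (0 : E)) :=
    inter_mem (prod_mem_nhds (Metric.ball_mem_nhds _ hR) (Metric.ball_mem_nhds _ one_pos)) hWS
  obtain ⟨α, ε, hε, r, hr, K, hα, hK⟩ := S.exists_flow hq hU
  -- the time `τ` at which the geodesics are stopped makes the exponential map nearly linear
  set P : ℝ := ‖(Ψ : (F × ℝ) →L[ℝ] E)‖ with hP
  set P' : ℝ := ‖(Ψ.symm : E →L[ℝ] F × ℝ)‖ with hP'
  have hPn : 0 ≤ P := norm_nonneg _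
  have hPn' : 0 ≤ P' := norm_nonneg _
  set Q : ℝ := P' * (M * K * P) with hQ
  have hQn : 0 ≤ Q := by positivity
  obtain ⟨τ, hτ, hτε⟩ : ∃ τ : ℝ, 0 < τ ∧ τ < ε ∧ Q * τ ≤ 1 / 2 := by
    refine ⟨min (ε / 2) (1 / 2 / (Q + 1)), by positivity, (min_le_left _ _).trans_lt (by linarith),
      ?_⟩
    calc Q * min (ε / 2) (1 / 2 / (Q + 1)) ≤ (Q + 1) * (1 / 2 / (Q + 1)) := by
          gcongr
          · linarith
          · exact min_le_right _ _
      _ = 1 / 2 := by field_simp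
  have hI : ∀ t ∈ Icc 0 τ, t ∈ Ioo (-ε) ε := fun t ht =>
    ⟨by linarith [ht.1], ht.2.trans_lt hτε.1⟩
  set r' : ℝ := r / (2 * (P + 1)) with hr'
  have hr'0 : 0 < r' := by positivity
  have hxr : ∀ x ∈ Metric.closedBall (0 : F) r', ‖Ψ (x, 0)‖ < r := fun x hx => by
    rw [mem_closedBall_zero_iff] at hx
    calc ‖Ψ (x, 0)‖ ≤ P * ‖((x, 0) : F × ℝ)‖ := (Ψ : (F × ℝ) →L[ℝ] E).le_opNorm _
      _ ≤ (P + 1) * r' := by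
        gcongr
        · linarith
        · simpa using hx
      _ < r := by rw [hr']; field_simp; linarith
  have hmemr : ∀ x ∈ Metric.closedBall (0 : F) r',
      (q, Ψ (x, 0)) ∈ Metric.closedBall (q, (0 : E)) r := fun x hx => by
    rw [mem_closedBall_iff_norm]
    simpa using (hxr x hx).le
  have hgeo : ∀ x ∈ Metric.closedBall (0 : F) r', ∀ t ∈ Ioo (-ε) ε,
      HasDerivAt (α (q, Ψ (x, 0))) (spray g (α (q, Ψ (x, 0)) t)) t := fun x hx t ht =>
    ((hα _ (hmemr x hx)).2 t ht).2
  have hfst : ∀ x ∈ Metric.closedBall (0 : F) r', ∀ t ∈ Ioo (-ε) ε,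
      HasDerivAt (fun t => (α (q, Ψ (x, 0)) t).1) (α (q, Ψ (x, 0)) t).2 t := fun x hx t ht =>
    (hgeo x hx t ht).fst
  have hsnd : ∀ x ∈ Metric.closedBall (0 : F) r', ∀ t ∈ Ioo (-ε) ε,
      HasDerivAt (fun t => (α (q, Ψ (x, 0)) t).2)
        (accel g (α (q, Ψ (x, 0)) t).1 (α (q, Ψ (x, 0)) t).2) t := fun x hx t ht =>
    (hgeo x hx t ht).snd
  have hin : ∀ x ∈ Metric.closedBall (0 : F) r', ∀ t ∈ Ioo (-ε) ε,
      α (q, Ψ (x, 0)) t ∈ (B ×ˢ Metric.ball (0 : E) 1) ∩ WS := fun x hx t ht =>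
    ((hα _ (hmemr x hx)).2 t ht).1
  have htan : ∀ x ∈ Metric.closedBall (0 : F) r', ∀ t ∈ Ioo (-ε) ε,
      θ (α (q, Ψ (x, 0)) t).1 (α (q, Ψ (x, 0)) t).2 = 0 := fun x hx =>
    S.tangent_of_tangent (t₀ := 0) (S.isGeodesic_of_spray (fun t ht => hBΩ (hin x hx t ht).1.1)
      (hgeo x hx)) ⟨by linarith, hε⟩ (by rw [(hα _ (hmemr x hx)).1]; exact hΨ x)
  have hcl : ∀ x ∈ Metric.closedBall (0 : F) r', ∀ t ∈ Icc 0 τ,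
      (α (q, Ψ (x, 0)) t).1 ∈ closure (regularSet Ω g k c) := fun x hx t ht =>
    S.flow_mem_closure he hq hqc
      (fun y hy => ⟨(hα y hy).1, fun t ht => ⟨hBΩ ((hα y hy).2 t ht).1.1.1, ((hα y hy).2 t ht).2⟩⟩)
      hK (hxr x hx) (hΨ x) ⟨ht.1, ht.2.trans_lt hτε.1⟩
  have hlip : ∀ x ∈ Metric.closedBall (0 : F) r', ∀ x' ∈ Metric.closedBall (0 : F) r',
      ∀ t ∈ Ioo (-ε) ε, ‖α (q, Ψ (x', 0)) t - α (q, Ψ (x, 0)) t‖ ≤ K * P * ‖x' - x‖ :=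
    fun x hx x' hx' t ht => by
    have h := (hK t ht).dist_le_mul _ (hmemr x' hx') _ (hmemr x hx)
    rw [dist_eq_norm, dist_eq_norm] at h
    refine h.trans ?_
    rw [mul_assoc]
    gcongr
    rw [Prod.mk_sub_mk, sub_self, ← map_sub, Prod.mk_sub_mk, sub_zero, Prod.norm_mk, norm_zero,
      max_eq_right (norm_nonneg _)]
    refine ((Ψ : (F × ℝ) →L[ℝ] E).le_opNorm _).trans (le_of_eq ?_)
    simp [hP]
  set C₁ : ℝ := 2 * (‖fderiv ℝ θ q‖ + 1) * ‖e‖ * (|θ q e| / 2)⁻¹ with hC₁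
  set C₂ : ℝ := (‖fderiv ℝ θ q‖ + 1) + A₂ with hC₂
  have hm : 0 < |θ q e| / 2 := half_pos (abs_pos.2 (he q hq))
  refine exists_integral_graph (θ := θ) (A := closure (regularSet Ω g k c)) (m := |θ q e| / 2)
    (r := r') (τ := τ) (C := C₂ * (K * P) ^ 2 * gronwallBound 0 C₁ 1 τ) hθs he hm hr'0 hτ
    (Φ := fun x => (α (q, Ψ (x, 0)) τ).1) ?_ (fun x hx => ?_) (fun x hx x' hx' => ?_)
    (fun x hx x' hx' => ?_)
  · -- the geodesic with initial velocity zero is constant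
    have h0 : (0 : F) ∈ Metric.closedBall (0 : F) r' := Metric.mem_closedBall_self hr'0.le
    have h1 := hα _ (hmemr 0 h0)
    have h2 := hgeo 0 h0
    have h3 := hin 0 h0
    have h00 : Ψ ((0 : F), (0 : ℝ)) = 0 := Ψ.map_zero
    simp only [h00] at h1 h2 h3 ⊢
    have := eq_zero_of_norm_deriv_le (f := fun t => α (q, 0) t - (q, 0))
      (f' := fun t => spray g (α (q, 0) t)) (C := M) (a := 0) (b := τ) (t₀ := 0)
      (fun t ht => (h2 t (hI t ht)).sub_const _) (fun t ht => by
        have h := hM.dist_le_mul _ (h3 t (hI t ht)).2 _ (mem_of_mem_nhds hWS)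
        rwa [spray_zero, dist_zero_right, dist_eq_norm] at h) (left_mem_Icc.2 hτ.le)
      (sub_eq_zero.2 h1.1) τ (right_mem_Icc.2 hτ.le)
    rw [sub_eq_zero.1 this]
  · have hτI := hI τ (right_mem_Icc.2 hτ.le)
    have h := (hin x hx τ hτI).1.1
    exact ⟨⟨hBΩ h, hcl x hx τ (right_mem_Icc.2 hτ.le)⟩, (hB _ h).2.1⟩
  · -- the inclination of the chord vanishes at the parameter `0`, and grows by Gronwall's inequality
    have hτr := right_mem_Icc.2 hτ.le
    have hder : ∀ t ∈ Icc 0 τ, HasDerivAt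
        (fun t => θ (α (q, Ψ (x, 0)) t).1 ((α (q, Ψ (x', 0)) t).1 - (α (q, Ψ (x, 0)) t).1))
        (fderiv ℝ θ (α (q, Ψ (x, 0)) t).1 (α (q, Ψ (x, 0)) t).2
          ((α (q, Ψ (x', 0)) t).1 - (α (q, Ψ (x, 0)) t).1) +
          θ (α (q, Ψ (x, 0)) t).1 ((α (q, Ψ (x', 0)) t).2 - (α (q, Ψ (x, 0)) t).2)) t :=
      fun t ht => by
      have h1 := hfst x hx t (hI t ht)
      have h2 := hfst x' hx' t (hI t ht)
      have h3 := (hθs.differentiableOn (by simp)).differentiableAt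
        (S.isOpen.mem_nhds (hBΩ (hin x hx t (hI t ht)).1.1)) |>.hasFDerivAt
      exact (h3.comp_hasDerivAt t h1).clm_apply (h2.sub h1)
    have hgr := norm_le_gronwallBound_of_norm_deriv_right_le (δ := 0) (K := C₁)
      (ε := C₂ * (K * P * ‖x' - x‖) ^ 2) (a := 0) (b := τ)
      (fun t ht => (hder t ht).continuousAt.continuousWithinAt)
      (fun t ht => (hder t (Ico_subset_Icc_self ht)).hasDerivWithinAt) (by
        rw [(hα _ (hmemr x hx)).1, (hα _ (hmemr x' hx')).1]; simp) (fun t ht => by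
        have htI := hI t (Ico_subset_Icc_self ht)
        have hl := hlip x hx x' hx' t htI
        exact S.abs_deriv_inclination_le he (convex_ball q R) hBΩ (fun z hz => (hB z hz).1)
          (hA₂.mono fun z hz => (hB z hz).2.2.1) hm (fun z hz => (hB z hz).2.1)
          (hin x hx t htI).1.1 (hin x' hx' t htI).1.1 (hcl x hx t (Ico_subset_Icc_self ht))
          (htan x hx t htI) (htan x' hx' t htI)
          (mem_ball_zero_iff.1 (hin x hx t htI).1.2).le
          (mem_ball_zero_iff.1 (hin x' hx' t htI).1.2).le
          ((norm_fst_le _).trans hl) ((norm_snd_le _).trans hl)) τ hτr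
    refine (Real.norm_eq_abs _).symm.trans_le (hgr.trans (le_of_eq ?_))
    rw [gronwallBound_zero_left, sub_zero]
    ring
  · -- the end points depend almost linearly on the initial velocities, as `τ` is small
    have hT := norm_sub_smul_le_of_second_deriv
      (J := fun t => (α (q, Ψ (x', 0)) t).1 - (α (q, Ψ (x, 0)) t).1)
      (J' := fun t => (α (q, Ψ (x', 0)) t).2 - (α (q, Ψ (x, 0)) t).2)
      (J'' := fun t => accel g (α (q, Ψ (x', 0)) t).1 (α (q, Ψ (x', 0)) t).2
        - accel g (α (q, Ψ (x, 0)) t).1 (α (q, Ψ (x, 0)) t).2)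
      (τ := τ) (A := M * (K * P * ‖x' - x‖)) (by positivity) hτ.le
      (fun t ht => (hfst x' hx' t (hI t ht)).sub (hfst x hx t (hI t ht)))
      (fun t ht => (hsnd x' hx' t (hI t ht)).sub (hsnd x hx t (hI t ht)))
      (fun t ht => by
        have h := hM.dist_le_mul _ (hin x' hx' t (hI t ht)).2 _ (hin x hx t (hI t ht)).2
        rw [dist_eq_norm, dist_eq_norm] at h
        exact (norm_snd_le (spray g _ - spray g _)).trans
          (h.trans (by gcongr; exact hlip x hx x' hx' t (hI t ht))))
    simp only [(hα _ (hmemr x hx)).1, (hα _ (hmemr x' hx')).1, sub_self, sub_zero] at hT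
    have hx1 : τ • (x' - x) = (Ψ.symm (τ • (Ψ (x', 0) - Ψ (x, 0)))).1 := by
      rw [← map_sub, map_smul, Ψ.symm_apply_apply]; simp
    rw [hx1, ← Prod.fst_sub, ← map_sub]
    refine (norm_fst_le _).trans (((Ψ.symm : E →L[ℝ] F × ℝ).le_opNorm _).trans ?_)
    calc _ ≤ P' * (M * (K * P * ‖x' - x‖) * τ * τ) := by gcongr
      _ = (Q * τ) * (τ * ‖x' - x‖) := by rw [hQ]; ring
      _ ≤ (1 / 2) * (τ * ‖x' - x‖) := by gcongr; exact hτε.2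
      _ = _ := by ring

end IsKillingSystem

end

/-! ### Vector fields in charts -/

section ChartFields

open LorentzGeom

universe u

variable {m : ℕ} {M : Type u} [TopologicalSpace M] [ChartedSpace (Model m) M]

/-- The coordinate expression of a vector field in the chart at `x₀`. -/
noncomputable def chartField (x₀ : M) (X : ∀ x : M, TangentSpace (𝓡 m) x) (z : Model m) : Model m :=
  mfderiv (𝓡 m) 𝓘(ℝ, Model m) (extChartAt (𝓡 m) x₀) ((extChartAt (𝓡 m) x₀).symm z)
    (X ((extChartAt (𝓡 m) x₀).symm z))

/-- The derivative of the inverse of the chart at `x₀`. -/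
noncomputable def chartDeriv (x₀ : M) (z : Model m) :
    Model m →L[ℝ] TangentSpace (𝓡 m) ((extChartAt (𝓡 m) x₀).symm z) :=
  mfderiv 𝓘(ℝ, Model m) (𝓡 m) (extChartAt (𝓡 m) x₀).symm z

lemma mlieBracket_model (V W : ∀ z : Model m, TangentSpace 𝓘(ℝ, Model m) z) (z : Model m) :
    VectorField.mlieBracket 𝓘(ℝ, Model m) V W z = VectorField.lieBracket ℝ V W z := by
  rw [← VectorField.mlieBracketWithin_univ, VectorField.mlieBracketWithin_eq_lieBracketWithin]
  exact congrFun VectorField.lieBracketWithin_univ z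

lemma mem_chart_source {x₀ : M} {z : Model m} (hz : z ∈ (extChartAt (𝓡 m) x₀).target) :
    (extChartAt (𝓡 m) x₀).symm z ∈ (chartAt (Model m) x₀).source := by
  rw [← extChartAt_source (𝓡 m)]; exact (extChartAt (𝓡 m) x₀).map_target hz

variable [IsManifold (𝓡 m) ∞ M]

/-- The field, defined on the domain of the chart at `x₀`, whose coordinate expression is the
constant `w`. -/
noncomputable def constField (x₀ : M) (w : Model m) (x : M) : TangentSpace (𝓡 m) x :=
  (trivializationAt (Model m) (TangentSpace (𝓡 m)) x₀).symmL ℝ x w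

lemma mdifferentiableAt_chart_symm {x₀ : M} {z : Model m}
    (hz : z ∈ (extChartAt (𝓡 m) x₀).target) :
    MDifferentiableAt 𝓘(ℝ, Model m) (𝓡 m) (extChartAt (𝓡 m) x₀).symm z := by
  have := mdifferentiableWithinAt_extChartAt_symm (I := 𝓡 m) hz
  rwa [(𝓡 m).range_eq_univ, mdifferentiableWithinAt_univ] at this

lemma contMDiffAt_chart_symm {x₀ : M} {z : Model m}
    (hz : z ∈ (extChartAt (𝓡 m) x₀).target) :
    ContMDiffAt 𝓘(ℝ, Model m) (𝓡 m) ∞ (extChartAt (𝓡 m) x₀).symm z :=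
  (contMDiffOn_extChartAt_symm x₀).contMDiffAt ((isOpen_extChartAt_target x₀).mem_nhds hz)

lemma chartDeriv_mfderiv {x₀ : M} {z : Model m} (hz : z ∈ (extChartAt (𝓡 m) x₀).target)
    (v : TangentSpace (𝓡 m) ((extChartAt (𝓡 m) x₀).symm z)) :
    chartDeriv x₀ z (mfderiv (𝓡 m) 𝓘(ℝ, Model m) (extChartAt (𝓡 m) x₀)
      ((extChartAt (𝓡 m) x₀).symm z) v) = v := by
  have := mfderivWithin_extChartAt_symm_comp_mfderiv_extChartAt (I := 𝓡 m) hz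
  rw [(𝓡 m).range_eq_univ, mfderivWithin_univ] at this
  exact DFunLike.congr_fun this v

lemma mfderiv_chartDeriv {x₀ : M} {z : Model m} (hz : z ∈ (extChartAt (𝓡 m) x₀).target)
    (v : Model m) :
    mfderiv (𝓡 m) 𝓘(ℝ, Model m) (extChartAt (𝓡 m) x₀)
      ((extChartAt (𝓡 m) x₀).symm z) (chartDeriv x₀ z v) = v := by
  have := mfderiv_extChartAt_comp_mfderivWithin_extChartAt_symm (I := 𝓡 m) hz
  rw [(𝓡 m).range_eq_univ, mfderivWithin_univ] at this
  exact DFunLike.congr_fun this v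

lemma chartDeriv_chartField {x₀ : M} {z : Model m} (hz : z ∈ (extChartAt (𝓡 m) x₀).target)
    (X : ∀ x : M, TangentSpace (𝓡 m) x) :
    chartDeriv x₀ z (chartField x₀ X z) = X ((extChartAt (𝓡 m) x₀).symm z) :=
  chartDeriv_mfderiv hz _

lemma constField_symm {x₀ : M} {z : Model m} (hz : z ∈ (extChartAt (𝓡 m) x₀).target)
    (w : Model m) : constField x₀ w ((extChartAt (𝓡 m) x₀).symm z) = chartDeriv x₀ z w := by
  rw [constField, TangentBundle.symmL_trivializationAt (I := 𝓡 m) (mem_chart_source hz),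
    (𝓡 m).range_eq_univ, mfderivWithin_univ, (extChartAt (𝓡 m) x₀).right_inv hz]
  rfl

lemma contMDiffOn_constField (x₀ : M) (w : Model m) :
    ContMDiffOn (𝓡 m) ((𝓡 m).prod 𝓘(ℝ, Model m)) ∞
      (fun x => (Bundle.TotalSpace.mk' (Model m) x (constField x₀ w x) : TangentBundle (𝓡 m) M))
      (chartAt (Model m) x₀).source := by
  have h := (trivializationAt (Model m) (TangentSpace (𝓡 m)) x₀).contMDiffOn_section_baseSet_iff
    (IB := 𝓡 m) (n := ∞) (s := constField x₀ w)
  rw [TangentBundle.trivializationAt_baseSet] at h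
  refine h.2 ((contMDiffOn_const (c := w)).congr fun y hy => ?_)
  have hb : y ∈ (trivializationAt (Model m) (TangentSpace (𝓡 m)) x₀).baseSet := by
    rwa [TangentBundle.trivializationAt_baseSet]
  rw [constField, ← Bundle.Trivialization.continuousLinearMapAt_apply_of_mem (R := ℝ) _ hb,
    Bundle.Trivialization.continuousLinearMapAt_symmL _ hb]

lemma contDiffOn_chartField (x₀ : M) {X : ∀ x : M, TangentSpace (𝓡 m) x} (hX : IsSmoothField X) :
    ContDiffOn ℝ ∞ (chartField x₀ X) (extChartAt (𝓡 m) x₀).target := by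
  have h := ((trivializationAt (Model m) (TangentSpace (𝓡 m)) x₀).contMDiffOn_section_baseSet_iff
    (IB := 𝓡 m) (n := ∞) (s := X)).1 hX.contMDiffOn
  rw [TangentBundle.trivializationAt_baseSet] at h
  rw [← contMDiffOn_iff_contDiffOn]
  refine (h.comp (contMDiffOn_extChartAt_symm x₀) fun z hz => mem_chart_source hz).congr
    fun z hz => ?_
  have hb : (extChartAt (𝓡 m) x₀).symm z ∈
      (trivializationAt (Model m) (TangentSpace (𝓡 m)) x₀).baseSet := by
    rw [TangentBundle.trivializationAt_baseSet]; exact mem_chart_source hz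
  have h1 := TangentBundle.continuousLinearMapAt_trivializationAt (I := 𝓡 m)
    (mem_chart_source hz)
  exact (DFunLike.congr_fun h1 _).symm.trans
    (Bundle.Trivialization.continuousLinearMapAt_apply_of_mem (R := ℝ) _ hb _)

lemma dirDeriv_eq_fderiv {x₀ : M} {z : Model m} (hz : z ∈ (extChartAt (𝓡 m) x₀).target)
    (X : ∀ x : M, TangentSpace (𝓡 m) x) {f : M → ℝ}
    (hf : MDifferentiableAt (𝓡 m) 𝓘(ℝ, ℝ) f ((extChartAt (𝓡 m) x₀).symm z)) :
    dirDeriv X f ((extChartAt (𝓡 m) x₀).symm z) =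
      fderiv ℝ (f ∘ (extChartAt (𝓡 m) x₀).symm) z (chartField x₀ X z) := by
  rw [dirDeriv, ← mfderiv_eq_fderiv, mfderiv_comp z hf (mdifferentiableAt_chart_symm hz)]
  show _ = mfderiv (𝓡 m) 𝓘(ℝ, ℝ) f _ (chartDeriv x₀ z (chartField x₀ X z))
  rw [chartDeriv_chartField hz]

lemma mpullback_eq_chartField {x₀ : M} {z : Model m} (hz : z ∈ (extChartAt (𝓡 m) x₀).target)
    (X : ∀ x : M, TangentSpace (𝓡 m) x) :
    VectorField.mpullback 𝓘(ℝ, Model m) (𝓡 m) (extChartAt (𝓡 m) x₀).symm X z =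
      chartField x₀ X z := by
  have h1 := mfderivWithin_extChartAt_symm_comp_mfderiv_extChartAt (I := 𝓡 m) hz
  have h2 := mfderiv_extChartAt_comp_mfderivWithin_extChartAt_symm (I := 𝓡 m) hz
  rw [(𝓡 m).range_eq_univ, mfderivWithin_univ] at h1 h2
  rw [VectorField.mpullback_apply, ContinuousLinearMap.inverse_eq h1 h2]
  rfl

lemma chartField_mlieBracket {x₀ : M} {z : Model m} (hz : z ∈ (extChartAt (𝓡 m) x₀).target)
    {X Y : ∀ x : M, TangentSpace (𝓡 m) x} (hX : IsSmoothField X) (hY : IsSmoothField Y) :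
    chartField x₀ (VectorField.mlieBracket (𝓡 m) X Y) z =
      VectorField.lieBracket ℝ (chartField x₀ X) (chartField x₀ Y) z := by
  have h2 : minSmoothness ℝ 2 ≤ (∞ : WithTop ℕ∞) := by
    rw [minSmoothness_of_isRCLikeNormedField]
    exact WithTop.coe_le_coe.2 (le_top (a := (2 : ℕ∞)))
  have : IsManifold (𝓡 m) (minSmoothness ℝ 2) M := IsManifold.of_le (n := ∞) h2
  rw [← mpullback_eq_chartField hz, VectorField.mpullback_mlieBracket (n := ∞)
    (hX.mdifferentiable (by simp) _) (hY.mdifferentiable (by simp) _)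
    (contMDiffAt_chart_symm hz) h2]
  have hev : ∀ X : ∀ x : M, TangentSpace (𝓡 m) x,
      VectorField.mpullback 𝓘(ℝ, Model m) (𝓡 m) (extChartAt (𝓡 m) x₀).symm X =ᶠ[𝓝 z]
        chartField x₀ X := fun X => by
    filter_upwards [(isOpen_extChartAt_target x₀).mem_nhds hz] with y hy
      using mpullback_eq_chartField hy X
  exact (mlieBracket_model _ _ z).trans ((hev X).lieBracket_vectorField_eq (hev Y))

/-- Every vector is the value of a global smooth field with locally constant coordinates. -/
lemma exists_isSmoothField [T2Space M] {x₀ : M} {z : Model m}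
    (hz : z ∈ (extChartAt (𝓡 m) x₀).target) (w : Model m) :
    ∃ X : ∀ x : M, TangentSpace (𝓡 m) x, IsSmoothField X ∧
      chartField x₀ X =ᶠ[𝓝 z] fun _ => w := by
  set x := (extChartAt (𝓡 m) x₀).symm z with hx
  have hs : (chartAt (Model m) x₀).source ∈ 𝓝 x :=
    (chartAt (Model m) x₀).open_source.mem_nhds (mem_chart_source hz)
  obtain ⟨f, -, hf⟩ := (SmoothBumpFunction.nhds_basis_tsupport (I := 𝓡 m) x).mem_iff.1 hs
  refine ⟨fun y => f y • constField x₀ w y,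
    ContMDiffOn.smul_section_of_tsupport (ψ := f) f.contMDiff.contMDiffOn
      (chartAt (Model m) x₀).open_source hf (contMDiffOn_constField x₀ w), ?_⟩
  have hc : ContinuousAt (extChartAt (𝓡 m) x₀).symm z := (contMDiffAt_chart_symm hz).continuousAt
  filter_upwards [hc.eventually f.eventuallyEq_one,
    (isOpen_extChartAt_target x₀).mem_nhds hz] with y hy hyt
  rw [chartField, hy, Pi.one_apply, one_smul, constField_symm hyt, mfderiv_chartDeriv hyt]

end ChartFields

/-! ### The Lorentzian metric in charts -/

section ChartMetric

open LorentzGeom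

universe u

variable {n r : ℕ} {M : Type u} [TopologicalSpace M] [ChartedSpace (Model (n + 1)) M]
  [IsManifold (𝓡 (n + 1)) ∞ M] (g : LorentzianMetric n M)

/-- The coordinate expression of the metric in the chart at `x₀`, as a bilinear map. -/
noncomputable def coordMetric (x₀ : M) (z : Model (n + 1)) :
    Model (n + 1) →L[ℝ] Model (n + 1) →L[ℝ] ℝ :=
  ContinuousLinearMap.bilinearComp (E := Model (n + 1)) (F := Model (n + 1))
    (g.val ((extChartAt (𝓡 (n + 1)) x₀).symm z) : Model (n + 1) →L[ℝ] Model (n + 1) →L[ℝ] ℝ)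
    (chartDeriv x₀ z) (chartDeriv x₀ z)

lemma coordMetric_apply (x₀ : M) (z u v : Model (n + 1)) :
    coordMetric g x₀ z u v = g.val ((extChartAt (𝓡 (n + 1)) x₀).symm z)
      (chartDeriv x₀ z u) (chartDeriv x₀ z v) := rfl

lemma inChart_eq_coordMetric (x₀ : M) (z u v : Model (n + 1)) :
    g.inChart x₀ z u v = coordMetric g x₀ z u v := rfl

lemma coordMetric_chartField {x₀ : M} {z : Model (n + 1)}
    (hz : z ∈ (extChartAt (𝓡 (n + 1)) x₀).target) (X Y : ∀ x : M, TangentSpace (𝓡 (n + 1)) x) :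
    coordMetric g x₀ z (chartField x₀ X z) (chartField x₀ Y z) =
      g.pair X Y ((extChartAt (𝓡 (n + 1)) x₀).symm z) := by
  rw [coordMetric_apply, chartDeriv_chartField hz, chartDeriv_chartField hz]
  rfl

lemma contMDiffOn_pair {X Y : ∀ x : M, TangentSpace (𝓡 (n + 1)) x} {s : Set M}
    (hX : ContMDiffOn (𝓡 (n + 1)) ((𝓡 (n + 1)).prod 𝓘(ℝ, Model (n + 1))) ∞
      (fun x => (Bundle.TotalSpace.mk' (Model (n + 1)) x (X x) : TangentBundle (𝓡 (n + 1)) M)) s)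
    (hY : ContMDiffOn (𝓡 (n + 1)) ((𝓡 (n + 1)).prod 𝓘(ℝ, Model (n + 1))) ∞
      (fun x => (Bundle.TotalSpace.mk' (Model (n + 1)) x (Y x) : TangentBundle (𝓡 (n + 1)) M)) s) :
    ContMDiffOn (𝓡 (n + 1)) 𝓘(ℝ, ℝ) ∞ (g.pair X Y) s := by
  intro x hx
  have : ContMDiffWithinAt (𝓡 (n + 1)) ((𝓡 (n + 1)).prod 𝓘(ℝ, ℝ)) ∞
      (fun x => Bundle.TotalSpace.mk' ℝ (E := Bundle.Trivial M ℝ) x (g.val x (X x) (Y x))) s x := by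
    apply ContMDiffWithinAt.clm_bundle_apply₂ (F₁ := Model (n + 1)) (F₂ := Model (n + 1))
    · exact g.smooth.contMDiffAt.contMDiffWithinAt
    · exact hX x hx
    · exact hY x hx
  simp only [Bundle.contMDiffWithinAt_totalSpace] at this
  exact this.2

lemma contMDiff_pair {X Y : ∀ x : M, TangentSpace (𝓡 (n + 1)) x} (hX : IsSmoothField X)
    (hY : IsSmoothField Y) : ContMDiff (𝓡 (n + 1)) 𝓘(ℝ, ℝ) ∞ (g.pair X Y) := by
  rw [← contMDiffOn_univ]
  exact contMDiffOn_pair g hX.contMDiffOn hY.contMDiffOn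

lemma contDiffOn_coordMetric (x₀ : M) :
    ContDiffOn ℝ ∞ (coordMetric g x₀) (extChartAt (𝓡 (n + 1)) x₀).target := by
  rw [contDiffOn_clm_apply]
  intro u
  rw [contDiffOn_clm_apply]
  intro v
  rw [← contMDiffOn_iff_contDiffOn]
  refine ((contMDiffOn_pair g (contMDiffOn_constField x₀ u) (contMDiffOn_constField x₀ v)).comp
    (contMDiffOn_extChartAt_symm x₀) fun z hz => mem_chart_source hz).congr fun z hz => ?_
  rw [Function.comp_apply, LorentzianMetric.pair, constField_symm hz, constField_symm hz]
  rfl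

lemma coordMetric_symm (x₀ : M) (z u v : Model (n + 1)) :
    coordMetric g x₀ z u v = coordMetric g x₀ z v u := g.symm _ _ _

lemma metric_nondeg {x : M} {u : TangentSpace (𝓡 (n + 1)) x} (h : ∀ v, g.val x u v = 0) :
    u = 0 := by
  obtain ⟨b, hb⟩ := g.signature x
  refine b.ext_elem fun i => ?_
  have h1 := h (b i)
  rw [← b.sum_repr u] at h1
  simp only [map_sum, map_smul, sum_apply, smul_apply, hb] at h1
  rw [Finset.sum_eq_single i (fun j _ hj => by simp [hj]) (by simp)] at h1
  simp only [if_true] at h1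
  rw [map_zero, Finsupp.zero_apply]
  split_ifs at h1 <;> simpa using h1

lemma metric_repr {x : M} {b : Module.Basis (Fin (n + 1)) ℝ (TangentSpace (𝓡 (n + 1)) x)}
    (hb : ∀ i j, g.val x (b i) (b j) = if i = j then (if i = 0 then -1 else 1) else 0)
    (u v : TangentSpace (𝓡 (n + 1)) x) :
    g.val x u v = - (b.repr u 0 * b.repr v 0) + ∑ i : Fin n, b.repr u i.succ * b.repr v i.succ := by
  conv_lhs => rw [← b.sum_repr u, ← b.sum_repr v]
  simp only [map_sum, map_smul, sum_apply, smul_apply, hb, smul_eq_mul]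
  simp only [mul_ite, mul_zero, Finset.mem_univ, if_true, Finset.sum_ite_eq']
  rw [Fin.sum_univ_succ]
  simp [Fin.succ_ne_zero, mul_comm]

/-- The metric is positive semi-definite on the orthogonal complement of a null vector `l`, and
only the multiples of `l` are null there. -/
lemma exists_eq_smul_of_null {x : M} {l v : TangentSpace (𝓡 (n + 1)) x} (hl : l ≠ 0)
    (hll : g.val x l l = 0) (hlv : g.val x l v = 0) (hvv : g.val x v v = 0) :
    ∃ a : ℝ, v = a • l := by
  obtain ⟨b, hb⟩ := g.signature x
  have hrep := metric_repr g hb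
  have hl0 : b.repr l 0 ≠ 0 := by
    intro h0
    have h1 := hrep l l
    rw [hll, h0] at h1
    simp only [mul_zero, neg_zero, zero_add] at h1
    have h2 := (Finset.sum_eq_zero_iff_of_nonneg (fun i _ => mul_self_nonneg _)).1 h1.symm
    refine hl (b.ext_elem fun i => ?_)
    rw [map_zero, Finsupp.zero_apply]
    refine Fin.cases h0 (fun i => ?_) i
    exact mul_self_eq_zero.1 (h2 i (Finset.mem_univ i))
  refine ⟨b.repr v 0 / b.repr l 0, ?_⟩
  set a := b.repr v 0 / b.repr l 0 with ha
  set w := v - a • l with hw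
  have hw0 : b.repr w 0 = 0 := by
    simp only [hw, map_sub, map_smul, Finsupp.sub_apply, Finsupp.smul_apply, smul_eq_mul, ha]
    field_simp
    simp
  have hww : g.val x w w = 0 := by
    have hvl : g.val x v l = 0 := by rw [g.symm]; exact hlv
    simp only [hw, map_sub, map_smul, sub_apply, smul_apply, hll, hlv, hvv, hvl]
    simp
  have h1 := hrep w w
  rw [hww, hw0] at h1
  simp only [mul_zero, neg_zero, zero_add] at h1
  have h2 := (Finset.sum_eq_zero_iff_of_nonneg (fun i _ => mul_self_nonneg _)).1 h1.symm
  have hw' : w = 0 := by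
    refine b.ext_elem fun i => ?_
    rw [map_zero, Finsupp.zero_apply]
    refine Fin.cases hw0 (fun i => ?_) i
    exact mul_self_eq_zero.1 (h2 i (Finset.mem_univ i))
  exact sub_eq_zero.1 hw'

variable {g}

lemma hasFDerivAt_of_contDiffOn {E F : Type*} [NormedAddCommGroup E] [NormedSpace ℝ E]
    [NormedAddCommGroup F] [NormedSpace ℝ F] {f : E → F} {s : Set E} (hs : IsOpen s)
    (hf : ContDiffOn ℝ ∞ f s) {z : E} (hz : z ∈ s) : HasFDerivAt f (fderiv ℝ f z) z :=
  ((hf.differentiableOn (by simp)).differentiableAt (hs.mem_nhds hz)).hasFDerivAt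

/-- The Killing equation in coordinates. -/
lemma killing_coord [T2Space M] {X : ∀ x : M, TangentSpace (𝓡 (n + 1)) x} (hX : g.IsKilling X)
    {x₀ : M} {z : Model (n + 1)} (hz : z ∈ (extChartAt (𝓡 (n + 1)) x₀).target)
    (u v : Model (n + 1)) :
    fderiv ℝ (coordMetric g x₀) z (chartField x₀ X z) u v
      + coordMetric g x₀ z (fderiv ℝ (chartField x₀ X) z u) v
      + coordMetric g x₀ z u (fderiv ℝ (chartField x₀ X) z v) = 0 := by
  have hO := isOpen_extChartAt_target (I := 𝓡 (n + 1)) x₀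
  obtain ⟨U, hU, hUe⟩ := exists_isSmoothField hz u
  obtain ⟨W, hW, hWe⟩ := exists_isSmoothField hz v
  have hG := hasFDerivAt_of_contDiffOn hO (contDiffOn_coordMetric g x₀) hz
  have key := hX.2 U W hU hW ((extChartAt (𝓡 (n + 1)) x₀).symm z)
  rw [dirDeriv_eq_fderiv hz X ((contMDiff_pair g hU hW).mdifferentiable (by simp) _),
    ← coordMetric_chartField g hz, ← coordMetric_chartField g hz, chartField_mlieBracket hz hX.1 hU,
    chartField_mlieBracket hz hX.1 hW, VectorField.lieBracket, VectorField.lieBracket,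
    hUe.fderiv_eq, hWe.fderiv_eq, hUe.self_of_nhds, hWe.self_of_nhds] at key
  have hf : (g.pair U W ∘ (extChartAt (𝓡 (n + 1)) x₀).symm) =ᶠ[𝓝 z]
      fun y => coordMetric g x₀ y u v := by
    filter_upwards [hO.mem_nhds hz, hUe, hWe] with y hy h1 h2
    rw [Function.comp_apply, ← coordMetric_chartField g hy, h1, h2]
  have h1 := (hG.clm_apply (hasFDerivAt_const u z)).clm_apply (hasFDerivAt_const v z)
  rw [hf.fderiv_eq, h1.fderiv] at key
  simp at key
  linarith

/-- The exterior derivative of the one-form `g (X, ·)` on two fields with locally constant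
coordinates. -/
lemma extDerivOneForm_coord {X : ∀ x : M, TangentSpace (𝓡 (n + 1)) x} (hX : IsSmoothField X)
    {x₀ : M} {z : Model (n + 1)} (hz : z ∈ (extChartAt (𝓡 (n + 1)) x₀).target)
    {U W : ∀ x : M, TangentSpace (𝓡 (n + 1)) x} (hU : IsSmoothField U) (hW : IsSmoothField W)
    {u v : Model (n + 1)} (hUe : chartField x₀ U =ᶠ[𝓝 z] fun _ => u)
    (hWe : chartField x₀ W =ᶠ[𝓝 z] fun _ => v) :
    extDerivOneForm (fun y w => g.val y (X y) w) U W ((extChartAt (𝓡 (n + 1)) x₀).symm z) =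
      fderiv ℝ (coordMetric g x₀) z u (chartField x₀ X z) v
      + coordMetric g x₀ z (fderiv ℝ (chartField x₀ X) z u) v
      - fderiv ℝ (coordMetric g x₀) z v (chartField x₀ X z) u
      - coordMetric g x₀ z (fderiv ℝ (chartField x₀ X) z v) u := by
  have hO := isOpen_extChartAt_target (I := 𝓡 (n + 1)) x₀
  have hG := hasFDerivAt_of_contDiffOn hO (contDiffOn_coordMetric g x₀) hz
  have hF := hasFDerivAt_of_contDiffOn hO (contDiffOn_chartField x₀ hX) hz
  have hd : ∀ (A B : ∀ x : M, TangentSpace (𝓡 (n + 1)) x) (a b : Model (n + 1)),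
      IsSmoothField B → chartField x₀ A =ᶠ[𝓝 z] (fun _ => a) →
      chartField x₀ B =ᶠ[𝓝 z] (fun _ => b) →
      dirDeriv A (fun y => g.val y (X y) (B y)) ((extChartAt (𝓡 (n + 1)) x₀).symm z) =
        fderiv ℝ (coordMetric g x₀) z a (chartField x₀ X z) b
          + coordMetric g x₀ z (fderiv ℝ (chartField x₀ X) z a) b := by
    intro A B a b hB hA hBe
    have hf : (g.pair X B ∘ (extChartAt (𝓡 (n + 1)) x₀).symm) =ᶠ[𝓝 z]
        fun y => coordMetric g x₀ y (chartField x₀ X y) b := by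
      filter_upwards [hO.mem_nhds hz, hBe] with y hy h2
      rw [Function.comp_apply, ← coordMetric_chartField g hy, h2]
    have h1 := (hG.clm_apply hF).clm_apply (hasFDerivAt_const b z)
    have h2 := dirDeriv_eq_fderiv hz A ((contMDiff_pair g hX hB).mdifferentiable (by simp) _)
    rw [hf.fderiv_eq, h1.fderiv, hA.self_of_nhds] at h2
    refine h2.trans ?_
    simp [add_comm]
  have hbr : g.val ((extChartAt (𝓡 (n + 1)) x₀).symm z) (X ((extChartAt (𝓡 (n + 1)) x₀).symm z))
      (VectorField.mlieBracket (𝓡 (n + 1)) U W ((extChartAt (𝓡 (n + 1)) x₀).symm z)) = 0 := by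
    have := coordMetric_chartField g hz X (VectorField.mlieBracket (𝓡 (n + 1)) U W)
    rw [chartField_mlieBracket hz hU hW, VectorField.lieBracket, hUe.fderiv_eq,
      hWe.fderiv_eq] at this
    simp at this
    exact this.symm
  rw [extDerivOneForm, hd U W u v hW hUe hWe, hd W U v u hU hWe hUe, hbr]
  ring

end ChartMetric

/-! ### The Killing system in a chart -/

/-- An antisymmetrized product of a two-form with one-forms, evaluated on vectors of which all but
the first two are dual to the one-forms: only the identity and one transposition contribute. -/
lemma sum_perm_eq_of_dual {s : ℕ} (A : Fin (s + 2) → Fin (s + 2) → ℝ)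
    (P : Fin s → Fin (s + 2) → ℝ) (hP : ∀ ν a, P ν a = if a = ν.succ.succ then 1 else 0) :
    ∑ σ : Equiv.Perm (Fin (s + 2)), ((Equiv.Perm.sign σ : ℤ) : ℝ) *
      (A (σ 0) (σ 1) * ∏ ν : Fin s, P ν (σ ν.succ.succ)) = A 0 1 - A 1 0 := by
  have h01 : (0 : Fin (s + 2)) ≠ 1 := by simp
  have hne : (1 : Equiv.Perm (Fin (s + 2))) ≠ Equiv.swap 0 1 := fun h => by
    have := Equiv.congr_fun h 0
    simp at this
  have hss : ∀ ν : Fin s, ν.succ.succ ≠ (0 : Fin (s + 2)) ∧ ν.succ.succ ≠ (1 : Fin (s + 2)) :=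
    fun ν => ⟨Fin.succ_ne_zero _, fun h => by
      rw [← Fin.succ_zero_eq_one, Fin.succ_inj] at h; exact Fin.succ_ne_zero _ h⟩
  rw [Fintype.sum_eq_add 1 (Equiv.swap 0 1) hne]
  · have h1 : ∀ ν : Fin s, Equiv.swap (0 : Fin (s + 2)) 1 ν.succ.succ = ν.succ.succ := fun ν =>
      Equiv.swap_apply_of_ne_of_ne (hss ν).1 (hss ν).2
    simp [hP, h1, Equiv.Perm.sign_swap h01]
    ring
  · rintro σ ⟨hσ1, hσ2⟩
    by_cases hσ : ∀ ν : Fin s, σ ν.succ.succ = ν.succ.succ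
    · exfalso
      have hcases : ∀ a : Fin (s + 2), a = 0 ∨ a = 1 ∨ ∃ ν : Fin s, a = ν.succ.succ := fun a => by
        refine Fin.cases (Or.inl rfl) (fun b => ?_) a
        exact Fin.cases (Or.inr (Or.inl rfl)) (fun c => Or.inr (Or.inr ⟨c, rfl⟩)) b
      have hlow : ∀ a : Fin (s + 2), (a = 0 ∨ a = 1) → σ a = 0 ∨ σ a = 1 := fun a ha => by
        rcases hcases (σ a) with h | h | ⟨ν, h⟩
        · exact Or.inl h
        · exact Or.inr h
        · have := σ.injective (h.trans (hσ ν).symm)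
          rcases ha with rfl | rfl
          · exact absurd this.symm (hss ν).1
          · exact absurd this.symm (hss ν).2
      rcases hlow 0 (Or.inl rfl) with h0 | h0 <;> rcases hlow 1 (Or.inr rfl) with h1 | h1
      · exact h01 (σ.injective (h0.trans h1.symm))
      · refine hσ1 (Equiv.ext fun a => ?_)
        rcases hcases a with rfl | rfl | ⟨ν, rfl⟩
        · simpa using h0
        · simpa using h1
        · simpa using hσ ν
      · refine hσ2 (Equiv.ext fun a => ?_)
        rcases hcases a with rfl | rfl | ⟨ν, rfl⟩
        · simpa using h0
        · simpa using h1
        · rw [hσ ν, Equiv.swap_apply_of_ne_of_ne (hss ν).1 (hss ν).2]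
      · exact h01 (σ.injective (h0.trans h1.symm))
    · push Not at hσ
      obtain ⟨ν, hν⟩ := hσ
      rw [Finset.prod_eq_zero (Finset.mem_univ ν) (by rw [hP, if_neg hν]), mul_zero, mul_zero]

section ChartSystem

open LorentzGeom

universe u

variable {n r : ℕ} {M : Type u} [TopologicalSpace M] [ChartedSpace (Model (n + 1)) M]

/-- The coordinate expression of the fields `∑ μ, b μ • K μ`, as a linear map of the
coefficients. -/
noncomputable def coordFrame (K : Fin (r + 1) → ∀ x : M, TangentSpace (𝓡 (n + 1)) x) (x₀ : M)
    (z : Model (n + 1)) : (Fin (r + 1) → ℝ) →L[ℝ] Model (n + 1) :=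
  ∑ μ, (ContinuousLinearMap.proj μ : (Fin (r + 1) → ℝ) →L[ℝ] ℝ).smulRight (chartField x₀ (K μ) z)

lemma coordFrame_apply (K : Fin (r + 1) → ∀ x : M, TangentSpace (𝓡 (n + 1)) x) (x₀ : M)
    (z : Model (n + 1)) (b : Fin (r + 1) → ℝ) :
    coordFrame K x₀ z b = ∑ μ, b μ • chartField x₀ (K μ) z := by
  simp [coordFrame]

/-- The combination of the fields `K μ` with constant coefficients `b`. -/
noncomputable def combination (K : Fin (r + 1) → ∀ x : M, TangentSpace (𝓡 (n + 1)) x)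
    (b : Fin (r + 1) → ℝ) (x : M) : TangentSpace (𝓡 (n + 1)) x := ∑ μ, b μ • K μ x

lemma coordFrame_eq_chartField (K : Fin (r + 1) → ∀ x : M, TangentSpace (𝓡 (n + 1)) x) (x₀ : M)
    (z : Model (n + 1)) (b : Fin (r + 1) → ℝ) :
    coordFrame K x₀ z b = chartField x₀ (combination K b) z := by
  rw [coordFrame_apply, chartField, combination, map_sum]
  simp only [map_smul]
  rfl

variable [IsManifold (𝓡 (n + 1)) ∞ M]

lemma chartDeriv_coordFrame (K : Fin (r + 1) → ∀ x : M, TangentSpace (𝓡 (n + 1)) x) {x₀ : M}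
    {z : Model (n + 1)} (hz : z ∈ (extChartAt (𝓡 (n + 1)) x₀).target) (b : Fin (r + 1) → ℝ) :
    chartDeriv x₀ z (coordFrame K x₀ z b) =
      combination K b ((extChartAt (𝓡 (n + 1)) x₀).symm z) := by
  rw [coordFrame_eq_chartField, chartDeriv_chartField hz]

lemma coordFrame_injective_iff (K : Fin (r + 1) → ∀ x : M, TangentSpace (𝓡 (n + 1)) x) {x₀ : M}
    {z : Model (n + 1)} (hz : z ∈ (extChartAt (𝓡 (n + 1)) x₀).target) :
    Function.Injective (coordFrame K x₀ z) ↔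
      LinearIndependent ℝ fun μ => K μ ((extChartAt (𝓡 (n + 1)) x₀).symm z) := by
  rw [Fintype.linearIndependent_iff, injective_iff_map_eq_zero]
  have h : ∀ b, coordFrame K x₀ z b = 0 ↔
      ∑ μ, b μ • K μ ((extChartAt (𝓡 (n + 1)) x₀).symm z) = 0 := fun b => by
    refine ⟨fun hb => ?_, fun hb => ?_⟩
    · have := chartDeriv_coordFrame K hz b
      rw [hb, map_zero] at this
      exact this.symm
    · rw [coordFrame_eq_chartField, chartField, combination, hb, map_zero]
      rfl
  simp only [h, funext_iff, Pi.zero_apply]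

variable {g : LorentzianMetric n M} {K : Fin (r + 1) → ∀ x : M, TangentSpace (𝓡 (n + 1)) x}

lemma contDiffOn_coordFrame (hK : ∀ μ, IsSmoothField (K μ)) (x₀ : M) :
    ContDiffOn ℝ ∞ (coordFrame K x₀) (extChartAt (𝓡 (n + 1)) x₀).target := by
  rw [contDiffOn_clm_apply]
  intro b
  simp only [coordFrame_apply]
  exact ContDiffOn.sum fun μ _ => (contDiffOn_chartField x₀ (hK μ)).const_smul (b μ)

lemma fderiv_coordFrame_apply (hK : ∀ μ, IsSmoothField (K μ)) {x₀ : M} {z : Model (n + 1)}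
    (hz : z ∈ (extChartAt (𝓡 (n + 1)) x₀).target) (u : Model (n + 1)) (b : Fin (r + 1) → ℝ) :
    fderiv ℝ (coordFrame K x₀) z u b = ∑ μ, b μ • fderiv ℝ (chartField x₀ (K μ)) z u := by
  have hO := isOpen_extChartAt_target (I := 𝓡 (n + 1)) x₀
  have h1 := (hasFDerivAt_of_contDiffOn hO (contDiffOn_coordFrame hK x₀) hz).clm_apply
    (hasFDerivAt_const b z)
  have h2 : HasFDerivAt (fun y => coordFrame K x₀ y b)
      (∑ μ, b μ • fderiv ℝ (chartField x₀ (K μ)) z) z := by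
    simp only [coordFrame_apply]
    exact HasFDerivAt.fun_sum fun μ _ =>
      (hasFDerivAt_of_contDiffOn hO (contDiffOn_chartField x₀ (hK μ)) hz).const_smul (b μ)
  have := DFunLike.congr_fun (h1.unique h2) u
  simpa using this

lemma coordMetric_nondeg {x₀ : M} {z : Model (n + 1)}
    (hz : z ∈ (extChartAt (𝓡 (n + 1)) x₀).target) {u : Model (n + 1)}
    (h : ∀ v, coordMetric g x₀ z u v = 0) : u = 0 := by
  have h1 : chartDeriv x₀ z u = 0 := metric_nondeg g fun v => by
    rw [← chartDeriv_mfderiv hz v]; exact h _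
  have h2 := mfderiv_chartDeriv hz u
  rw [h1, map_zero] at h2
  exact h2.symm

/-- Functionals on the coefficients are represented by vectors where the fields are linearly
independent. -/
lemma exists_dual_vector {x₀ : M} {z : Model (n + 1)}
    (hz : z ∈ (extChartAt (𝓡 (n + 1)) x₀).target)
    (hinj : Function.Injective (coordFrame K x₀ z)) (ν : Fin (r + 1)) :
    ∃ w : Model (n + 1), ∀ μ, coordMetric g x₀ z (chartField x₀ (K μ) z) w =
      if ν = μ then 1 else 0 := by
  obtain ⟨ξ, hξ⟩ := LinearMap.dualMap_surjective_of_injective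
    (f := (coordFrame K x₀ z).toLinearMap) hinj (LinearMap.proj ν)
  let T : Model (n + 1) →ₗ[ℝ] Module.Dual ℝ (Model (n + 1)) :=
    ContinuousLinearMap.coeLM ℝ ∘ₗ (coordMetric g x₀ z).toLinearMap
  have hT : Function.Injective T := by
    rw [injective_iff_map_eq_zero]
    intro u hu
    exact coordMetric_nondeg hz fun v => DFunLike.congr_fun hu v
  have hTs : Function.Surjective T :=
    (LinearMap.injective_iff_surjective_of_finrank_eq_finrank
      (by rw [Subspace.dual_finrank_eq])).1 hT
  obtain ⟨w, hw⟩ := hTs ξ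
  refine ⟨w, fun μ => ?_⟩
  rw [coordMetric_symm]
  have h1 : T w (chartField x₀ (K μ) z) = ξ (chartField x₀ (K μ) z) := by rw [hw]
  have h2 : coordFrame K x₀ z (Pi.single μ 1) = chartField x₀ (K μ) z := by
    rw [coordFrame_apply, Finset.sum_eq_single μ (fun j _ hj => by simp [hj]) (by simp)]
    simp
  have h3 : ξ (coordFrame K x₀ z (Pi.single μ 1)) = (Pi.single μ 1 : Fin (r + 1) → ℝ) ν :=
    DFunLike.congr_fun hξ (Pi.single μ 1)
  rw [h2] at h3
  refine (h1.trans h3).trans ?_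
  rw [Pi.single_apply]

/-- The orthogonal integrability condition in coordinates. -/
lemma extDeriv_coord_eq_zero [T2Space M] (hK : ∀ μ, IsSmoothField (K μ))
    (hInt : g.OrthogonallyIntegrable K) {x₀ : M} {z : Model (n + 1)}
    (hz : z ∈ (extChartAt (𝓡 (n + 1)) x₀).target)
    (hinj : Function.Injective (coordFrame K x₀ z)) (b : Fin (r + 1) → ℝ) {u v : Model (n + 1)}
    (hu : ∀ b', coordMetric g x₀ z (coordFrame K x₀ z b') u = 0)
    (hv : ∀ b', coordMetric g x₀ z (coordFrame K x₀ z b') v = 0) :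
    extDeriv (coordMetric g x₀) (coordFrame K x₀) z b u v = 0 := by
  have hsingle : ∀ ν, coordFrame K x₀ z (Pi.single ν 1) = chartField x₀ (K ν) z := fun ν => by
    rw [coordFrame_apply, Finset.sum_eq_single ν (fun j _ hj => by simp [hj]) (by simp)]
    simp
  -- the wedge product is evaluated on `u`, `v` and vectors dual to the one-forms `g (K ν)`
  choose w hw using fun ν => exists_dual_vector (g := g) (K := K) hz hinj ν
  have key : ∀ μ, extDeriv (coordMetric g x₀) (coordFrame K x₀) z (Pi.single μ 1) u v = 0 := by
    intro μ
    have hfd : ∀ y, fderiv ℝ (coordFrame K x₀) z y (Pi.single μ 1) =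
        fderiv ℝ (chartField x₀ (K μ)) z y := fun y => by
      rw [fderiv_coordFrame_apply hK hz,
        Finset.sum_eq_single μ (fun j _ hj => by simp [hj]) (by simp)]
      simp
    choose X hXs hXe using fun a : Fin (r + 1 + 2) => exists_isSmoothField hz
      ((Fin.cons u (Fin.cons v w : Fin (r + 1 + 1) → Model (n + 1)) :
        Fin (r + 1 + 2) → Model (n + 1)) a)
    have h := hInt μ X hXs ((extChartAt (𝓡 (n + 1)) x₀).symm z)
    have hpair : ∀ (ν : Fin (r + 1)) (a : Fin (r + 1 + 2)),
        g.pair (K ν) (X a) ((extChartAt (𝓡 (n + 1)) x₀).symm z) =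
          if a = ν.succ.succ then 1 else 0 := fun ν a => by
      rw [← coordMetric_chartField g hz, (hXe a).self_of_nhds]
      refine Fin.cases ?_ (fun a => Fin.cases ?_ (fun a => ?_) a) a
      · rw [Fin.cons_zero, ← hsingle, hu, if_neg (Fin.succ_ne_zero _).symm]
      · rw [Fin.cons_succ, Fin.cons_zero, ← hsingle, hv, if_neg]
        rw [Fin.succ_inj]
        exact (Fin.succ_ne_zero _).symm
      · rw [Fin.cons_succ, Fin.cons_succ, hw]
        simp only [Fin.succ_inj]
    rw [sum_perm_eq_of_dual (fun a b => extDerivOneForm (fun y v => g.val y (K μ y) v) (X a) (X b)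
      ((extChartAt (𝓡 (n + 1)) x₀).symm z)) (fun ν a => g.pair (K ν) (X a)
      ((extChartAt (𝓡 (n + 1)) x₀).symm z)) hpair,
      extDerivOneForm_coord (hK μ) hz (hXs 0) (hXs 1) (hXe 0) (hXe 1),
      extDerivOneForm_coord (hK μ) hz (hXs 1) (hXs 0) (hXe 1) (hXe 0)] at h
    have e0 : (Fin.cons u (Fin.cons v w : Fin (r + 1 + 1) → Model (n + 1)) :
        Fin (r + 1 + 2) → Model (n + 1)) 0 = u := rfl
    have e1 : (Fin.cons u (Fin.cons v w : Fin (r + 1 + 1) → Model (n + 1)) :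
        Fin (r + 1 + 2) → Model (n + 1)) 1 = v := rfl
    rw [e0, e1] at h
    rw [extDeriv, hfd, hfd, hsingle]
    linarith
  have hb : b = ∑ μ, b μ • (Pi.single μ 1 : Fin (r + 1) → ℝ) := by
    ext ν; simp [Pi.single_apply]
  have hlin : extDeriv (coordMetric g x₀) (coordFrame K x₀) z b u v =
      ∑ μ, b μ * extDeriv (coordMetric g x₀) (coordFrame K x₀) z (Pi.single μ 1) u v := by
    conv_lhs => rw [hb]
    simp only [extDeriv, map_sum, map_smul, sum_apply, smul_apply, smul_eq_mul, mul_sub, mul_add,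
      Finset.sum_add_distrib, Finset.sum_sub_distrib]
  rw [hlin]
  exact Finset.sum_eq_zero fun μ _ => by rw [key μ, mul_zero]

/-- Commuting Killing fields satisfying the orthogonal integrability condition form a Killing
system in each chart. -/
lemma isKillingSystem_chart [T2Space M] (hKilling : ∀ μ, g.IsKilling (K μ))
    (hComm : ∀ μ ν, ∀ x : M, VectorField.mlieBracket (𝓡 (n + 1)) (K μ) (K ν) x = 0)
    (hInt : g.OrthogonallyIntegrable K) (x₀ : M) :
    IsKillingSystem (extChartAt (𝓡 (n + 1)) x₀).target (coordMetric g x₀) (coordFrame K x₀) where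
  isOpen := isOpen_extChartAt_target x₀
  smooth_metric := contDiffOn_coordMetric g x₀
  smooth_field := contDiffOn_coordFrame (fun μ => (hKilling μ).1) x₀
  symm z _ u v := coordMetric_symm g x₀ z u v
  nondeg z hz u h := coordMetric_nondeg hz h
  null z hz l v hl hll hlv hvv := by
    obtain ⟨a, ha⟩ := exists_eq_smul_of_null g (l := chartDeriv x₀ z l) (v := chartDeriv x₀ z v)
      (fun h => hl (by rw [← mfderiv_chartDeriv hz l, h, map_zero]; rfl)) hll hlv hvv
    refine ⟨a, ?_⟩
    rw [← mfderiv_chartDeriv hz v, ha, map_smul, mfderiv_chartDeriv hz]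
    rfl
  killing z hz b u v := by
    have h := fun μ => killing_coord (hKilling μ) hz u v
    have h1 : ∑ μ, b μ * (fderiv ℝ (coordMetric g x₀) z (chartField x₀ (K μ) z) u v
      + coordMetric g x₀ z (fderiv ℝ (chartField x₀ (K μ)) z u) v
      + coordMetric g x₀ z u (fderiv ℝ (chartField x₀ (K μ)) z v)) = 0 :=
      Finset.sum_eq_zero fun μ _ => by rw [h μ, mul_zero]
    rw [fderiv_coordFrame_apply (fun μ => (hKilling μ).1) hz,
      fderiv_coordFrame_apply (fun μ => (hKilling μ).1) hz, coordFrame_apply]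
    simp only [map_sum, map_smul, sum_apply, smul_apply, smul_eq_mul]
    rw [← h1]
    simp only [mul_add, Finset.sum_add_distrib]
  comm z hz b b' := by
    have h : ∀ μ ν, fderiv ℝ (chartField x₀ (K ν)) z (chartField x₀ (K μ) z) =
        fderiv ℝ (chartField x₀ (K μ)) z (chartField x₀ (K ν) z) := fun μ ν => by
      have h1 := chartField_mlieBracket hz (hKilling μ).1 (hKilling ν).1
      rw [chartField, hComm, map_zero] at h1
      exact sub_eq_zero.1 h1.symm
    rw [fderiv_coordFrame_apply (fun μ => (hKilling μ).1) hz,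
      fderiv_coordFrame_apply (fun μ => (hKilling μ).1) hz, coordFrame_apply, coordFrame_apply]
    simp only [map_sum, map_smul, Finset.smul_sum]
    rw [Finset.sum_comm]
    refine Finset.sum_congr rfl fun μ _ => Finset.sum_congr rfl fun ν _ => ?_
    rw [h μ ν, smul_comm]
  orth z hz hinj b u v hu hv :=
    extDeriv_coord_eq_zero (fun μ => (hKilling μ).1) hInt hz hinj b hu hv

end ChartSystem

/-! ### The horizon set -/

/-- A family of vectors has vanishing exterior product if and only if it is linearly dependent. -/
lemma ιMulti_eq_zero_iff {E : Type*} [AddCommGroup E] [Module ℝ E] [FiniteDimensional ℝ E]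
    {s : ℕ} (v : Fin s → E) :
    ExteriorAlgebra.ιMulti ℝ s v = 0 ↔ ¬ LinearIndependent ℝ v := by
  refine ⟨fun h hv => ?_, AlternatingMap.map_linearDependent _ v⟩
  -- a left inverse of the injective map given by `v`, composed with the determinant
  obtain ⟨L, hL⟩ := (Fintype.linearCombination ℝ v).exists_leftInverse_of_injective
    (LinearMap.ker_eq_bot.2 (linearIndependent_iff_injective_fintypeLinearCombination.1 hv))
  let D : E [⋀^Fin s]→ₗ[ℝ] ℝ := (Pi.basisFun ℝ (Fin s)).det.compLinearMap L
  have hD : D v = 1 := by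
    have h1 : (fun i => L (v i)) = Pi.basisFun ℝ (Fin s) := by
      funext i
      have h2 := LinearMap.congr_fun hL (Pi.single i 1)
      simpa [Fintype.linearCombination_apply_single] using h2
    show (Pi.basisFun ℝ (Fin s)).det (fun i => L (v i)) = 1
    rw [h1, Module.Basis.det_self]
  have h1 := ExteriorAlgebra.liftAlternating_apply_ιMulti
    (fun i => if h : i = s then h ▸ D else 0) v
  rw [h, map_zero, dif_pos rfl] at h1
  exact one_ne_zero (hD.symm.trans h1.symm)

section Horizon

open LorentzGeom

universe u

variable {n r : ℕ} {M : Type u} [TopologicalSpace M] [ChartedSpace (Model (n + 1)) M]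

lemma mem_degeneracySet_iff {K : Fin (r + 1) → ∀ x : M, TangentSpace (𝓡 (n + 1)) x} {x : M} :
    x ∈ LorentzianMetric.degeneracySet K ↔ ¬ LinearIndependent ℝ fun μ => K μ x := by
  have : FiniteDimensional ℝ (TangentSpace (𝓡 (n + 1)) x) :=
    inferInstanceAs (FiniteDimensional ℝ (Model (n + 1)))
  exact ιMulti_eq_zero_iff fun μ => K μ x

lemma combination_ne_zero {K : Fin (r + 1) → ∀ x : M, TangentSpace (𝓡 (n + 1)) x} {x : M}
    (hx : LinearIndependent ℝ fun μ => K μ x)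
    {b : Fin (r + 1) → ℝ} (hb : b ≠ 0) : combination K b x ≠ 0 := fun h =>
  hb (funext (Fintype.linearIndependent_iff.1 hx b h))

variable [IsManifold (𝓡 (n + 1)) ∞ M] {g : LorentzianMetric n M}
  {K : Fin (r + 1) → ∀ x : M, TangentSpace (𝓡 (n + 1)) x}

variable (g K) in
/-- The points at which the fields `K μ` are linearly independent and orthogonal to their
combination with coefficients `c`. -/
def regularPoints (c : Fin (r + 1) → ℝ) : Set M :=
  {x | LinearIndependent ℝ (fun μ => K μ x) ∧ ∀ μ, g.pair (K μ) (combination K c) x = 0}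

lemma pair_combination_left (b : Fin (r + 1) → ℝ) (Y : ∀ x : M, TangentSpace (𝓡 (n + 1)) x)
    (x : M) : g.pair (combination K b) Y x = ∑ μ, b μ * g.pair (K μ) Y x := by
  simp only [LorentzianMetric.pair, combination, map_sum, map_smul, sum_apply, smul_apply,
    smul_eq_mul]

lemma pair_combination_right (b : Fin (r + 1) → ℝ) (X : ∀ x : M, TangentSpace (𝓡 (n + 1)) x)
    (x : M) : g.pair X (combination K b) x = ∑ μ, b μ * g.pair X (K μ) x := by
  simp only [LorentzianMetric.pair, combination, map_sum, map_smul, smul_eq_mul]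

lemma pair_comm (X Y : ∀ x : M, TangentSpace (𝓡 (n + 1)) x) (x : M) :
    g.pair X Y x = g.pair Y X x := g.symm _ _ _

/-- The Gram determinant vanishes exactly where some non-trivial combination of the fields is
orthogonal to all of them. -/
lemma areaFunction_eq_zero_iff (x : M) :
    g.areaFunction K x = 0 ↔ ∃ b : Fin (r + 1) → ℝ, b ≠ 0 ∧
      ∀ μ, g.pair (K μ) (combination K b) x = 0 := by
  rw [LorentzianMetric.areaFunction, neg_eq_zero, ← Matrix.exists_mulVec_eq_zero_iff]
  refine exists_congr fun b => and_congr_right fun _ => ?_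
  rw [funext_iff]
  refine forall_congr' fun μ => ?_
  rw [pair_combination_right]
  simp only [Matrix.mulVec, dotProduct, Matrix.of_apply, Pi.zero_apply, mul_comm]

lemma pair_self_of_orthogonal {c : Fin (r + 1) → ℝ} {x : M}
    (h : ∀ μ, g.pair (K μ) (combination K c) x = 0) :
    g.pair (combination K c) (combination K c) x = 0 := by
  rw [pair_combination_left]
  exact Finset.sum_eq_zero fun μ _ => by rw [h μ, mul_zero]

/-- Off the degeneracy set, a combination of the fields is null and the Gram determinant vanishes
exactly where the combination is orthogonal to all the fields. -/
lemma regularPoints_eq {c : Fin (r + 1) → ℝ} (hc : c ≠ 0) :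
    {q | q ∉ LorentzianMetric.degeneracySet K ∧
      g.pair (combination K c) (combination K c) q = 0 ∧ g.areaFunction K q = 0} =
      regularPoints g K c := by
  ext q
  simp only [mem_ofPred_eq, mem_degeneracySet_iff, not_not, regularPoints]
  refine and_congr_right fun hq => ⟨fun ⟨hll, hW⟩ => ?_, fun h =>
    ⟨pair_self_of_orthogonal h, (areaFunction_eq_zero_iff q).2 ⟨c, hc, h⟩⟩⟩
  obtain ⟨d, hd, hdo⟩ := (areaFunction_eq_zero_iff q).1 hW
  -- the kernel vector and the null combination are orthogonal null vectors, hence proportional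
  have hdl : g.pair (combination K d) (combination K c) q = 0 := by
    rw [pair_comm, pair_combination_left]
    exact Finset.sum_eq_zero fun μ _ => by rw [hdo μ, mul_zero]
  obtain ⟨a, ha⟩ := exists_eq_smul_of_null g (combination_ne_zero hq hd)
    (pair_self_of_orthogonal hdo) hdl hll
  intro μ
  rw [LorentzianMetric.pair, ha, map_smul]
  have : g.val q (K μ q) (combination K d q) = 0 := hdo μ
  rw [this, smul_zero]

variable (g K) in
/-- The constant coefficients of the generator at `p`. -/
noncomputable def generatorCoeff (p : M) : Fin (r + 1) → ℝ :=
  Fin.cons 1 fun j => - ∑ i, (g.gram K p)⁻¹ i j * g.pair (K 0) (K i.succ) p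

lemma generator_eq_combination (p x : M) :
    g.generator K p x = combination K (generatorCoeff g K p) x := by
  rw [LorentzianMetric.generator, combination, Fin.sum_univ_succ, Finset.sum_comm, sub_eq_add_neg,
    ← Finset.sum_neg_distrib]
  simp only [generatorCoeff, Fin.cons_zero, Fin.cons_succ, one_smul, neg_smul, Finset.sum_smul]

lemma generatorCoeff_ne_zero (p : M) : generatorCoeff g K p ≠ 0 := fun h => by
  have := congrFun h 0
  simp [generatorCoeff] at this

/-- The base point is regular: the correction terms make the generator orthogonal to
`K 1, …, K r`, and together with a kernel vector of the Gram matrix these fields span all of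
them. -/
lemma mem_regularPoints {p : M} (hW : g.areaFunction K p = 0)
    (hp : p ∉ LorentzianMetric.degeneracySet K) (hh : IsUnit (g.gram K p).det) :
    p ∈ regularPoints g K (generatorCoeff g K p) := by
  have hp' : LinearIndependent ℝ fun μ => K μ p := by
    rwa [mem_degeneracySet_iff, not_not] at hp
  set c := generatorCoeff g K p
  have hc0 : c 0 = 1 := rfl
  have hcs : ∀ j : Fin r, c j.succ = - ∑ i, (g.gram K p)⁻¹ i j * g.pair (K 0) (K i.succ) p :=
    fun j => rfl
  have hs : ∀ k : Fin r, g.pair (K k.succ) (combination K c) p = 0 := fun k => by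
    rw [pair_combination_right, Fin.sum_univ_succ, hc0, one_mul]
    have h1 : ∑ j : Fin r, c j.succ * g.pair (K k.succ) (K j.succ) p
        = - ∑ i : Fin r, ((g.gram K p)⁻¹ * g.gram K p) i k * g.pair (K 0) (K i.succ) p := by
      simp only [hcs, neg_mul, Finset.sum_neg_distrib, Finset.sum_mul, Matrix.mul_apply]
      rw [Finset.sum_comm]
      refine congrArg _ (Finset.sum_congr rfl fun i _ => Finset.sum_congr rfl fun j _ => ?_)
      have : g.pair (K k.succ) (K j.succ) p = g.gram K p j k := pair_comm _ _ _
      rw [this]; ring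
    rw [h1, Matrix.nonsing_inv_mul _ hh]
    simp only [Matrix.one_apply, ite_mul, one_mul, zero_mul, Finset.sum_ite_eq', Finset.mem_univ,
      if_true]
    rw [pair_comm]; ring
  -- `K 0` is orthogonal to the generator as well, since the kernel vector `d` involves `K 0`
  refine ⟨hp', fun μ => ?_⟩
  refine Fin.cases ?_ hs μ
  obtain ⟨d, hd, hdo⟩ := (areaFunction_eq_zero_iff p).1 hW
  -- otherwise `d` would give a kernel vector of the invertible matrix `h(p)`
  have hd0 : d 0 ≠ 0 := fun h0 => by
    have h1 : (g.gram K p).mulVec (fun j => d j.succ) = 0 := by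
      funext i
      have h2 := hdo i.succ
      rw [pair_combination_right, Fin.sum_univ_succ, h0, zero_mul, zero_add] at h2
      rw [Pi.zero_apply, ← h2]
      simp only [Matrix.mulVec, dotProduct, LorentzianMetric.gram, Matrix.of_apply, mul_comm]
    have h3 := Matrix.eq_zero_of_mulVec_eq_zero hh.ne_zero h1
    refine hd (funext fun μ => ?_)
    refine Fin.cases h0 (fun j => ?_) μ
    exact congrFun h3 j
  have hdl : g.pair (combination K d) (combination K c) p = 0 := by
    rw [pair_comm, pair_combination_left]
    exact Finset.sum_eq_zero fun μ _ => by rw [hdo μ, mul_zero]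
  rw [pair_combination_left, Fin.sum_univ_succ,
    Finset.sum_eq_zero fun j _ => by rw [hs j, mul_zero], add_zero] at hdl
  exact (mul_eq_zero.1 hdl).resolve_left hd0

/-- `E_p` in terms of regular points. -/
lemma horizonSet_eq (p : M) : g.horizonSet K p =
    closure (regularPoints g K (generatorCoeff g K p)) \
      {q | combination K (generatorCoeff g K p) q = 0} := by
  have h : g.generator K p = combination K (generatorCoeff g K p) :=
    funext fun x => generator_eq_combination p x
  rw [LorentzianMetric.horizonSet, h, regularPoints_eq (generatorCoeff_ne_zero p)]

lemma isSmoothField_combination (hK : ∀ μ, IsSmoothField (K μ)) (c : Fin (r + 1) → ℝ) :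
    IsSmoothField (combination K c) :=
  ContMDiff.sum_section fun μ _ => (hK μ).const_smul_section

/-- Constant combinations of Killing fields are Killing fields. -/
lemma isKilling_combination (hK : ∀ μ, g.IsKilling (K μ)) (c : Fin (r + 1) → ℝ) :
    g.IsKilling (combination K c) := by
  refine ⟨isSmoothField_combination (fun μ => (hK μ).1) c, fun X Y hX hY x => ?_⟩
  have hbr : ∀ Z : ∀ x : M, TangentSpace (𝓡 (n + 1)) x, IsSmoothField Z →
      VectorField.mlieBracket (𝓡 (n + 1)) (combination K c) Z x =
        ∑ μ, c μ • VectorField.mlieBracket (𝓡 (n + 1)) (K μ) Z x := by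
    intro Z hZ
    have hz := mem_extChartAt_target (I := 𝓡 (n + 1)) x
    have hO := isOpen_extChartAt_target (I := 𝓡 (n + 1)) x
    set z := extChartAt (𝓡 (n + 1)) x x with hzdef
    have hx : (extChartAt (𝓡 (n + 1)) x).symm z = x := extChartAt_to_inv x
    have h0 : ∀ W : ∀ x : M, TangentSpace (𝓡 (n + 1)) x, IsSmoothField W →
        VectorField.mlieBracket (𝓡 (n + 1)) W Z ((extChartAt (𝓡 (n + 1)) x).symm z) =
          chartDeriv x z (VectorField.lieBracket ℝ (chartField x W) (chartField x Z) z) :=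
      fun W hW => by
      rw [← chartField_mlieBracket hz hW hZ, chartDeriv_chartField hz]
    have hd := fun μ => hasFDerivAt_of_contDiffOn hO (contDiffOn_chartField x (hK μ).1) hz
    have hcf : chartField x (combination K c) = fun y => ∑ μ, c μ • chartField x (K μ) y := by
      funext y
      rw [← coordFrame_eq_chartField, coordFrame_apply]
    have hfd : HasFDerivAt (chartField x (combination K c))
        (∑ μ, c μ • fderiv ℝ (chartField x (K μ)) z) z := by
      rw [hcf]
      exact HasFDerivAt.fun_sum fun μ _ => (hd μ).const_smul (c μ)
    rw [← hx, h0 _ (isSmoothField_combination (fun μ => (hK μ).1) c)]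
    simp only [h0 _ (hK _).1]
    simp only [VectorField.lieBracket, ← map_smul, ← map_sum]
    rw [hfd.fderiv, hcf]
    congr 1
    simp only [map_sum, map_smul, sum_apply, smul_apply, smul_sub, Finset.sum_sub_distrib]
  have h1 := fun μ => (hK μ).2 X Y hX hY x
  rw [LorentzianMetric.pair, LorentzianMetric.pair, hbr X hX, hbr Y hY, dirDeriv, combination]
  simp only [map_sum, map_smul, sum_apply, smul_apply, smul_eq_mul]
  rw [← Finset.sum_add_distrib]
  refine Finset.sum_congr rfl fun μ _ => ?_
  have h2 : mfderiv (𝓡 (n + 1)) 𝓘(ℝ, ℝ) (g.pair X Y) x (K μ x) = _ := h1 μ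
  rw [h2, LorentzianMetric.pair, LorentzianMetric.pair]
  exact mul_add _ _ _

end Horizon

/-! ### Charts adapted to the null distribution -/

section Straightening

variable {E F : Type*} [NormedAddCommGroup E] [NormedSpace ℝ E] [NormedAddCommGroup F]
  [NormedSpace ℝ F]

/-- The diffeomorphism which flattens the graph of `u`, in the coordinates around `q` given by
`Ψ`, to the slice `F × {0}` of the coordinates given by `σ`. -/
noncomputable def straighten (σ Ψ : (F × ℝ) ≃L[ℝ] E) (q : E) {Ω : Set E} (hΩ : IsOpen Ω) {s : Set F}
    (hs : IsOpen s) {u : F → ℝ} (hu : ContinuousOn u s) : OpenPartialHomeomorph E E where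
  toFun z := σ ((Ψ.symm (z - q)).1, (Ψ.symm (z - q)).2 - u (Ψ.symm (z - q)).1)
  invFun w := q + Ψ ((σ.symm w).1, (σ.symm w).2 + u (σ.symm w).1)
  source := {z | z ∈ Ω ∧ (Ψ.symm (z - q)).1 ∈ s}
  target := {w | (σ.symm w).1 ∈ s ∧ q + Ψ ((σ.symm w).1, (σ.symm w).2 + u (σ.symm w).1) ∈ Ω}
  map_source' z hz := by
    simp only [ContinuousLinearEquiv.symm_apply_apply, sub_add_cancel, Prod.mk.eta,
      ContinuousLinearEquiv.apply_symm_apply, add_sub_cancel, mem_ofPred_eq]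
    exact ⟨hz.2, hz.1⟩
  map_target' w hw := by
    simp only [add_sub_cancel_left, ContinuousLinearEquiv.symm_apply_apply, mem_ofPred_eq]
    exact ⟨hw.2, hw.1⟩
  left_inv' z _ := by
    simp only [ContinuousLinearEquiv.symm_apply_apply, sub_add_cancel, Prod.mk.eta,
      ContinuousLinearEquiv.apply_symm_apply, add_sub_cancel]
  right_inv' w _ := by simp
  open_source := hΩ.inter (hs.preimage (by fun_prop))
  open_target := by
    have h1 : IsOpen {w : E | (σ.symm w).1 ∈ s} := hs.preimage (by fun_prop)
    have h2 : ContinuousOn (fun w : E => u (σ.symm w).1) {w : E | (σ.symm w).1 ∈ s} :=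
      hu.comp (Continuous.continuousOn (by fun_prop)) fun _ h => h
    exact ContinuousOn.isOpen_inter_preimage (continuousOn_const.add
      (Ψ.continuous.comp_continuousOn (ContinuousOn.prodMk (Continuous.continuousOn (by fun_prop))
        (ContinuousOn.add (Continuous.continuousOn (by fun_prop)) h2)))) h1 hΩ
  continuousOn_toFun := by
    have h2 : ContinuousOn (fun z : E => u (Ψ.symm (z - q)).1)
        {z | z ∈ Ω ∧ (Ψ.symm (z - q)).1 ∈ s} :=
      hu.comp (Continuous.continuousOn (by fun_prop)) fun _ h => h.2
    exact σ.continuous.comp_continuousOn (ContinuousOn.prodMk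
      (Continuous.continuousOn (by fun_prop))
      (ContinuousOn.sub (Continuous.continuousOn (by fun_prop)) h2))
  continuousOn_invFun := by
    have h2 : ContinuousOn (fun w : E => u (σ.symm w).1)
        {w | (σ.symm w).1 ∈ s ∧ q + Ψ ((σ.symm w).1, (σ.symm w).2 + u (σ.symm w).1) ∈ Ω} :=
      hu.comp (Continuous.continuousOn (by fun_prop)) fun _ h => h.1
    exact continuousOn_const.add
      (Ψ.continuous.comp_continuousOn (ContinuousOn.prodMk (Continuous.continuousOn (by fun_prop))
        (ContinuousOn.add (Continuous.continuousOn (by fun_prop)) h2)))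

variable {σ Ψ : (F × ℝ) ≃L[ℝ] E} {q : E} {Ω : Set E} {hΩ : IsOpen Ω} {s : Set F} {hs : IsOpen s}
  {u : F → ℝ} (hu : ContDiffOn ℝ ∞ u s)

lemma contDiffOn_straighten :
    ContDiffOn ℝ ∞ (straighten σ Ψ q hΩ hs hu.continuousOn)
      (straighten σ Ψ q hΩ hs hu.continuousOn).source := by
  have h2 : ContDiffOn ℝ ∞ (fun z : E => u (Ψ.symm (z - q)).1)
      {z | z ∈ Ω ∧ (Ψ.symm (z - q)).1 ∈ s} :=
    hu.comp (ContDiff.contDiffOn (by fun_prop)) fun _ h => h.2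
  exact σ.contDiff.comp_contDiffOn (ContDiffOn.prodMk (ContDiff.contDiffOn (by fun_prop))
    (ContDiffOn.sub (ContDiff.contDiffOn (by fun_prop)) h2))

lemma contDiffOn_straighten_symm :
    ContDiffOn ℝ ∞ (straighten σ Ψ q hΩ hs hu.continuousOn).symm
      (straighten σ Ψ q hΩ hs hu.continuousOn).target := by
  have h2 : ContDiffOn ℝ ∞ (fun w : E => u (σ.symm w).1)
      {w | (σ.symm w).1 ∈ s ∧ q + Ψ ((σ.symm w).1, (σ.symm w).2 + u (σ.symm w).1) ∈ Ω} :=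
    hu.comp (ContDiff.contDiffOn (by fun_prop)) fun _ h => h.1
  exact contDiffOn_const.add (Ψ.contDiff.comp_contDiffOn (ContDiffOn.prodMk
    (ContDiff.contDiffOn (by fun_prop))
    (ContDiffOn.add (ContDiff.contDiffOn (by fun_prop)) h2)))

include hs in
lemma hasFDerivAt_straighten_symm {a : F} (ha : a ∈ s) :
    HasFDerivAt (straighten σ Ψ q hΩ hs hu.continuousOn).symm
      ((Ψ : F × ℝ →L[ℝ] E).comp ((((ContinuousLinearMap.fst ℝ F ℝ).prod
        (ContinuousLinearMap.snd ℝ F ℝ + (fderiv ℝ u a).comp (ContinuousLinearMap.fst ℝ F ℝ)))).comp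
          (σ.symm : E →L[ℝ] F × ℝ))) (σ (a, 0)) := by
  have hσ : HasFDerivAt σ.symm (σ.symm : E →L[ℝ] F × ℝ) (σ (a, 0)) := σ.symm.hasFDerivAt
  have h1 : HasFDerivAt u (fderiv ℝ u a) (σ.symm (σ (a, 0))).1 := by
    rw [σ.symm_apply_apply]
    exact ((hu.contDiffAt (hs.mem_nhds ha)).differentiableAt (by simp)).hasFDerivAt
  exact ((Ψ : F × ℝ →L[ℝ] E).hasFDerivAt.comp _
    (hσ.fst.prodMk (hσ.snd.add (HasFDerivAt.comp (f := fun x => (σ.symm x).1) _ h1 hσ.fst)))).const_add q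

end Straightening

lemma IsKillingSystem.mono {E V : Type*} [NormedAddCommGroup E] [NormedSpace ℝ E]
    [NormedAddCommGroup V] [NormedSpace ℝ V] {Ω Ω' : Set E} {g : E → E →L[ℝ] E →L[ℝ] ℝ}
    {k : E → V →L[ℝ] E} (S : IsKillingSystem Ω g k) (h : Ω' ⊆ Ω) (hO : IsOpen Ω') :
    IsKillingSystem Ω' g k where
  isOpen := hO
  smooth_metric := S.smooth_metric.mono h
  smooth_field := S.smooth_field.mono h
  symm z hz := S.symm z (h hz)
  nondeg z hz := S.nondeg z (h hz)
  null z hz := S.null z (h hz)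
  killing z hz := S.killing z (h hz)
  comm z hz := S.comm z (h hz)
  orth z hz := S.orth z (h hz)

section Adapted

open LorentzGeom

universe u

/-- A fixed identification of `ℝⁿ × ℝ` with `ℝⁿ⁺¹`. -/
noncomputable def split (n : ℕ) : (Model n × ℝ) ≃L[ℝ] Model (n + 1) :=
  ContinuousLinearEquiv.ofFinrankEq (by simp)

variable {n r : ℕ} {M : Type u} [TopologicalSpace M] [ChartedSpace (Model (n + 1)) M]
  [IsManifold (𝓡 (n + 1)) ∞ M] {g : LorentzianMetric n M}
  {K : Fin (r + 1) → ∀ x : M, TangentSpace (𝓡 (n + 1)) x} {c : Fin (r + 1) → ℝ}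
  {l : ∀ x : M, TangentSpace (𝓡 (n + 1)) x} {A : Set M}

variable (g l) in
/-- A continuously differentiable map whose derivative takes values in the orthogonal complement
of `l`. -/
def IsOrthogonalOn (F : Type*) [NormedAddCommGroup F] [NormedSpace ℝ F] {N : Type*}
    [TopologicalSpace N] [ChartedSpace F N] (f : N → M) (O : Set N) : Prop :=
  ContMDiffOn 𝓘(ℝ, F) (𝓡 (n + 1)) 1 f O ∧ ∀ y ∈ O, ∀ v : TangentSpace 𝓘(ℝ, F) y,
    g.val (f y) (l (f y)) (mfderiv 𝓘(ℝ, F) (𝓡 (n + 1)) f y v) = 0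

/-- Maps orthogonal to `l` may be precomposed with arbitrary maps; this reduces statements about
them to statements about curves. -/
lemma IsOrthogonalOn.comp {F F' : Type*} [NormedAddCommGroup F] [NormedSpace ℝ F] {N : Type*}
    [TopologicalSpace N] [ChartedSpace F N] [NormedAddCommGroup F'] [NormedSpace ℝ F'] {N' : Type*}
    [TopologicalSpace N'] [ChartedSpace F' N'] {f : N → M} {O : Set N} {f' : N' → N} {O' : Set N'}
    (h : IsOrthogonalOn g l F f O) (hO : IsOpen O) (h' : ContMDiffOn 𝓘(ℝ, F') 𝓘(ℝ, F) 1 f' O')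
    (hO' : IsOpen O') (hm : MapsTo f' O' O) : IsOrthogonalOn g l F' (f ∘ f') O' := by
  refine ⟨h.1.comp h' hm, fun y hy v => ?_⟩
  have h1 := (h.1.contMDiffAt (hO.mem_nhds (hm hy))).mdifferentiableAt one_ne_zero
  have h2 := (h'.contMDiffAt (hO'.mem_nhds hy)).mdifferentiableAt one_ne_zero
  rw [mfderiv_comp y h1 h2]
  exact h.2 _ (hm hy) _

variable (g l A) in
/-- A chart of `M`, into `ℝⁿ⁺¹ = ℝⁿ × ℝ`, whose slice `ℝⁿ × {0}` is a ball contained in `A` and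
tangent to the orthogonal complement of `l`, and which captures every curve orthogonal to `l` in
the domain of the chart that meets the slice. -/
structure IsAdaptedChart (e : OpenPartialHomeomorph M (Model (n + 1))) : Prop where
  mem_maximalAtlas : e ∈ IsManifold.maximalAtlas (𝓡 (n + 1)) ∞ M
  exists_ball : ∃ ρ : ℝ, ∀ a, split n (a, 0) ∈ e.target ↔ a ∈ Metric.ball 0 ρ
  mem : ∀ a, split n (a, 0) ∈ e.target → e.symm (split n (a, 0)) ∈ A
  tangent : ∀ a, split n (a, 0) ∈ e.target → ∀ w : Model (n + 1),
    g.val (e.symm (split n (a, 0))) (l (e.symm (split n (a, 0))))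
      (mfderiv (𝓡 (n + 1)) (𝓡 (n + 1)) e.symm (split n (a, 0)) w) = 0 ↔ ((split n).symm w).2 = 0
  unique : ∀ (γ : ℝ → M) (J : Set ℝ), IsOpen J → IsPreconnected J → IsOrthogonalOn g l ℝ γ J →
    MapsTo γ J e.source → ∀ t₀ ∈ J, ((split n).symm (e (γ t₀))).2 = 0 →
      ∀ t ∈ J, ((split n).symm (e (γ t))).2 = 0

/-- The one-form `g(l, ·)` in coordinates. -/
lemma coordMetric_coordFrame {x₀ : M} {z : Model (n + 1)}
    (hz : z ∈ (extChartAt (𝓡 (n + 1)) x₀).target) (w : Model (n + 1)) :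
    coordMetric g x₀ z (coordFrame K x₀ z c) w =
      g.val ((extChartAt (𝓡 (n + 1)) x₀).symm z)
        (combination K c ((extChartAt (𝓡 (n + 1)) x₀).symm z)) (chartDeriv x₀ z w) := by
  rw [← chartDeriv_coordFrame K hz]; rfl

lemma coordMetric_coordFrame_mfderiv {x₀ y : M} (hy : y ∈ (chartAt (Model (n + 1)) x₀).source)
    (v : TangentSpace (𝓡 (n + 1)) y) :
    coordMetric g x₀ (extChartAt (𝓡 (n + 1)) x₀ y)
      (coordFrame K x₀ (extChartAt (𝓡 (n + 1)) x₀ y) c)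
      (mfderiv (𝓡 (n + 1)) 𝓘(ℝ, Model (n + 1)) (extChartAt (𝓡 (n + 1)) x₀) y v) =
    g.val y (combination K c y) v := by
  rw [← extChartAt_source (𝓡 (n + 1))] at hy
  obtain ⟨z, hz, rfl⟩ : ∃ z ∈ (extChartAt (𝓡 (n + 1)) x₀).target,
    (extChartAt (𝓡 (n + 1)) x₀).symm z = y := ⟨_, (extChartAt (𝓡 (n + 1)) x₀).map_source hy,
      (extChartAt (𝓡 (n + 1)) x₀).left_inv hy⟩
  rw [(extChartAt (𝓡 (n + 1)) x₀).right_inv hz]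
  exact (coordMetric_coordFrame hz _).trans (congrArg (g.val _ _) (chartDeriv_mfderiv hz v))

/-- The set of regular points of the system in a chart is the coordinate image of the set of
regular points in the manifold. -/
lemma mem_regularSet_iff {x₀ : M} {Ω : Set (Model (n + 1))}
    (hΩ : Ω ⊆ (extChartAt (𝓡 (n + 1)) x₀).target) {z : Model (n + 1)} :
    z ∈ regularSet Ω (coordMetric g x₀) (coordFrame K x₀) c ↔
      z ∈ Ω ∧ (extChartAt (𝓡 (n + 1)) x₀).symm z ∈ regularPoints g K c := by
  refine and_congr_right fun hz => ?_
  refine and_congr (coordFrame_injective_iff K (hΩ hz)) ?_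
  have h : ∀ b, coordMetric g x₀ z (coordFrame K x₀ z b) (coordFrame K x₀ z c) =
      g.pair (combination K b) (combination K c) ((extChartAt (𝓡 (n + 1)) x₀).symm z) := fun b => by
    rw [coordMetric_coordFrame (hΩ hz), chartDeriv_coordFrame K (hΩ hz)]; rfl
  simp only [h, pair_combination_left]
  refine ⟨fun h μ => ?_, fun h b => Finset.sum_eq_zero fun μ _ => by rw [h μ, mul_zero]⟩
  simpa [Pi.single_apply] using h (Pi.single μ 1)

/-- Linear coordinates of which the last one is a given non-zero functional. -/
lemma exists_equiv_of_ne_zero {E F : Type*} [NormedAddCommGroup E] [NormedSpace ℝ E]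
    [NormedAddCommGroup F] [NormedSpace ℝ F] [FiniteDimensional ℝ E] [FiniteDimensional ℝ F]
    (h : Module.finrank ℝ E = Module.finrank ℝ F + 1) {θ : E →L[ℝ] ℝ} (hθ : θ ≠ 0) :
    ∃ Ψ : (F × ℝ) ≃L[ℝ] E, ∀ x s, θ (Ψ (x, s)) = s := by
  obtain ⟨e, he⟩ : ∃ e, θ e = 1 := by
    obtain ⟨v, hv⟩ := DFunLike.ne_iff.1 hθ
    exact ⟨(θ v)⁻¹ • v, by rw [map_smul, smul_eq_mul, inv_mul_cancel₀ hv]⟩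
  let R : ℝ →L[ℝ] E := (1 : ℝ →L[ℝ] ℝ).smulRight e
  have hR : Function.RightInverse R θ := fun s => by simp [R, he]
  let B := ContinuousLinearEquiv.equivOfRightInverse θ R hR
  have h1 := Module.Dual.finrank_ker_add_one_of_ne_zero
    (f := θ.toLinearMap) (fun h0 => hθ (ContinuousLinearMap.coe_inj.1 h0))
  have h2 : Module.finrank ℝ F = Module.finrank ℝ (LinearMap.ker θ.toLinearMap) := by omega
  let C : F ≃L[ℝ] LinearMap.ker θ.toLinearMap := ContinuousLinearEquiv.ofFinrankEq h2
  refine ⟨((ContinuousLinearEquiv.prodComm ℝ F ℝ).trans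
    ((ContinuousLinearEquiv.refl ℝ ℝ).prodCongr C)).trans B.symm, fun x s => ?_⟩
  have h3 : B.symm (s, C x) = R s + (C x : E) :=
    ContinuousLinearEquiv.equivOfRightInverse_symm_apply θ R hR (s, C x)
  have h4 : θ (C x : E) = 0 := (C x).2
  show θ (B.symm (s, C x)) = s
  rw [h3, map_add, h4, hR s, add_zero]

/-- The coordinate expression of a curve orthogonal to `l`. -/
lemma IsOrthogonalOn.hasDerivAt_chart {γ : ℝ → M} {J : Set ℝ}
    (h : IsOrthogonalOn g (combination K c) ℝ γ J) (hJ : IsOpen J) {x₀ : M}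
    (hs : MapsTo γ J (chartAt (Model (n + 1)) x₀).source) :
    ContDiffOn ℝ 1 (fun t => extChartAt (𝓡 (n + 1)) x₀ (γ t)) J ∧ ∀ t ∈ J,
      coordMetric g x₀ (extChartAt (𝓡 (n + 1)) x₀ (γ t))
        (coordFrame K x₀ (extChartAt (𝓡 (n + 1)) x₀ (γ t)) c)
        (deriv (fun t => extChartAt (𝓡 (n + 1)) x₀ (γ t)) t) = 0 := by
  have h1 : ContMDiffOn (𝓡 (n + 1)) 𝓘(ℝ, Model (n + 1)) 1 (extChartAt (𝓡 (n + 1)) x₀)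
      (chartAt (Model (n + 1)) x₀).source :=
    (contMDiffOn_extChartAt (I := 𝓡 (n + 1)) (n := ∞) (x := x₀)).of_le (by simp)
  refine ⟨contMDiffOn_iff_contDiffOn.1 (h1.comp h.1 hs), fun t ht => ?_⟩
  have h2 := (h1.contMDiffAt ((chartAt (Model (n + 1)) x₀).open_source.mem_nhds
    (hs ht))).mdifferentiableAt one_ne_zero
  have h3 := (h.1.contMDiffAt (hJ.mem_nhds ht)).mdifferentiableAt one_ne_zero
  have h4 := h.2 t ht (1 : ℝ)
  rw [← coordMetric_coordFrame_mfderiv (hs ht)] at h4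
  rw [← h4]
  congr 1
  have h5 : mfderiv 𝓘(ℝ, ℝ) 𝓘(ℝ, Model (n + 1))
      (fun t => extChartAt (𝓡 (n + 1)) x₀ (γ t)) t = _ := mfderiv_comp t h2 h3
  rw [mfderiv_eq_fderiv] at h5
  rw [← fderiv_apply_one_eq_deriv]
  exact DFunLike.congr_fun h5 (1 : ℝ)

/-- Through every limit of regular points which is not a zero of the generator there is an
adapted chart. -/
lemma exists_isAdaptedChart [T2Space M] (hKilling : ∀ μ, g.IsKilling (K μ))
    (hComm : ∀ μ ν, ∀ x : M, VectorField.mlieBracket (𝓡 (n + 1)) (K μ) (K ν) x = 0)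
    (hInt : g.OrthogonallyIntegrable K) {q : M} (hq : q ∈ closure (regularPoints g K c))
    (hl : combination K c q ≠ 0) :
    ∃ e, IsAdaptedChart g (combination K c)
      (closure (regularPoints g K c) \ {x | combination K c x = 0}) e ∧
        q ∈ e.source ∧ ((split n).symm (e q)).2 = 0 := by
  set φ := extChartAt (𝓡 (n + 1)) q with hφ
  set θ : Model (n + 1) → Model (n + 1) →L[ℝ] ℝ :=
    fun z => coordMetric g q z (coordFrame K q z c) with hθdef
  have S := isKillingSystem_chart hKilling hComm hInt q
  have hφq : φ q ∈ φ.target := mem_extChartAt_target q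
  have hφφ : φ.symm (φ q) = q := extChartAt_to_inv q
  have hθ0 : θ (φ q) ≠ 0 := fun h0 => by
    have h1 := coordMetric_nondeg hφq (u := coordFrame K q (φ q) c)
      (fun v => DFunLike.congr_fun h0 v)
    have h2 := chartDeriv_coordFrame K hφq c
    rw [h1, map_zero] at h2
    refine hl ?_
    rw [← hφφ]
    exact h2.symm
  obtain ⟨Ψ, hΨ⟩ := exists_equiv_of_ne_zero (F := Model n) (by simp) hθ0
  have hθs : ContDiffOn ℝ ∞ θ φ.target := S.contDiffOn_form c
  set Ω : Set (Model (n + 1)) := φ.target ∩ (fun z => θ z (Ψ (0, 1))) ⁻¹' {0}ᶜ with hΩdef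
  have hΩ : IsOpen Ω := (hθs.continuousOn.clm_apply continuousOn_const).isOpen_inter_preimage
    S.isOpen isOpen_compl_singleton
  have he : ∀ z ∈ Ω, θ z (Ψ (0, 1)) ≠ 0 := fun z hz => hz.2
  have hqΩ : φ q ∈ Ω := ⟨hφq, by
    simp only [mem_preimage, hΨ, mem_compl_iff, mem_singleton_iff, one_ne_zero, not_false_iff]⟩
  -- the system is restricted to the region `Ω` in which `Ψ (0, 1)` is transversal to the distribution
  have hqc : φ q ∈ closure (regularSet Ω (coordMetric g q) (coordFrame K q) c) := by
    have h1 : q ∈ closure (regularPoints g K c ∩ φ.source ∩ φ ⁻¹' Ω) := by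
      have h2 : φ.source ∩ φ ⁻¹' Ω ∈ 𝓝 q := Filter.inter_mem (extChartAt_source_mem_nhds q)
        ((continuousAt_extChartAt q).preimage_mem_nhds (hΩ.mem_nhds hqΩ))
      rw [mem_closure_iff_frequently] at hq ⊢
      exact (hq.and_eventually h2).mono fun x hx => ⟨⟨hx.1, hx.2.1⟩, hx.2.2⟩
    refine ((continuousAt_extChartAt q).continuousWithinAt).mem_closure h1 fun x hx => ?_
    rw [mem_regularSet_iff inter_subset_left]
    exact ⟨hx.2, by rw [φ.left_inv hx.1.2]; exact hx.1.1⟩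
  obtain ⟨ρ, hρ, u, hu, hu0, hleaf⟩ := (S.mono inter_subset_left hΩ).exists_leaf Ψ he hqΩ hqc
    fun x => hΨ x 0
  -- the adapted chart is the chart at `q` followed by the flattening of the integral graph
  set T := straighten (split n) Ψ (φ q) hΩ Metric.isOpen_ball hu.continuousOn with hT
  set e := (chartAt (Model (n + 1)) q).trans T with he_def
  have hTs : ∀ y, T y = split n ((Ψ.symm (y - φ q)).1,
    (Ψ.symm (y - φ q)).2 - u (Ψ.symm (y - φ q)).1) := fun y => rfl
  have hT1 : ContDiffOn ℝ ∞ T T.source := contDiffOn_straighten hu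
  have hT2 : ContDiffOn ℝ ∞ T.symm T.target := contDiffOn_straighten_symm hu
  have hTsymm : ∀ a, T.symm (split n (a, 0)) = φ q + Ψ (a, u a) := fun a => by
    show φ q + Ψ (((split n).symm (split n (a, 0))).1, ((split n).symm (split n (a, 0))).2 +
      u ((split n).symm (split n (a, 0))).1) = _
    rw [ContinuousLinearEquiv.symm_apply_apply, zero_add]
  have hesrc : ∀ y, y ∈ e.source ↔ y ∈ (chartAt (Model (n + 1)) q).source ∧ φ y ∈ Ω ∧
      (Ψ.symm (φ y - φ q)).1 ∈ Metric.ball 0 ρ := fun y => by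
    rw [he_def, OpenPartialHomeomorph.trans_source]; rfl
  have hetgt : ∀ w, w ∈ e.target ↔ w ∈ T.target := fun w => by
    rw [he_def, OpenPartialHomeomorph.trans_target]
    refine ⟨fun h => h.1, fun h => ⟨h, ?_⟩⟩
    have h1 : T.symm w ∈ φ.target := (T.map_target h).1.1
    rwa [hφ, extChartAt_target, (𝓡 (n + 1)).range_eq_univ, inter_univ] at h1
  have hslice : ∀ a, split n (a, 0) ∈ e.target ↔ a ∈ Metric.ball 0 ρ := fun a => by
    rw [hetgt]
    have h1 : split n (a, 0) ∈ T.target ↔ ((split n).symm (split n (a, 0))).1 ∈ Metric.ball 0 ρ ∧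
      T.symm (split n (a, 0)) ∈ Ω := Iff.rfl
    rw [h1, hTsymm, ContinuousLinearEquiv.symm_apply_apply]
    exact ⟨fun h => h.1, fun h => ⟨h, (hleaf a h).1.1⟩⟩
  have hesymm : ∀ w, e.symm w = φ.symm (T.symm w) := fun w => rfl
  have hcl : ∀ z ∈ Ω, z ∈ closure (regularSet Ω (coordMetric g q) (coordFrame K q) c) →
      φ.symm z ∈ closure (regularPoints g K c) := fun z hz hzc => by
    refine (contMDiffAt_chart_symm hz.1).continuousAt.continuousWithinAt.mem_closure hzc
      fun x hx => ?_
    exact ((mem_regularSet_iff inter_subset_left).1 hx).2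
  have hmax : e ∈ IsManifold.maximalAtlas (𝓡 (n + 1)) ∞ M := by
    have h1 := (contMDiffOn_of_mem_maximalAtlas
      (IsManifold.chart_mem_maximalAtlas (I := 𝓡 (n + 1)) (n := ∞) q))
    have h2 := contMDiffOn_symm_of_mem_maximalAtlas
      (IsManifold.chart_mem_maximalAtlas (I := 𝓡 (n + 1)) (n := ∞) q)
    refine OpenPartialHomeomorph.mem_maximalAtlas_of_contMDiffOn _ ?_ ?_
    · exact (contMDiffOn_iff_contDiffOn.2 hT1).comp
        (h1.mono fun x hx => ((hesrc x).1 hx).1) fun x hx => ((hesrc x).1 hx).2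
    · refine h2.comp ((contMDiffOn_iff_contDiffOn.2 hT2).mono
        fun w hw => (hetgt w).1 hw) fun w hw => ?_
      have h1 := hw.2
      exact h1
  refine ⟨e, ⟨hmax, ⟨ρ, hslice⟩, fun a ha => ?_, fun a ha w => ?_, ?_⟩, ?_, ?_⟩
  · obtain ⟨⟨h1, h2⟩, -⟩ := hleaf a ((hslice a).1 ha)
    rw [hesymm, hTsymm]
    refine ⟨hcl _ h1 h2, fun h0 => he _ h1 ?_⟩
    have h3 : combination K c (φ.symm (φ q + Ψ (a, u a))) = 0 := h0
    show coordMetric g q _ (coordFrame K q _ c) _ = 0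
    rw [coordMetric_coordFrame h1.1, h3, map_zero]; rfl
  · have ha' := (hslice a).1 ha
    obtain ⟨⟨h1, h2⟩, h3⟩ := hleaf a ha'
    have h4 := hasFDerivAt_straighten_symm (σ := split n) (Ψ := Ψ) (q := φ q) (hΩ := hΩ)
      (hs := Metric.isOpen_ball) hu ha'
    have h5 : MDifferentiableAt 𝓘(ℝ, Model (n + 1)) (𝓡 (n + 1)) φ.symm
        (T.symm (split n (a, 0))) := by
      rw [hTsymm]; exact mdifferentiableAt_chart_symm h1.1
    have h6 : mfderiv (𝓡 (n + 1)) (𝓡 (n + 1)) e.symm (split n (a, 0)) = _ :=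
      mfderiv_comp (f := T.symm) (split n (a, 0)) h5 h4.differentiableAt.mdifferentiableAt
    obtain ⟨⟨h, s⟩, rfl⟩ := (split n).surjective w
    have h7 : coordMetric g q (T.symm (split n (a, 0)))
        (coordFrame K q (T.symm (split n (a, 0))) c) (Ψ (h, s + fderiv ℝ u a h)) =
        s * θ (φ q + Ψ (a, u a)) (Ψ (0, 1)) := by
      rw [hTsymm]
      have h8 : Ψ (h, s + fderiv ℝ u a h) = Ψ (h, fderiv ℝ u a h) + s • Ψ (0, 1) := by
        rw [← map_smul, ← map_add]
        simp [add_comm]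
      rw [h8, map_add, map_smul, h3 h, zero_add, smul_eq_mul]
    have h9 : g.val (e.symm (split n (a, 0))) (combination K c (e.symm (split n (a, 0))))
      (mfderiv (𝓡 (n + 1)) (𝓡 (n + 1)) e.symm (split n (a, 0)) (split n (h, s))) =
        s * θ (φ q + Ψ (a, u a)) (Ψ (0, 1)) := by
      rw [← h7, coordMetric_coordFrame (by rw [hTsymm]; exact h1.1), h6]
      have h10 : fderiv ℝ T.symm (split n (a, 0)) (split n (h, s)) =
          Ψ (h, s + fderiv ℝ u a h) := by
        rw [h4.fderiv]
        simp
      rw [← h10, ← mfderiv_eq_fderiv]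
      rfl
    rw [h9, mul_eq_zero, or_iff_left (he _ h1), ContinuousLinearEquiv.symm_apply_apply]
  · intro γ J hJ hJ' hγ hm t₀ ht₀ h0 t ht
    have hm' : ∀ t ∈ J, _ := fun t ht => (hesrc _).1 (hm ht)
    obtain ⟨h1, h2⟩ := hγ.hasDerivAt_chart hJ (x₀ := q) fun t ht => (hm' t ht).1
    have he2 : ∀ t, ((split n).symm (e (γ t))).2 = (Ψ.symm (φ (γ t) - φ q)).2 -
        u (Ψ.symm (φ (γ t) - φ q)).1 := fun t => by
      show ((split n).symm (T (φ (γ t)))).2 = _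
      rw [hTs, ContinuousLinearEquiv.symm_apply_apply]
    rw [he2, sub_eq_zero] at h0 ⊢
    exact curve_mem_graph hΩ (hθs.mono inter_subset_left) he Metric.isOpen_ball hu
      (fun x hx => (hleaf x hx).1.1) (fun x hx => (hleaf x hx).2) hJ hJ'
      (fun t ht => ((h1.contDiffAt (hJ.mem_nhds ht)).differentiableAt one_ne_zero).hasDerivAt)
      (h1.continuousOn_deriv_of_isOpen hJ le_rfl) (fun t ht => (hm' t ht).2.1)
      (fun t ht => (hm' t ht).2.2) h2 ht₀ h0 t ht
  · rw [hesrc]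
    refine ⟨ChartedSpace.mem_chart_source q, hqΩ, ?_⟩
    simpa using hρ
  · show ((split n).symm (T (φ q))).2 = 0
    rw [hTs, ContinuousLinearEquiv.symm_apply_apply]
    simp [hu0]

end Adapted

/-! ### Leaves -/

section Leaves

open LorentzGeom

universe u

variable {n : ℕ} {M : Type u} [TopologicalSpace M]

/-- The part of the slice `ℝⁿ × {0}` in the domain of a chart. -/
def slice (e : OpenPartialHomeomorph M (Model (n + 1))) : Set M :=
  {y | y ∈ e.source ∧ ((split n).symm (e y)).2 = 0}

/-- The parametrization of the slice of a chart by `ℝⁿ`. -/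
noncomputable def sliceMap (e : OpenPartialHomeomorph M (Model (n + 1))) (a : Model n) : M :=
  e.symm (split n (a, 0))

variable {e e' : OpenPartialHomeomorph M (Model (n + 1))}

lemma sliceMap_mem {a : Model n} (ha : split n (a, 0) ∈ e.target) : sliceMap e a ∈ slice e := by
  refine ⟨e.map_target ha, ?_⟩
  rw [sliceMap, e.right_inv ha, ContinuousLinearEquiv.symm_apply_apply]

lemma split_coord {y : M} (hy : y ∈ slice e) :
    split n (((split n).symm (e y)).1, 0) = e y := by
  rw [← hy.2, Prod.mk.eta, ContinuousLinearEquiv.apply_symm_apply]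

lemma sliceMap_coord {y : M} (hy : y ∈ slice e) : sliceMap e ((split n).symm (e y)).1 = y := by
  rw [sliceMap, split_coord hy, e.left_inv hy.1]

lemma coord_sliceMap {a : Model n} (ha : split n (a, 0) ∈ e.target) :
    ((split n).symm (e (sliceMap e a))).1 = a := by
  rw [sliceMap, e.right_inv ha, ContinuousLinearEquiv.symm_apply_apply]

lemma isOpen_slice_target : IsOpen {a : Model n | split n (a, 0) ∈ e.target} :=
  e.open_target.preimage (by fun_prop)

variable [ChartedSpace (Model (n + 1)) M]

lemma contMDiffOn_sliceMap (he : e ∈ IsManifold.maximalAtlas (𝓡 (n + 1)) ∞ M) :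
    ContMDiffOn (𝓡 n) (𝓡 (n + 1)) ∞ (sliceMap e) {a | split n (a, 0) ∈ e.target} :=
  (contMDiffOn_symm_of_mem_maximalAtlas he).comp
    (ContDiff.contMDiff (by fun_prop)).contMDiffOn fun _ ha => ha

lemma mfderiv_sliceMap (he : e ∈ IsManifold.maximalAtlas (𝓡 (n + 1)) ∞ M) {a : Model n}
    (ha : split n (a, 0) ∈ e.target) (v : Model n) :
    mfderiv (𝓡 n) (𝓡 (n + 1)) (sliceMap e) a v =
      mfderiv (𝓡 (n + 1)) (𝓡 (n + 1)) e.symm (split n (a, 0)) (split n (v, 0)) := by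
  have h1 := ((contMDiffAt_symm_of_mem_maximalAtlas he ha)).mdifferentiableAt
    (show (∞ : WithTop ℕ∞) ≠ 0 by simp)
  have h2 : HasFDerivAt (fun a : Model n => split n (a, (0 : ℝ)))
      ((split n : Model n × ℝ →L[ℝ] Model (n + 1)).comp (ContinuousLinearMap.inl ℝ (Model n) ℝ)) a :=
    ((split n : Model n × ℝ →L[ℝ] Model (n + 1)).comp
      (ContinuousLinearMap.inl ℝ (Model n) ℝ)).hasFDerivAt
  have h3 : mfderiv (𝓡 n) (𝓡 (n + 1)) (sliceMap e) a = _ :=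
    mfderiv_comp (f := fun a : Model n => split n (a, (0 : ℝ))) a h1
      h2.differentiableAt.mdifferentiableAt
  have h4 : fderiv ℝ (fun a : Model n => split n (a, (0 : ℝ))) a v = split n (v, 0) := by
    rw [h2.fderiv]; rfl
  rw [h3, ← h4, ← mfderiv_eq_fderiv]
  rfl

variable [IsManifold (𝓡 (n + 1)) ∞ M] {g : LorentzianMetric n M}
  {l : ∀ x : M, TangentSpace (𝓡 (n + 1)) x} {A C : Set M}

lemma IsAdaptedChart.slice_subset (h : IsAdaptedChart g l A e) : slice e ⊆ A := fun y hy => by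
  have h1 := h.mem ((split n).symm (e y)).1 (by rw [split_coord hy]; exact e.map_source hy.1)
  rwa [split_coord hy, e.left_inv hy.1] at h1

lemma IsAdaptedChart.isOrthogonalOn_sliceMap (h : IsAdaptedChart g l A e) :
    IsOrthogonalOn g l (Model n) (sliceMap e) {a | split n (a, 0) ∈ e.target} := by
  refine ⟨(contMDiffOn_sliceMap h.mem_maximalAtlas).of_le (by simp), fun a ha v => ?_⟩
  refine (congrArg (g.val _ _) (mfderiv_sliceMap h.mem_maximalAtlas ha v)).trans ?_
  refine (h.tangent a ha _).2 ?_
  rw [ContinuousLinearEquiv.symm_apply_apply]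

/-- A map orthogonal to `l` which meets the slice of an adapted chart stays in it locally: it does
so along radial curves. -/
lemma IsAdaptedChart.eventually_mem_slice (h : IsAdaptedChart g l A e) {F : Type*}
    [NormedAddCommGroup F] [NormedSpace ℝ F] {N : Type*} [TopologicalSpace N] [ChartedSpace F N]
    [IsManifold 𝓘(ℝ, F) 1 N] {f : N → M} {O : Set N} (hf : IsOrthogonalOn g l F f O)
    (hO : IsOpen O) {x : N} (hx : x ∈ O) (hfx : f x ∈ slice e) : ∀ᶠ y in 𝓝 x, f y ∈ slice e := by
  set φ := extChartAt 𝓘(ℝ, F) x with hφ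
  have hφx : φ.symm (φ x) = x := extChartAt_to_inv x
  have hsc : ContinuousAt φ.symm (φ x) := continuousAt_extChartAt_symm x
  have hfc : ContinuousAt f x := (hf.1.contMDiffAt (hO.mem_nhds hx)).continuousAt
  have h1 : ∀ᶠ z in 𝓝 (φ x), z ∈ φ.target ∧ φ.symm z ∈ O ∧ f (φ.symm z) ∈ e.source := by
    have h2 : ∀ᶠ z in 𝓝 (φ x), z ∈ φ.target := extChartAt_target_mem_nhds x
    have h3 : ∀ᶠ z in 𝓝 (φ x), φ.symm z ∈ O :=
      hsc.preimage_mem_nhds (by rw [hφx]; exact hO.mem_nhds hx)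
    have h4 : ∀ᶠ z in 𝓝 (φ x), φ.symm z ∈ f ⁻¹' e.source := hsc.preimage_mem_nhds
      (by rw [hφx]; exact hfc.preimage_mem_nhds (e.open_source.mem_nhds hfx.1))
    exact h2.and (h3.and h4)
  obtain ⟨ε, hε, hball⟩ := Metric.eventually_nhds_iff_ball.1 h1
  filter_upwards [extChartAt_source_mem_nhds (I := 𝓘(ℝ, F)) x,
    (continuousAt_extChartAt (I := 𝓘(ℝ, F)) x).preimage_mem_nhds (Metric.ball_mem_nhds _ hε)]
    with y hy hyε
  set L : ℝ → F := fun t => φ x + t • (φ y - φ x) with hL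
  set J : Set ℝ := L ⁻¹' Metric.ball (φ x) ε with hJ
  have hJo : IsOpen J := Metric.isOpen_ball.preimage (by fun_prop)
  have hJc : IsPreconnected J := by
    have h2 : J = (AffineMap.lineMap (φ x) (φ y) : ℝ →ᵃ[ℝ] F) ⁻¹' Metric.ball (φ x) ε := by
      ext t
      simp only [hJ, hL, mem_preimage, AffineMap.lineMap_apply, vsub_eq_sub, vadd_eq_add, add_comm]
    rw [h2]
    exact ((convex_ball _ _).affine_preimage _).isPreconnected
  have hγ : IsOrthogonalOn g l ℝ (f ∘ (φ.symm ∘ L)) J := by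
    refine hf.comp hO ?_ hJo fun t ht => (hball _ ht).2.1
    refine (contMDiffOn_extChartAt_symm (I := 𝓘(ℝ, F)) (n := 1) x).comp
      (ContDiff.contMDiff (by fun_prop)).contMDiffOn fun t ht => (hball _ ht).1
  have hL0 : L 0 = φ x := by simp [hL]
  have hL1 : L 1 = φ y := by simp [hL]
  have hm : MapsTo (f ∘ (φ.symm ∘ L)) J e.source := fun t ht => (hball _ ht).2.2
  have hy' : f y = (f ∘ (φ.symm ∘ L)) 1 := by
    simp only [Function.comp_apply, hL1]
    rw [φ.left_inv hy]
  have h1J : (1 : ℝ) ∈ J := by rw [hJ, mem_preimage, hL1]; exact hyε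
  rw [hy']
  refine ⟨hm h1J, h.unique _ J hJo hJc hγ hm 0 ?_ ?_ 1 h1J⟩
  · rw [hJ, mem_preimage, hL0]; exact Metric.mem_ball_self hε
  · simp only [Function.comp_apply, hL0]
    rw [hφx]
    exact hfx.2

variable (g l A C) in
/-- A non-empty union of slices of adapted charts which contains every such slice that meets it. -/
structure IsLeafSet : Prop where
  nonempty : C.Nonempty
  exists_chart : ∀ x ∈ C, ∃ e, IsAdaptedChart g l A e ∧ x ∈ slice e
  slice_subset : ∀ e, IsAdaptedChart g l A e → (slice e ∩ C).Nonempty → slice e ⊆ C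

namespace IsLeafSet

variable (h : IsLeafSet g l A C)
include h

lemma subset : C ⊆ A := fun x hx => by
  obtain ⟨e, he, hxe⟩ := h.exists_chart x hx
  exact he.slice_subset hxe

/-- Along a connected domain on which `l` has no zero, a map orthogonal to `l` cannot leave a leaf
set. -/
lemma mapsTo (hA : ∀ x ∈ closure A, l x ≠ 0 → ∃ e, IsAdaptedChart g l A e ∧ x ∈ slice e)
    {F : Type*}
    [NormedAddCommGroup F] [NormedSpace ℝ F] {N : Type*} [TopologicalSpace N] [ChartedSpace F N]
    [IsManifold 𝓘(ℝ, F) 1 N] {f : N → M} {O : Set N} (hf : IsOrthogonalOn g l F f O)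
    (hO : IsOpen O) (hO' : IsPreconnected O) (hl : ∀ y ∈ O, l (f y) ≠ 0) {x : N} (hx : x ∈ O)
    (hfx : f x ∈ C) : MapsTo f O C := by
  -- the set of `y` with `f y ∈ C` is open and relatively closed in `O`
  have hsub : O ⊆ {y | y ∈ O ∧ f y ∈ C} := by
    refine hO'.subset_of_closure_inter_subset ?_ ⟨x, hx, hx, hfx⟩ ?_
    · rw [isOpen_iff_mem_nhds]
      rintro y ⟨hy, hfy⟩
      obtain ⟨e, he, hye⟩ := h.exists_chart _ hfy
      filter_upwards [hO.mem_nhds hy, he.eventually_mem_slice hf hO hy hye] with y' h1 h2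
      exact ⟨h1, h.slice_subset e he ⟨_, hye, hfy⟩ h2⟩
    · rintro y ⟨hy, hyO⟩
      refine ⟨hyO, ?_⟩
      have h1 : f y ∈ closure C :=
        (hf.1.contMDiffAt (hO.mem_nhds hyO)).continuousAt.continuousWithinAt.mem_closure hy
          fun z hz => hz.2
      obtain ⟨e, he, hye⟩ := hA _ (closure_mono h.subset h1) (hl y hyO)
      obtain ⟨z, hz, hzC⟩ := ((mem_closure_iff_frequently.1 hy).and_eventually
        (he.eventually_mem_slice hf hO hyO hye)).exists
      exact h.slice_subset e he ⟨_, hzC, hz.2⟩ hye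
  exact fun y hy => (hsub hy).2

end IsLeafSet

end Leaves

/-! ### The leaf as an immersed hypersurface -/

section LeafManifold

open LorentzGeom

universe u

variable {n : ℕ} {M : Type u} [TopologicalSpace M]

open Classical in
/-- The coordinates on the slice of a chart, as a chart of a set `C` containing the slice.  The
value of the inverse outside the target is irrelevant. -/
noncomputable def sliceChart {C : Set M} (x₀ : C) (e : OpenPartialHomeomorph M (Model (n + 1)))
    (he : slice e ⊆ C) : PartialEquiv C (Model n) where
  toFun y := ((split n).symm (e y)).1
  invFun a := if ha : split n (a, 0) ∈ e.target then ⟨sliceMap e a, he (sliceMap_mem ha)⟩ else x₀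
  source := {y | (y : M) ∈ slice e}
  target := {a | split n (a, 0) ∈ e.target}
  map_source' y hy := by
    rw [mem_ofPred_eq, split_coord hy]
    exact e.map_source hy.1
  map_target' a ha := by
    rw [dif_pos (show split n (a, 0) ∈ e.target from ha)]
    exact sliceMap_mem ha
  left_inv' y hy := by
    have h1 : split n (((split n).symm (e y)).1, 0) ∈ e.target := by
      rw [split_coord hy]; exact e.map_source hy.1
    rw [dif_pos h1]
    exact Subtype.ext (sliceMap_coord hy)
  right_inv' a ha := by
    rw [dif_pos (show split n (a, 0) ∈ e.target from ha)]
    exact coord_sliceMap ha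

lemma coe_sliceChart_symm {C : Set M} (x₀ : C) {e : OpenPartialHomeomorph M (Model (n + 1))}
    (he : slice e ⊆ C) {a : Model n} (ha : split n (a, 0) ∈ e.target) :
    ((sliceChart x₀ e he).symm a : M) = sliceMap e a := by
  show ((sliceChart x₀ e he).invFun a : M) = sliceMap e a
  simp only [sliceChart, dif_pos ha]

variable {C : Set M} {e e' : OpenPartialHomeomorph M (Model (n + 1))}

lemma mem_transition_source {x₀ : C} {he : slice e ⊆ C} {he' : slice e' ⊆ C} {a : Model n} :
    a ∈ ((sliceChart x₀ e he).symm.trans (sliceChart x₀ e' he')).source ↔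
      split n (a, 0) ∈ e.target ∧ sliceMap e a ∈ slice e' := by
  rw [PartialEquiv.trans_source]
  refine and_congr_right fun (ha : split n (a, 0) ∈ e.target) => ?_
  show (((sliceChart x₀ e he).symm a : C) : M) ∈ slice e' ↔ _
  rw [coe_sliceChart_symm x₀ he ha]

variable [ChartedSpace (Model (n + 1)) M]

lemma mfderiv_apply_congr {F : Type*} [NormedAddCommGroup F] [NormedSpace ℝ F] {N : Type*}
    [TopologicalSpace N] [ChartedSpace F N] {f f' : N → M} {x : N} (h : f =ᶠ[𝓝 x] f')
    (v : TangentSpace 𝓘(ℝ, F) x) : (mfderiv 𝓘(ℝ, F) (𝓡 (n + 1)) f x v : Model (n + 1)) =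
      (mfderiv 𝓘(ℝ, F) (𝓡 (n + 1)) f' x v : Model (n + 1)) := by
  rw [h.mfderiv_eq]
  rfl

variable [IsManifold (𝓡 (n + 1)) ∞ M] {g : LorentzianMetric n M}
  {l : ∀ x : M, TangentSpace (𝓡 (n + 1)) x} {A : Set M}

lemma isOpen_transition_source (h : IsAdaptedChart g l A e) (h' : IsAdaptedChart g l A e') {x₀ : C}
    {he : slice e ⊆ C} {he' : slice e' ⊆ C} :
    IsOpen ((sliceChart x₀ e he).symm.trans (sliceChart x₀ e' he')).source := by
  rw [isOpen_iff_mem_nhds]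
  intro a ha
  rw [mem_transition_source] at ha
  filter_upwards [isOpen_slice_target.mem_nhds ha.1, h'.eventually_mem_slice
    h.isOrthogonalOn_sliceMap isOpen_slice_target ha.1 ha.2] with b hb hb'
  exact mem_transition_source.2 ⟨hb, hb'⟩

lemma contDiffOn_transition (h : IsAdaptedChart g l A e) (h' : IsAdaptedChart g l A e') {x₀ : C}
    {he : slice e ⊆ C} {he' : slice e' ⊆ C} :
    ContDiffOn ℝ ∞ ((sliceChart x₀ e he).symm.trans (sliceChart x₀ e' he'))
      ((sliceChart x₀ e he).symm.trans (sliceChart x₀ e' he')).source := by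
  have h1 : ContMDiffOn (𝓡 n) (𝓡 n) ∞ (fun a => ((split n).symm (e' (sliceMap e a))).1)
      ((sliceChart x₀ e he).symm.trans (sliceChart x₀ e' he')).source := by
    have h2 : ContMDiff (𝓡 (n + 1)) (𝓡 n) ∞ fun w : Model (n + 1) => ((split n).symm w).1 :=
      ContDiff.contMDiff (by fun_prop)
    refine h2.comp_contMDiffOn ((contMDiffOn_of_mem_maximalAtlas h'.mem_maximalAtlas).comp
      ((contMDiffOn_sliceMap h.mem_maximalAtlas).mono fun a ha => (mem_transition_source.1 ha).1)
      fun a ha => (mem_transition_source.1 ha).2.1)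
  refine (contMDiffOn_iff_contDiffOn.1 h1).congr fun a ha => ?_
  show ((split n).symm (e' ((sliceChart x₀ e he).symm a : C))).1 = _
  rw [coe_sliceChart_symm x₀ he (mem_transition_source.1 ha).1]

lemma val_eq_zero_of_eq {p p' : M} (h : p = p') {w : Model (n + 1)} (hw : g.val p (l p) w = 0) :
    g.val p' (l p') w = 0 := by
  subst h
  exact hw

lemma IsOrthogonalOn.congr {F : Type*} [NormedAddCommGroup F] [NormedSpace ℝ F] {N : Type*}
    [TopologicalSpace N] [ChartedSpace F N] {f f' : N → M} {O : Set N}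
    (h : IsOrthogonalOn g l F f O) (hO : IsOpen O) (hf : ∀ y ∈ O, f' y = f y) :
    IsOrthogonalOn g l F f' O := by
  refine ⟨h.1.congr hf, fun y hy v => ?_⟩
  have h1 : (mfderiv 𝓘(ℝ, F) (𝓡 (n + 1)) f' y v : Model (n + 1)) =
      (mfderiv 𝓘(ℝ, F) (𝓡 (n + 1)) f y v : Model (n + 1)) :=
    mfderiv_apply_congr (Filter.eventuallyEq_of_mem (hO.mem_nhds hy) hf) v
  exact val_eq_zero_of_eq (hf y hy).symm
    ((congrArg (g.val (f y) (l (f y))) h1).trans (h.2 y hy v))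

/-- Every vector orthogonal to `l` at a point of the slice is tangent to the slice. -/
lemma IsAdaptedChart.exists_mfderiv_sliceMap_eq (h : IsAdaptedChart g l A e) {a : Model n}
    (ha : split n (a, 0) ∈ e.target) {v : Model (n + 1)}
    (hv : g.val (sliceMap e a) (l (sliceMap e a)) v = 0) :
    ∃ b, mfderiv (𝓡 n) (𝓡 (n + 1)) (sliceMap e) a b = v := by
  have he : e.MDifferentiable (𝓡 (n + 1)) (𝓡 (n + 1)) :=
    ⟨(contMDiffOn_of_mem_maximalAtlas h.mem_maximalAtlas).mdifferentiableOn (by simp),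
      (contMDiffOn_symm_of_mem_maximalAtlas h.mem_maximalAtlas).mdifferentiableOn (by simp)⟩
  obtain ⟨w, hw⟩ := (he.symm.mfderiv ha).surjective v
  have hw' : mfderiv (𝓡 (n + 1)) (𝓡 (n + 1)) e.symm (split n (a, 0)) w = v := hw
  have h1 : ((split n).symm w).2 = 0 := by
    rw [← h.tangent a ha w, hw']
    exact hv
  refine ⟨((split n).symm w).1, ?_⟩
  have h2 : split n (((split n).symm w).1, 0) = w := by
    rw [← h1]
    exact (split n).apply_symm_apply w
  rw [mfderiv_sliceMap h.mem_maximalAtlas ha, h2]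
  exact hw'

/-- The points of a leaf set, to be given the leaf topology rather than the topology induced from
the ambient manifold. -/
def LeafSpace (_ : IsLeafSet g l A C) : Type u := C

namespace IsLeafSet

variable (h : IsLeafSet g l A C)

/-- An adapted chart at a point of a leaf set. -/
noncomputable def chart (x : C) : OpenPartialHomeomorph M (Model (n + 1)) :=
  (h.exists_chart x x.2).choose

lemma chart_spec (x : C) : IsAdaptedChart g l A (h.chart x) ∧ (x : M) ∈ slice (h.chart x) :=
  (h.exists_chart x x.2).choose_spec

lemma slice_chart_subset (x : C) : slice (h.chart x) ⊆ C :=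
  h.slice_subset _ (h.chart_spec x).1 ⟨x, (h.chart_spec x).2, x.2⟩

/-- The atlas of a leaf set given by the slices of all adapted charts. -/
noncomputable def core : ChartedSpaceCore (Model n) (LeafSpace h) where
  atlas := {E | ∃ (e : OpenPartialHomeomorph M (Model (n + 1))) (he : slice e ⊆ C),
    IsAdaptedChart g l A e ∧ E = sliceChart ⟨h.nonempty.some, h.nonempty.some_mem⟩ e he}
  chartAt x := sliceChart ⟨h.nonempty.some, h.nonempty.some_mem⟩ (h.chart x)
    (h.slice_chart_subset x)
  mem_chart_source x := (h.chart_spec x).2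
  chart_mem_atlas x := ⟨_, _, (h.chart_spec x).1, rfl⟩
  open_source := by
    rintro _ _ ⟨e, he, hea, rfl⟩ ⟨e', he', hea', rfl⟩
    exact isOpen_transition_source hea hea'
  continuousOn_toFun := by
    rintro _ _ ⟨e, he, hea, rfl⟩ ⟨e', he', hea', rfl⟩
    exact (contDiffOn_transition hea hea').continuousOn

noncomputable instance : TopologicalSpace (LeafSpace h) := h.core.toTopologicalSpace

noncomputable instance : ChartedSpace (Model n) (LeafSpace h) := h.core.toChartedSpace

/-- The inclusion of a leaf set. -/
def incl (x : LeafSpace h) : M := Subtype.val (p := (· ∈ C)) x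

/-- The charts of a leaf are the slices of the adapted charts, not only of those chosen by
`IsLeafSet.chart`. -/
lemma mem_atlas_iff {E : OpenPartialHomeomorph (LeafSpace h) (Model n)} :
    E ∈ atlas (Model n) (LeafSpace h) ↔
      ∃ (e : OpenPartialHomeomorph M (Model (n + 1))) (he : slice e ⊆ C),
        IsAdaptedChart g l A e ∧
        E.toPartialEquiv = sliceChart ⟨h.nonempty.some, h.nonempty.some_mem⟩ e he := by
  show E ∈ ⋃ (e : PartialEquiv (LeafSpace h) (Model n)) (he : e ∈ h.core.atlas),
    {h.core.openPartialHomeomorph e he} ↔ _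
  simp only [mem_iUnion, mem_singleton_iff]
  refine ⟨?_, ?_⟩
  · rintro ⟨_, ⟨e, he, hea, rfl⟩, rfl⟩
    exact ⟨e, he, hea, rfl⟩
  · rintro ⟨e, he, hea, hE⟩
    exact ⟨_, ⟨e, he, hea, rfl⟩, OpenPartialHomeomorph.toPartialEquiv_injective hE⟩

instance : IsManifold (𝓡 n) ∞ (LeafSpace h) := by
  refine isManifold_of_contDiffOn _ _ _ fun E E' hE hE' => ?_
  obtain ⟨e, he, hea, h1⟩ := h.mem_atlas_iff.1 hE
  obtain ⟨e', he', hea', h2⟩ := h.mem_atlas_iff.1 hE'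
  have h3 := contDiffOn_transition hea hea' (x₀ := ⟨h.nonempty.some, h.nonempty.some_mem⟩)
    (he := he) (he' := he')
  have h4 : (E.symm ≫ₕ E').toPartialEquiv = E.toPartialEquiv.symm.trans E'.toPartialEquiv := rfl
  have h5 : ContDiffOn ℝ ∞ (E.symm ≫ₕ E').toPartialEquiv (E.symm ≫ₕ E').toPartialEquiv.source := by
    rw [h4, h1, h2]
    exact h3
  simpa using h5

lemma injective_incl : Function.Injective h.incl := Subtype.val_injective

lemma range_incl : range h.incl = C := Subtype.range_val

/-- A chart of the leaf together with the adapted chart defining it. -/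
lemma exists_chart_pair (x : LeafSpace h) :
    ∃ (E : OpenPartialHomeomorph (LeafSpace h) (Model n))
      (e : OpenPartialHomeomorph M (Model (n + 1))),
      IsAdaptedChart g l A e ∧ E ∈ atlas (Model n) (LeafSpace h) ∧ x ∈ E.source ∧
      (∀ y, y ∈ E.source ↔ h.incl y ∈ slice e) ∧ (∀ a, a ∈ E.target ↔ split n (a, 0) ∈ e.target) ∧
      ∀ a ∈ E.target, h.incl (E.symm a) = sliceMap e a := by
  refine ⟨chartAt (Model n) x, h.chart x, (h.chart_spec x).1, chart_mem_atlas _ _,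
    ChartedSpace.mem_chart_source x, fun y => Iff.rfl, fun a => Iff.rfl, fun a ha => ?_⟩
  exact coe_sliceChart_symm _ (h.slice_chart_subset x) ha

lemma isImmersion_incl : Manifold.IsImmersion (𝓡 n) (𝓡 (n + 1)) ∞ h.incl := by
  refine Manifold.IsImmersionOfComplement.isImmersion (F := ℝ) fun x => ?_
  obtain ⟨E, e, he, hE, hx, hsrc, htgt, hsymm⟩ := h.exists_chart_pair x
  refine Manifold.IsImmersionAtOfComplement.mk_of_charts (split n) E e hx ((hsrc x).1 hx).1
    (IsManifold.subset_maximalAtlas hE) he.mem_maximalAtlas (fun y hy => ((hsrc y).1 hy).1)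
    fun a ha => ?_
  have ha' : a ∈ E.target := by simpa using ha
  show e (h.incl (E.symm a)) = split n (a, 0)
  rw [hsymm a ha', sliceMap, e.right_inv ((htgt a).1 ha')]

/-- A leaf set as an injectively immersed hypersurface. -/
noncomputable def submanifold : ImmersedSubmanifold n (n + 1) M where
  carrier := LeafSpace h
  incl := h.incl
  injective := h.injective_incl
  isImmersion := h.isImmersion_incl

lemma support_submanifold : h.submanifold.support = C := h.range_incl

lemma isOrthogonalOn_incl : IsOrthogonalOn g l (Model n) h.incl univ := by
  have h1 : ∀ x : LeafSpace h, ∃ O : Set (LeafSpace h), IsOpen O ∧ x ∈ O ∧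
      IsOrthogonalOn g l (Model n) h.incl O := fun x => by
    obtain ⟨E, e, he, hE, hx, hsrc, htgt, hsymm⟩ := h.exists_chart_pair x
    refine ⟨E.source, E.open_source, hx, IsOrthogonalOn.congr (he.isOrthogonalOn_sliceMap.comp
      isOpen_slice_target ((contMDiffOn_of_mem_maximalAtlas (I := 𝓡 n) (n := ∞)
        (IsManifold.subset_maximalAtlas hE)).of_le (by simp)) E.open_source fun y hy => ?_)
      E.open_source fun y hy => ?_⟩
    · exact (htgt _).1 (E.map_source hy)
    · show h.incl y = sliceMap e (E y)
      rw [← hsymm _ (E.map_source hy), E.left_inv hy]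
  refine ⟨fun x _ => ?_, fun x _ v => ?_⟩
  · obtain ⟨O, hO, hx, hf⟩ := h1 x
    exact (hf.1.contMDiffAt (hO.mem_nhds hx)).contMDiffWithinAt
  · obtain ⟨O, hO, hx, hf⟩ := h1 x
    exact hf.2 x hx v

/-- A leaf is an integral manifold of the orthogonal complement of `l`. -/
lemma mem_tangent_submanifold_iff (x : h.submanifold.carrier)
    (v : TangentSpace (𝓡 (n + 1)) (h.submanifold.incl x)) :
    v ∈ h.submanifold.tangent x ↔ g.val (h.submanifold.incl x) (l (h.submanifold.incl x)) v = 0 := by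
  refine ⟨?_, fun hv => ?_⟩
  · rintro ⟨w, rfl⟩
    exact h.isOrthogonalOn_incl.2 x (mem_univ x) w
  obtain ⟨E, e, he, hE, hx, hsrc, htgt, hsymm⟩ := h.exists_chart_pair x
  obtain ⟨a, ha, rfl⟩ : ∃ a ∈ E.target, E.symm a = x := ⟨E x, E.map_source hx, E.left_inv hx⟩
  obtain ⟨b, hb⟩ := he.exists_mfderiv_sliceMap_eq ((htgt a).1 ha)
    (val_eq_zero_of_eq (hsymm a ha) hv)
  have h3 : MDifferentiableAt (𝓡 n) (𝓡 n) E.symm a :=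
    mdifferentiableAt_atlas_symm hE ha
  have h4 : MDifferentiableAt (𝓡 n) (𝓡 (n + 1)) h.incl (E.symm a) :=
    (h.isOrthogonalOn_incl.1.contMDiffAt univ_mem).mdifferentiableAt one_ne_zero
  have h5 : mfderiv (𝓡 n) (𝓡 (n + 1)) (h.incl ∘ E.symm) a = _ := mfderiv_comp a h4 h3
  have h6 : (mfderiv (𝓡 n) (𝓡 (n + 1)) (h.incl ∘ E.symm) a b : Model (n + 1)) =
      (mfderiv (𝓡 n) (𝓡 (n + 1)) (sliceMap e) a b : Model (n + 1)) :=
    mfderiv_apply_congr (Filter.eventuallyEq_of_mem (E.open_target.mem_nhds ha) hsymm) b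
  refine ⟨mfderiv (𝓡 n) (𝓡 n) E.symm a b, ?_⟩
  rw [← hb, ← h6, h5]
  rfl

end IsLeafSet

variable (g l A) in
/-- The points which can be joined to `q` by a finite chain of slices of adapted charts. -/
def leaf (q : M) : Set M :=
  {y | Relation.EqvGen (fun x y => ∃ e, IsAdaptedChart g l A e ∧ x ∈ slice e ∧ y ∈ slice e) q y}

/-- Chains of slices stay in `A`, and each slice extends a chain by one step. -/
lemma isLeafSet_leaf (hA : ∀ x ∈ A, ∃ e, IsAdaptedChart g l A e ∧ x ∈ slice e) {q : M}
    (hq : q ∈ A) : IsLeafSet g l A (leaf g l A q) where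
  nonempty := ⟨q, .refl q⟩
  exists_chart x hx := by
    have h1 : ∀ x y, Relation.EqvGen
        (fun x y => ∃ e, IsAdaptedChart g l A e ∧ x ∈ slice e ∧ y ∈ slice e) x y →
        (x ∈ A ↔ y ∈ A) := fun x y hxy => by
      induction hxy with
      | rel x y h =>
        obtain ⟨e, he, hx, hy⟩ := h
        exact ⟨fun _ => he.slice_subset hy, fun _ => he.slice_subset hx⟩
      | refl x => exact Iff.rfl
      | symm x y _ ih => exact ih.symm
      | trans x y z _ _ ih ih' => exact ih.trans ih'
    exact hA x ((h1 _ _ hx).1 hq)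
  slice_subset := by
    rintro e he ⟨x, hxe, hx⟩ y hy
    exact .trans _ _ _ hx (.rel _ _ ⟨e, he, hxe, hy⟩)

/-- The slices are homeomorphic to balls, and so are connected in the leaf topology; hence chains
of slices stay in one connected component. -/
lemma connectedSpace_leaf {q : M} (h : IsLeafSet g l A (leaf g l A q)) :
    ConnectedSpace (LeafSpace h) := by
  have h1 : ∀ e, IsAdaptedChart g l A e → ∀ x y : LeafSpace h, h.incl x ∈ slice e →
      h.incl y ∈ slice e → connectedComponent x = connectedComponent y := fun e he x y hx hy => by
    have hsub : slice e ⊆ leaf g l A q := h.slice_subset e he ⟨_, hx, x.2⟩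
    have hE : sliceChart ⟨h.nonempty.some, h.nonempty.some_mem⟩ e hsub ∈ h.core.atlas :=
      ⟨e, hsub, he, rfl⟩
    set E : OpenPartialHomeomorph (LeafSpace h) (Model n) :=
      h.core.openPartialHomeomorph (sliceChart ⟨h.nonempty.some, h.nonempty.some_mem⟩ e hsub) hE
    obtain ⟨ρ, hρ⟩ := he.exists_ball
    have h2 : E.target = Metric.ball 0 ρ := Set.ext hρ
    have h3 : IsPreconnected E.source := by
      rw [← E.symm_image_target_eq_source]
      refine IsPreconnected.image ?_ _ E.continuousOn_symm
      rw [h2]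
      exact (convex_ball _ _).isPreconnected
    exact connectedComponent_eq (h3.subset_connectedComponent (x := x) hx hy)
  have h2 : ∀ a b, Relation.EqvGen
      (fun x y => ∃ e, IsAdaptedChart g l A e ∧ x ∈ slice e ∧ y ∈ slice e) a b →
      ∀ x y : LeafSpace h, h.incl x = a → h.incl y = b →
        connectedComponent x = connectedComponent y := fun a b hab => by
    induction hab with
    | rel a b hab =>
      rintro x y rfl rfl
      obtain ⟨e, he, hx, hy⟩ := hab
      exact h1 e he x y hx hy
    | refl a =>
      rintro x y rfl hy
      rw [h.injective_incl hy]
    | symm a b _ ih => exact fun x y hx hy => (ih y x hy hx).symm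
    | trans a b c hab _ ih ih' =>
      intro x z hx hz
      have hb : b ∈ leaf g l A q := .trans _ _ _ (hx ▸ x.2 : a ∈ leaf g l A q) hab
      exact (ih x ⟨b, hb⟩ hx rfl).trans (ih' ⟨b, hb⟩ z rfl hz)
  let q' : LeafSpace h := ⟨q, .refl q⟩
  have h3 : connectedComponent q' = univ := eq_univ_of_forall fun y => by
    rw [h2 q _ y.2 q' y rfl rfl]
    exact mem_connectedComponent
  have h4 : PreconnectedSpace (LeafSpace h) := ⟨h3 ▸ isPreconnected_connectedComponent⟩
  exact { toNonempty := ⟨q'⟩ }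

end LeafManifold

/-! ### Integral manifolds and geodesics -/

section Global

open LorentzGeom

universe u

variable {n r : ℕ} {M : Type u} [TopologicalSpace M] [ChartedSpace (Model (n + 1)) M]
  [IsManifold (𝓡 (n + 1)) ∞ M] {g : LorentzianMetric n M}
  {l : ∀ x : M, TangentSpace (𝓡 (n + 1)) x} {A C : Set M} {N : ImmersedSubmanifold n (n + 1) M}

/-- For dimensional reasons, `l` has no zero on an integral manifold of its orthogonal
complement. -/
lemma ne_zero_of_tangent_eq {x : N.carrier}
    (h : ∀ v : TangentSpace (𝓡 (n + 1)) (N.incl x),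
      v ∈ N.tangent x ↔ g.val (N.incl x) (l (N.incl x)) v = 0) : l (N.incl x) ≠ 0 := fun h0 => by
  have h1 : N.tangent x = ⊤ := eq_top_iff.2 fun v _ => (h v).2 (by rw [h0, map_zero]; rfl)
  let D : Model n →ₗ[ℝ] Model (n + 1) := (mfderiv (𝓡 n) (𝓡 (n + 1)) N.incl x).toLinearMap
  have h2 : LinearMap.range D = ⊤ := h1
  have h3 := LinearMap.finrank_range_le D
  rw [h2, finrank_top] at h3
  simp at h3

lemma isOrthogonalOn_of_tangent_eq
    (h : ∀ (x : N.carrier) (v : TangentSpace (𝓡 (n + 1)) (N.incl x)),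
      v ∈ N.tangent x ↔ g.val (N.incl x) (l (N.incl x)) v = 0) :
    IsOrthogonalOn g l (Model n) N.incl univ :=
  ⟨(N.isImmersion.contMDiff.of_le (by simp)).contMDiffOn, fun x _ v => (h x _).1 ⟨v, rfl⟩⟩

/-- A connected integral manifold which meets a leaf set is contained in it. -/
lemma IsLeafSet.support_subset (h : IsLeafSet g l A C)
    (hA : ∀ x ∈ closure A, l x ≠ 0 → ∃ e, IsAdaptedChart g l A e ∧ x ∈ slice e) {F : Set M}
    (hN : g.IsIntegralManifold l F N) (hC : (N.support ∩ C).Nonempty) : N.support ⊆ C := by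
  obtain ⟨hc, -, ht⟩ := hN
  obtain ⟨_, ⟨x, rfl⟩, hx⟩ := hC
  have : IsManifold 𝓘(ℝ, Model n) 1 N.carrier := IsManifold.of_le (n := ∞) (by simp)
  rintro _ ⟨y, rfl⟩
  exact h.mapsTo hA (isOrthogonalOn_of_tangent_eq ht) isOpen_univ isPreconnected_univ
    (fun y _ => ne_zero_of_tangent_eq (ht y)) (mem_univ x) hx (mem_univ y)

lemma isIntegralManifold_leaf {q : M} (h : IsLeafSet g l A (leaf g l A q)) {F : Set M}
    (hF : A ⊆ F) : g.IsIntegralManifold l F h.submanifold :=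
  ⟨connectedSpace_leaf h, h.support_submanifold.subset.trans (h.subset.trans hF),
    h.mem_tangent_submanifold_iff⟩

section Geodesics

variable {K : Fin (r + 1) → ∀ x : M, TangentSpace (𝓡 (n + 1)) x} {γ : ℝ → M} {J : Set ℝ}

lemma fderiv_inChart {x₀ : M} {z : Model (n + 1)} (hz : z ∈ (extChartAt (𝓡 (n + 1)) x₀).target)
    (u v w : Model (n + 1)) : fderiv ℝ (fun z => g.inChart x₀ z v w) z u =
      fderiv ℝ (coordMetric g x₀) z u v w := by
  have h1 := hasFDerivAt_of_contDiffOn (isOpen_extChartAt_target x₀)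
    (contDiffOn_coordMetric g x₀) hz
  have h2 := (h1.clm_apply (hasFDerivAt_const v z)).clm_apply (hasFDerivAt_const w z)
  show fderiv ℝ (fun z => coordMetric g x₀ z v w) z u = _
  rw [h2.fderiv]
  simp

/-- The product of a Killing field with the velocity has vanishing derivative along a geodesic. -/
lemma hasDerivAt_val_velocity [T2Space M] (hKilling : ∀ μ, g.IsKilling (K μ))
    (hComm : ∀ μ ν, ∀ x : M, VectorField.mlieBracket (𝓡 (n + 1)) (K μ) (K ν) x = 0)
    (hInt : g.OrthogonallyIntegrable K) (hJ : IsOpen J) (hγ : g.IsGeodesicOn γ J)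
    (c : Fin (r + 1) → ℝ) {t : ℝ} (ht : t ∈ J) :
    HasDerivAt (fun s => g.val (γ s) (combination K c (γ s))
      (mfderiv 𝓘(ℝ, ℝ) (𝓡 (n + 1)) γ s (1 : ℝ))) 0 t := by
  set φ := extChartAt (𝓡 (n + 1)) (γ t) with hφ
  set y : ℝ → Model (n + 1) := fun s => φ (γ s) with hy
  have S := isKillingSystem_chart hKilling hComm hInt (γ t)
  set O : Set ℝ := J ∩ γ ⁻¹' (chartAt (Model (n + 1)) (γ t)).source with hO
  have hOo : IsOpen O := hγ.1.continuousOn.isOpen_inter_preimage hJ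
    (chartAt (Model (n + 1)) (γ t)).open_source
  have htO : t ∈ O := ⟨ht, ChartedSpace.mem_chart_source _⟩
  have hφs : ContMDiffOn (𝓡 (n + 1)) 𝓘(ℝ, Model (n + 1)) 2 φ
      (chartAt (Model (n + 1)) (γ t)).source :=
    (contMDiffOn_extChartAt (I := 𝓡 (n + 1)) (n := ∞) (x := γ t)).of_le
      (show ((2 : ℕ∞) : WithTop ℕ∞) ≤ ((⊤ : ℕ∞) : WithTop ℕ∞) from WithTop.coe_le_coe.2 le_top)
  have hy2 : ContDiffOn ℝ 2 y O :=
    contMDiffOn_iff_contDiffOn.1 (hφs.comp (hγ.1.mono inter_subset_left) fun s hs => hs.2)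
  have hy1 : ContDiffOn ℝ 1 (deriv y) O := hy2.deriv_of_isOpen hOo (by norm_num)
  have hd1 : HasDerivAt y (deriv y t) t :=
    ((hy2.contDiffAt (hOo.mem_nhds htO)).differentiableAt (by simp)).hasDerivAt
  have hd2 : HasDerivAt (deriv y) (deriv (deriv y) t) t :=
    ((hy1.contDiffAt (hOo.mem_nhds htO)).differentiableAt (by simp)).hasDerivAt
  have hyt : y t ∈ φ.target := mem_extChartAt_target (γ t)
  have hgeo : GeodesicEq (coordMetric g (γ t)) (y t) (deriv y t) (deriv (deriv y) t) := fun w => by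
    have h1 := hγ.2 t ht w
    have h2 : g.inChart (γ t) (y t) (deriv (deriv y) t) w
        + g.christoffel (γ t) (y t) (deriv y t) (deriv y t) w = 0 := h1
    rw [LorentzianMetric.christoffel, fderiv_inChart hyt, fderiv_inChart hyt,
      inChart_eq_coordMetric] at h2
    linarith
  have hg := (hasFDerivAt_of_contDiffOn S.isOpen S.smooth_metric hyt).comp_hasDerivAt t hd1
  have hk := ((hasFDerivAt_of_contDiffOn S.isOpen S.smooth_field hyt).comp_hasDerivAt t
    hd1).clm_apply (hasDerivAt_const t c)
  have h3 := (hg.clm_apply hk).clm_apply hd2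
  refine (h3.congr_deriv ?_).congr_of_eventuallyEq ?_
  · have := S.geodesic_conservation hyt hgeo c
    simpa using this
  · filter_upwards [hOo.mem_nhds htO] with s hs
    have h4 := (hφs.contMDiffAt ((chartAt (Model (n + 1)) (γ t)).open_source.mem_nhds
      hs.2)).mdifferentiableAt two_ne_zero
    have h5 := (hγ.1.contMDiffAt (hJ.mem_nhds hs.1)).mdifferentiableAt two_ne_zero
    have h6 : mfderiv 𝓘(ℝ, ℝ) 𝓘(ℝ, Model (n + 1)) y s = _ := mfderiv_comp s h4 h5
    rw [mfderiv_eq_fderiv] at h6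
    rw [← coordMetric_coordFrame_mfderiv hs.2]
    have h7 : deriv y s = mfderiv (𝓡 (n + 1)) 𝓘(ℝ, Model (n + 1)) φ (γ s)
        (mfderiv 𝓘(ℝ, ℝ) (𝓡 (n + 1)) γ s (1 : ℝ)) := by
      rw [← fderiv_apply_one_eq_deriv]
      exact DFunLike.congr_fun h6 (1 : ℝ)
    exact (congrArg _ h7).symm

/-- A geodesic orthogonal to a Killing field at one parameter is orthogonal to it throughout. -/
lemma isOrthogonalOn_geodesic [T2Space M] (hKilling : ∀ μ, g.IsKilling (K μ))
    (hComm : ∀ μ ν, ∀ x : M, VectorField.mlieBracket (𝓡 (n + 1)) (K μ) (K ν) x = 0)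
    (hInt : g.OrthogonallyIntegrable K) (hJ : IsOpen J) (hJ' : IsPreconnected J)
    (hγ : g.IsGeodesicOn γ J) {c : Fin (r + 1) → ℝ} {t₀ : ℝ} (ht₀ : t₀ ∈ J)
    (h0 : g.val (γ t₀) (combination K c (γ t₀))
      (mfderiv 𝓘(ℝ, ℝ) (𝓡 (n + 1)) γ t₀ (1 : ℝ)) = 0) :
    IsOrthogonalOn g (combination K c) ℝ γ J := by
  refine ⟨hγ.1.of_le one_le_two, fun t ht v => ?_⟩
  have hd := fun t ht => hasDerivAt_val_velocity hKilling hComm hInt hJ hγ c (t := t) ht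
  have h1 := hJ.is_const_of_deriv_eq_zero hJ'
    (fun t ht => (hd t ht).differentiableAt.differentiableWithinAt) (fun t ht => (hd t ht).deriv)
    ht ht₀
  let D : ℝ →L[ℝ] Model (n + 1) := mfderiv 𝓘(ℝ, ℝ) (𝓡 (n + 1)) γ t
  let G : Model (n + 1) →L[ℝ] ℝ := g.val (γ t) (combination K c (γ t))
  have h2 : G (D 1) = 0 := h1.trans h0
  have h3 : ∀ a : ℝ, G (D a) = 0 := fun a => by
    rw [← mul_one a, ← smul_eq_mul, map_smul, map_smul, h2, smul_zero]
  exact h3 v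

end Geodesics

section Horizon

variable {K : Fin (r + 1) → ∀ x : M, TangentSpace (𝓡 (n + 1)) x} {c : Fin (r + 1) → ℝ}

lemma continuous_areaFunction (hK : ∀ μ, IsSmoothField (K μ)) : Continuous (g.areaFunction K) := by
  have h : Continuous fun x => Matrix.of fun μ ν : Fin (r + 1) => g.pair (K μ) (K ν) x :=
    continuous_matrix fun μ ν => (contMDiff_pair g (hK μ) (hK ν)).continuous
  exact h.matrix_det.neg

/-- The equations `W = 0` and `g(l, l) = 0` persist on the closure of the set of regular points. -/
lemma closure_regularPoints_subset (hK : ∀ μ, IsSmoothField (K μ)) (hc : c ≠ 0) :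
    closure (regularPoints g K c) ⊆
      {x | g.areaFunction K x = 0 ∧ g.pair (combination K c) (combination K c) x = 0} := by
  have h1 := isSmoothField_combination hK c
  refine closure_minimal (fun x hx => ⟨(areaFunction_eq_zero_iff x).2 ⟨c, hc, hx.2⟩,
    pair_self_of_orthogonal hx.2⟩) ?_
  exact (isClosed_eq (continuous_areaFunction hK) continuous_const).inter
    (isClosed_eq (contMDiff_pair g h1 h1).continuous continuous_const)

end Horizon

end Global
end KillingGeometry

theorem mainTheorem11 {n r : ℕ} {M : Type*} [TopologicalSpace M] [T2Space M]
    [SecondCountableTopology M] [ChartedSpace (LorentzGeom.Model (n + 1)) M]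
    [IsManifold (𝓡 (n + 1)) ∞ M] (g : LorentzGeom.LorentzianMetric n M)
    (K : Fin (r + 1) → ∀ x : M, TangentSpace (𝓡 (n + 1)) x)
    (hKilling : ∀ μ, g.IsKilling (K μ))
    (hIndep : LinearIndependent ℝ K)
    (hComm : ∀ μ ν, ∀ x : M, VectorField.mlieBracket (𝓡 (n + 1)) (K μ) (K ν) x = 0)
    (hInt : g.OrthogonallyIntegrable K)
    (hStrat : g.DegeneracyStratified K)
    (hSpacelike : ∀ (i : Fin r) (x : M), K i.succ x ≠ 0 → 0 < g.pair (K i.succ) (K i.succ) x)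
    (p : M) (hW : g.areaFunction K p = 0)
    (hp : p ∉ LorentzGeom.LorentzianMetric.degeneracySet K)
    (hh : IsUnit (g.gram K p).det) :
    p ∈ g.horizonSet K p ∧
    g.IsIntegrableOver (g.generator K p) (g.horizonSet K p) ∧
    (∀ q ∈ g.horizonSet K p, ∃ S : LorentzGeom.ImmersedSubmanifold n (n + 1) M,
      g.IsMaximalLeaf (g.generator K p) {x | g.areaFunction K x = 0} S ∧ q ∈ S.support) ∧
    (∀ S : LorentzGeom.ImmersedSubmanifold n (n + 1) M,
      g.IsMaximalLeaf (g.generator K p) {x | g.areaFunction K x = 0} S →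
      (S.support ∩ g.horizonSet K p).Nonempty →
        S.support ⊆ g.horizonSet K p ∧
        g.IsKillingPrehorizon (g.generator K p) S ∧
        g.IsTotallyGeodesicIn S {x | g.generator K p x ≠ 0}) := by
  open KillingGeometry in
  have hgen : g.generator K p = combination K (generatorCoeff g K p) :=
    funext fun x => generator_eq_combination p x
  rw [horizonSet_eq, hgen]
  have hc0 := generatorCoeff_ne_zero (g := g) (K := K) p
  have hpR := mem_regularPoints hW hp hh
  set c := generatorCoeff g K p
  set l := combination K c
  set A : Set M := closure (regularPoints g K c) \ {x | l x = 0} with hAdef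
  have hAW := closure_regularPoints_subset (g := g) (fun μ => (hKilling μ).1) hc0
  have hchart : ∀ x ∈ closure A, l x ≠ 0 → ∃ e, IsAdaptedChart g l A e ∧ x ∈ slice e :=
    fun x hx hlx => exists_isAdaptedChart hKilling hComm hInt
      (closure_minimal Set.sdiff_subset isClosed_closure hx) hlx
  have hleafSet : ∀ q ∈ A, IsLeafSet g l A (leaf g l A q) := fun q hq =>
    isLeafSet_leaf (fun x hx => hchart x (subset_closure hx) hx.2) hq
  have hAF : A ⊆ {x | g.areaFunction K x = 0} := fun x hx => (hAW hx.1).1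
  have hmax : ∀ q (hq : q ∈ A), g.IsMaximalLeaf l {x | g.areaFunction K x = 0}
      (hleafSet q hq).submanifold := fun q hq =>
    ⟨isIntegralManifold_leaf _ hAF, fun N hN hne => by
      rw [IsLeafSet.support_submanifold] at hne ⊢
      exact (hleafSet q hq).support_subset hchart hN hne⟩
  have hmem : ∀ q (hq : q ∈ A), q ∈ (hleafSet q hq).submanifold.support := fun q hq => by
    rw [IsLeafSet.support_submanifold]
    exact .refl q
  refine ⟨⟨subset_closure hpR, combination_ne_zero hpR.1 hc0⟩,
    fun q hq => ⟨(hleafSet q hq).submanifold, isIntegralManifold_leaf _ subset_rfl, hmem q hq⟩,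
    fun q hq => ⟨(hleafSet q hq).submanifold, hmax q hq, hmem q hq⟩, ?_⟩
  rintro S ⟨hS, hSmax⟩ ⟨q, hqS, hq⟩
  have hL := hleafSet q hq
  -- by maximality, the support is the leaf of `q`
  have hsup : S.support = leaf g l A q := by
    refine Set.Subset.antisymm (hL.support_subset hchart hS ⟨q, hqS, .refl q⟩) ?_
    rw [← hL.support_submanifold]
    exact hSmax _ (hmax q hq).1 ⟨q, hmem q hq, hqS⟩
  have hSA : S.support ⊆ A := hsup ▸ hL.subset
  have hmemS : ∀ x : S.carrier, S.incl x ∈ A := fun x => hSA ⟨x, rfl⟩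
  have hll : ∀ x : S.carrier, g.val (S.incl x) (l (S.incl x)) (l (S.incl x)) = 0 := fun x =>
    (hAW (hmemS x).1).2
  have hltan : ∀ x : S.carrier, l (S.incl x) ∈ S.tangent x := fun x =>
    (hS.2.2 x _).2 (hll x)
  refine ⟨hSA, ⟨isKilling_combination hKilling c, hS.1, fun x => ⟨l (S.incl x), hltan x,
    (hmemS x).2, fun w hw => (hS.2.2 x w).1 hw⟩, fun x hx => ⟨(hAW (hSA hx).1).2, (hSA hx).2⟩,
    hltan⟩, ?_⟩
  intro γ J t₀ hJ hJ' ht₀ hγ hm htan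
  obtain ⟨⟨x, w⟩, hxw⟩ := htan
  have hJc : IsPreconnected J := hJ'.isPreconnected
  -- the initial velocity is orthogonal to the generator
  let G : TangentBundle (𝓡 (n + 1)) M → ℝ := fun y => g.val y.1 (l y.1) y.2
  have h0 : g.val (γ t₀) (l (γ t₀)) (mfderiv 𝓘(ℝ, ℝ) (𝓡 (n + 1)) γ t₀ (1 : ℝ)) = 0 := by
    have h1 : g.val (S.incl x) (l (S.incl x)) (mfderiv (𝓡 n) (𝓡 (n + 1)) S.incl x w) = 0 :=
      (hS.2.2 x _).1 ⟨w, rfl⟩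
    exact (congrArg G hxw).symm.trans h1
  have hx : S.incl x = γ t₀ := congrArg Bundle.TotalSpace.proj hxw
  rw [hsup]
  refine hL.mapsTo hchart (isOrthogonalOn_geodesic hKilling hComm hInt hJ hJc hγ ht₀ h0) hJ hJc
    (fun t ht => hm ht) ht₀ ?_
  rw [← hsup]
  exact ⟨x, hx⟩
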